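/- **Proposition 3.2.** Let $n\ge 2$, $\lambda,\mu>0$, $B_1=\{x\in\mathbb R^n:|x|<1\}$, $B_1^+=B_1\cap\{x_n>0\}$, $B_1'=B_1\cap\{x_n=0\}$, and identify $\mathbb R^{n-1}\times\{0\}$ with $\mathbb R^{n-1}$. Let $\varphi\in H^{1/2}(B_1')$, $F\in L^2(B_1^+;\mathbb R^n)$, and let $u=(u^1,\dots,u^n)\in H^1(B_1^+;\mathbb R^n)$ be a weak solution of the thin obstacle problem for the Lamé system $$\mu\Delta u^j+(\mu+\lambda)\partial_j \operatorname{div}u=F^j\ \text{ in }B_1^+\ (1\le j\le n),\qquad \partial_nu^j+\partial_ju^n=0\ \text{ on }B_1'\ (1\le j\le n-1),$$ $$u^n\ge\varphi,\qquad -2\mu\partial_nu^n-\lambda\operatorname{div}u\ge0,\qquad (u^n-\varphi)(2\mu\partial_nu^n+\lambda\operatorname{div}u)=0\ \text{ on }B_1',$$ that is, $u^n\ge\varphi$ a.e. on $B_1'$ and, with $e(u)=\frac12(\nabla u+(\nabla u)^T)$, $$\int_{B_1^+}2\mu\, e(u):e(\zeta-u)+\lambda \operatorname{div}u\,\operatorname{div}(\zeta-u)\,dx\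 \ge\ -\int_{B_1^+}F\cdot(\zeta-u)\,dx$$ for all $\zeta\in H^1(B_1^+;\mathbb R^n)$ with $\zeta^n\ge\varphi$ a.e. on $B_1'$ and $\zeta=u$ on $\partial B_1\cap\{x_n>0\}$ (in the sense of traces). Let $\eta:\mathbb R^n\to[0,\infty)$ be smooth and radial (depending only on $|x|$), with $\eta=1$ in a ball $B_r(x_0)\subset B_1$ for some $r\in(0,1)$, $x_0\in B_1'$, and $\eta=0$ outside $B_1$. Write $\bar v(x')=u^n(x',0)\eta(x',0)$ and $(\varphi\eta)(x')=\varphi(x')\eta(x',0)$, extended by $0$ outside $B_1'$. For $s>0$ let $\dot H^{s}(\mathbb R^{n-1})$ be the space of real functions $f$ that are tempered distributions with $\hat f\in L^1_{loc}$ and $|\xi|^{s}\hat f\in L^2$, let $H^{s}=L^2\cap\dot H^{s}$, and let $\tilde a(v_1,v_2)=\int_{\mathbb R^{n-1}}(-\Delta)^{1/4}v_1\,(-\Delta)^{1/4}v_2\,dx'$. Then there are $h\in L^2(\mathbb R^{n-1})$ and $\bar w\in\dot H^{1/2}(\mathbb R^{n-1})$ with the following properties. 1. $\tilde v:=\bar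 v-\bar w$ and $\psi:=\varphi\eta-\bar w$ belong to $\dot H^{1/2}(\mathbb R^{n-1})$, and $\tilde v$ is a weak solution of the obstacle problem $\min\{(-\Delta)^{1/2}\tilde v,\tilde v-\psi\}=0$ in $\mathbb R^{n-1}$, i.e. $\tilde v\ge\psi$ a.e. and $\tilde a(\tilde v,\tilde\zeta-\tilde v)\ge0$ for all $\tilde\zeta\in\dot H^{1/2}(\mathbb R^{n-1})$ with $\tilde\zeta\ge\psi$ a.e. 2. The contact sets agree where $\eta>0$: $\{x':\tilde v=\psi\}\cap\{\eta(\cdot,0)>0\}=\{x'\in B_1':u^n=\varphi\}\cap\{\eta(\cdot,0)>0\}$. 3. $\bar v\in H^{1/2}(\mathbb R^{n-1})$ is a weak solution of the obstacle problem with obstacle $\varphi\eta$ and right-hand side $h$: $\bar v\ge\varphi\eta$ a.e. and $\tilde a(\bar v,\zeta-\bar v)\ge\int_{\mathbb R^{n-1}}h(\zeta-\bar v)\,dx'$ for all $\zeta\in H^{1/2}(\mathbb R^{n-1})$ with $\zeta\ge\varphi\eta$ a.e. 4. If $n\ge3$, then $\bar w=(-\Delta)^{-1/2}h$, i.e. $(-\Delta)^{1/2}\bar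 w=h$; in particular $\bar w\in\dot H^{1}(\mathbb R^{n-1})$. -/

import Mathlib

open MeasureTheory Set
open scoped FourierTransform SchwartzMap ContDiff

/-- The Euclidean space `ℝᵏ`. -/
abbrev Eucl (k : ℕ) := EuclideanSpace ℝ (Fin k)

/-- The identification `x' ↦ (x', 0)` of `ℝᵈ` with `ℝᵈ × {0} ⊆ ℝᵈ⁺¹`. -/
noncomputable def flat {d : ℕ} (x : Eucl d) : Eucl (d + 1) :=
  WithLp.toLp 2 (Fin.snoc (α := fun _ => ℝ) x.ofLp 0)

/-- The open upper half ball `B₁⁺ = {x ∈ ℝᵈ⁺¹ : |x| < 1, x_{d+1} > 0}`. -/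
def halfBall (d : ℕ) : Set (Eucl (d + 1)) :=
  {x | ‖x‖ < 1 ∧ 0 < x (Fin.last d)}

/-- The flat boundary part `B₁'`, as the open unit ball of `ℝᵈ`. -/
def flatBall (d : ℕ) : Set (Eucl d) := Metric.ball 0 1

/-- The classical partial derivative `∂ᵢ θ`. -/
noncomputable def partialDeriv {k : ℕ} (i : Fin k) (θ : Eucl k → ℝ) (x : Eucl k) : ℝ :=
  fderiv ℝ θ x (EuclideanSpace.single i 1)

/-- `θ ∈ C_c^∞(U)`. -/
def IsTest {k : ℕ} (U : Set (Eucl k)) (θ : Eucl k → ℝ) : Prop :=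
  ContDiff ℝ ∞ θ ∧ HasCompactSupport θ ∧ tsupport θ ⊆ U

/-! ### The space `H¹(B₁⁺)` -/

/-- `f ∈ H¹(B₁⁺)`, with weak gradient `Df`. -/
structure HasH1Gradient {d : ℕ} (f : Eucl (d + 1) → ℝ)
    (Df : Eucl (d + 1) → Fin (d + 1) → ℝ) : Prop where
  memLp : MemLp f 2 (volume.restrict (halfBall d))
  memLp_grad : ∀ i, MemLp (fun x => Df x i) 2 (volume.restrict (halfBall d))
  weak_deriv : ∀ θ, IsTest (halfBall d) θ → ∀ i,
    ∫ x in halfBall d, f x * partialDeriv i θ x = - ∫ x in halfBall d, Df x i * θ x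

/-- `t` is the trace on `B₁'` of the function `f ∈ H¹(B₁⁺)` with weak gradient `Df`. The trace
is characterised by Green's formula in the normal direction, tested with functions that need not
vanish on `B₁'` (the outer normal there is `-e_{d+1}`). -/
def HasFlatTrace {d : ℕ} (f : Eucl (d + 1) → ℝ) (Df : Eucl (d + 1) → Fin (d + 1) → ℝ)
    (t : Eucl d → ℝ) : Prop :=
  LocallyIntegrableOn t (flatBall d) ∧
  ∀ θ, IsTest (Metric.ball 0 1) θ →
    ∫ x in halfBall d, (f x * partialDeriv (Fin.last d) θ x + Df x (Fin.last d) * θ x)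
      = - ∫ y in flatBall d, t y * θ (flat y)

/-- The function `f ∈ H¹(B₁⁺)` with weak gradient `Df` has zero trace on the curved boundary
part `∂B₁ ∩ {x_{d+1} > 0}`: no boundary term occurs in Green's formula for test functions
supported in the open upper half space (which need not vanish on that part). -/
def ZeroOnSphere {d : ℕ} (f : Eucl (d + 1) → ℝ) (Df : Eucl (d + 1) → Fin (d + 1) → ℝ) : Prop :=
  ∀ θ, IsTest {x | 0 < x (Fin.last d)} θ → ∀ i,
    ∫ x in halfBall d, (f x * partialDeriv i θ x + Df x i * θ x) = 0

/-! ### The thin obstacle problem for the Lamé system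

A vector field is given by its components `u j`, and `Du j x i` stands for `∂ᵢ uʲ(x)`. -/

/-- The symmetrised gradient `e(u) = (∇u + (∇u)ᵀ) / 2`. -/
noncomputable def symGrad {d : ℕ} (Du : Fin (d + 1) → Eucl (d + 1) → Fin (d + 1) → ℝ)
    (x : Eucl (d + 1)) (i j : Fin (d + 1)) : ℝ :=
  (Du j x i + Du i x j) / 2

/-- The divergence `div u`. -/
noncomputable def divg {d : ℕ} (Du : Fin (d + 1) → Eucl (d + 1) → Fin (d + 1) → ℝ)
    (x : Eucl (d + 1)) : ℝ :=
  ∑ j, Du j x j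

/-- The bilinear form `∫_{B₁⁺} 2μ e(u) : e(v) + λ div u div v dx` of the operator
`-(μ Δ + (μ + λ) ∇ div)` with its natural boundary tractions. -/
noncomputable def lameForm {d : ℕ} (mu lam : ℝ)
    (Du Dv : Fin (d + 1) → Eucl (d + 1) → Fin (d + 1) → ℝ) : ℝ :=
  ∫ x in halfBall d,
    (2 * mu * ∑ i, ∑ j, symGrad Du x i j * symGrad Dv x i j + lam * (divg Du x * divg Dv x))

/-- `u ∈ H¹(B₁⁺; ℝᵈ⁺¹)` is a weak solution (in the sense of the variational inequality) of the
thin obstacle problem for the Lamé system with obstacle `φ` and inhomogeneity `F`, and `t` is the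
trace of its normal component on `B₁'`. In strong form:
`μ Δ uʲ + (μ + λ) ∂ⱼ div u = Fʲ` in `B₁⁺`, `∂ₙ uʲ + ∂ⱼ uⁿ = 0` on `B₁'` for `j < n`, `uⁿ ≥ φ`,
`-2μ ∂ₙ uⁿ - λ div u ≥ 0` and `(uⁿ - φ) (2μ ∂ₙ uⁿ + λ div u) = 0` on `B₁'`. -/
def IsLameThinObstacleSolution {d : ℕ} (mu lam : ℝ) (φ : Eucl d → ℝ)
    (F u : Fin (d + 1) → Eucl (d + 1) → ℝ) (t : Eucl d → ℝ) : Prop :=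
  ∃ Du : Fin (d + 1) → Eucl (d + 1) → Fin (d + 1) → ℝ,
    (∀ j, HasH1Gradient (u j) (Du j)) ∧
    HasFlatTrace (u (Fin.last d)) (Du (Fin.last d)) t ∧
    (∀ᵐ y ∂(volume.restrict (flatBall d)), φ y ≤ t y) ∧
    ∀ (ζ : Fin (d + 1) → Eucl (d + 1) → ℝ)
      (Dζ : Fin (d + 1) → Eucl (d + 1) → Fin (d + 1) → ℝ) (τ : Eucl d → ℝ),
      (∀ j, HasH1Gradient (ζ j) (Dζ j)) →
      HasFlatTrace (ζ (Fin.last d)) (Dζ (Fin.last d)) τ →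
      (∀ᵐ y ∂(volume.restrict (flatBall d)), φ y ≤ τ y) →
      (∀ j, ZeroOnSphere (ζ j - u j) (Dζ j - Du j)) →
      - ∑ j, ∫ x in halfBall d, F j x * (ζ j x - u j x) ≤ lameForm mu lam Du (Dζ - Du)

/-- `φ ∈ H^{1/2}(B₁')` (Sobolev–Slobodeckij norm). -/
def MemHHalfBall {d : ℕ} (φ : Eucl d → ℝ) : Prop :=
  MemLp φ 2 (volume.restrict (flatBall d)) ∧
  ∫⁻ x in flatBall d, ∫⁻ y in flatBall d,
    ENNReal.ofReal ((φ x - φ y) ^ 2 / ‖x - y‖ ^ (d + 1)) < ⊤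

/-! ### Fractional Laplacians and the obstacle problem on `ℝᵈ` -/

/-- `f` is a tempered distribution on `ℝᵈ` whose Fourier transform is the locally integrable
function `G` (normalisation `∫ f(x) e^{-2π i x·ξ} dx`). -/
def HasFourier {d : ℕ} (f : Eucl d → ℝ) (G : Eucl d → ℂ) : Prop :=
  LocallyIntegrable G ∧
  ∀ θ : 𝓢(Eucl d, ℂ),
    Integrable (fun x => (f x : ℂ) * θ x) ∧ Integrable (fun ξ => G ξ * θ ξ) ∧
    ∫ x, (f x : ℂ) * (𝓕 θ) x = ∫ ξ, G ξ * θ ξ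

/-- `(-Δ)^s f = g` with `g ∈ L²(ℝᵈ)`: the Fourier transform of `f` is a locally integrable function
and that of `g` is `|2πξ|^{2s}` times it. -/
def HasFracLaplacian {d : ℕ} (s : ℝ) (f g : Eucl d → ℝ) : Prop :=
  MemLp g 2 ∧ ∃ G : Eucl d → ℂ, HasFourier f G ∧
    HasFourier g (fun ξ => (((2 * Real.pi * ‖ξ‖) ^ (2 * s) : ℝ) : ℂ) * G ξ)

/-- The homogeneous Sobolev space `Ḣ^s(ℝᵈ)`: tempered distributions `f` with `f̂ ∈ L¹_loc` and
`|ξ|^s f̂ ∈ L²`. -/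
def MemHdot {d : ℕ} (s : ℝ) (f : Eucl d → ℝ) : Prop :=
  ∃ g, HasFracLaplacian (s / 2) f g

/-- `v ∈ Ḣ^{1/2}(ℝᵈ)` is a weak solution of the obstacle problem
`min {(-Δ)^{1/2} v, v - ψ} = 0`: one has `v ≥ ψ` and `ã(v, ζ - v) ≥ 0` for all
`ζ ∈ Ḣ^{1/2}(ℝᵈ)` with `ζ ≥ ψ`, where `ã(v₁, v₂) = ∫ (-Δ)^{1/4} v₁ (-Δ)^{1/4} v₂`. Here `V` and
`Z` stand for `(-Δ)^{1/4} v` and `(-Δ)^{1/4} ζ`. -/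
def IsHalfLaplacianObstacleSolution {d : ℕ} (ψ v : Eucl d → ℝ) : Prop :=
  (∀ᵐ y, ψ y ≤ v y) ∧
  ∃ V, HasFracLaplacian (1 / 4) v V ∧
    ∀ ζ Z, HasFracLaplacian (1 / 4) ζ Z → (∀ᵐ y, ψ y ≤ ζ y) →
      0 ≤ ∫ y, V y * (Z y - V y)

/-- `v ∈ H^{1/2}(ℝᵈ)` is a weak solution of the obstacle problem
`min {(-Δ)^{1/2} v - h, v - ψ} = 0` with right-hand side `h ∈ L²(ℝᵈ)`: one has `v ≥ ψ` and
`ã(v, ζ - v) ≥ ∫ h (ζ - v)` for all `ζ ∈ H^{1/2}(ℝᵈ)` with `ζ ≥ ψ`. -/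
def IsHalfLaplacianObstacleSolutionWith {d : ℕ} (h ψ v : Eucl d → ℝ) : Prop :=
  MemLp v 2 ∧ (∀ᵐ y, ψ y ≤ v y) ∧
  ∃ V, HasFracLaplacian (1 / 4) v V ∧
    ∀ ζ Z, MemLp ζ 2 → HasFracLaplacian (1 / 4) ζ Z → (∀ᵐ y, ψ y ≤ ζ y) →
      ∫ y, h y * (ζ y - v y) ≤ ∫ y, V y * (Z y - V y)

/-! ### Fourier transforms of `L²` functions as integrals against Schwartz functions -/

section FourierTools

variable {d : ℕ}

/-! Put `ρ = |2πξ|`. A normal displacement `z` on the boundary, with Fourier transform `g`, extends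
to the half space as an explicit solution of the Lamé system without shear traction on the flat
boundary. With `s` the normal coordinate and `b = μ / (λ + 2μ)`, its normal component has symbol `(1
+ (1 - b) ρ s) e^{-ρ s}` and its tangential components `(iξ_k / |ξ|) (b + (b - 1) ρ s) e^{-ρ s}`.
Its normal stress on the flat boundary is `-c ρ g` with `c = 2b(μ + λ)`, so its Dirichlet-to-Neumann
operator is `c (-Δ)^{1/2}`.

Let `E` be this extension and test the variational inequality with `u + s₀ η E`, where `s₀ > 0` is a
small constant. In the principal term `∫ η ∇u : σ(E)` write `η ∇u = ∇(η u) - u ⊗ ∇η`. Green's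
formula turns `∫ ∇(η u) : σ(E)` into `c` times the Dirichlet pairing of order one half between `z`
and the trace of `η uⁿ` (`HasH1Gradient.sum_stressSym_prodGrad`). All other terms are of lower
order: `E` itself is paired with an `L²` load, or `σ(E)` is paired with the `H¹` functions `uⁱ ∂ⱼη`,
onto which the derivative can be moved. They equal the pairing of `g` with a function `H` that is
both bounded and square integrable. The result is `IsLameThinObstacleSolution.exists_source`, and
`h` is the function with Fourier transform `conj H`.

Boundedness of `H` is what allows `|ξ|⁻¹` to be applied to it when `d ≥ 2`: it gives `w =
(-Δ)^{-1/2} h` in `Ḣ^{1/2}` (`IsBddL2.inv_rho_mul`, `exists_potential`), and subtracting `w` absorbs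
the right-hand side. For `d = 1` the choice `w = uⁿ η` makes the homogeneous problem trivial.

All of this is done weakly. Plane waves with exponential profiles are paired with functions on the
half ball (`partialFourier`). Since `ρ ∫₀¹ e^{-ρ s} ds ≤ 1`, these pairings gain half a derivative
in `L²` (`lintegral_partialFourier_sq_le`). The extension and its gradient are then obtained from
Riesz representation in `L²` of the half ball, and their weak derivatives and traces follow by
duality from integration by parts on the test function. A general competitor lies only in `Ḣ^{1/2}`,
so its transform is integrable near the origin and square integrable away from it (`IsL1L2`).

Finally, the trace of `uⁿ η` belongs to `H^{1/2}` by the same multipliers, and `φ η` does because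
the Gagliardo seminorm controls `|ξ|^{1/2}` on the Fourier side (`MemHHalfBall.mul_cutoff`). -/

lemma SchwartzMap.coe_conj_fourier (θ : 𝓢(Eucl d, ℂ)) :
    ∃ θ' : 𝓢(Eucl d, ℂ), (∀ x, θ' x = starRingEnd ℂ (θ (-x))) ∧
      ∀ x, (𝓕 θ') x = starRingEnd ℂ ((𝓕 θ) x) := by
  refine ⟨SchwartzMap.postcompCLM (𝕜 := ℝ) (Complex.conjCLE : ℂ →L[ℝ] ℂ)
    (SchwartzMap.compCLMOfContinuousLinearEquiv ℝ (ContinuousLinearEquiv.neg ℝ) θ), fun x => ?_,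
    fun x => ?_⟩
  · simp
  · rw [SchwartzMap.fourier_coe, SchwartzMap.fourier_coe, Real.fourier_eq, Real.fourier_eq,
      ← integral_conj, ← integral_neg_eq_self]
    refine integral_congr_ae (Filter.Eventually.of_forall fun v => ?_)
    have h2 : starRingEnd ℂ 2 = 2 := Complex.conj_ofReal 2
    simp [Circle.smul_def, Real.fourierChar_apply, ← Complex.exp_conj, h2]

lemma MeasureTheory.MemLp.integrable_mul_schwartz {f : Eucl d → ℂ} (hf : MemLp f 2)
    (θ : 𝓢(Eucl d, ℂ)) : Integrable (fun x => f x * θ x) :=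
  hf.integrable_mul (θ.memLp 2)

lemma MeasureTheory.MemLp.integrable_ofReal_mul_schwartz {f : Eucl d → ℝ} (hf : MemLp f 2)
    (θ : 𝓢(Eucl d, ℂ)) : Integrable (fun x => (f x : ℂ) * θ x) :=
  hf.ofReal.integrable_mul_schwartz θ

/-- A locally integrable function is determined by its integrals against Schwartz functions. -/
lemma ae_eq_of_integral_mul_schwartz_eq {G₁ G₂ : Eucl d → ℂ} (h₁ : LocallyIntegrable G₁)
    (h₂ : LocallyIntegrable G₂)
    (h : ∀ θ : 𝓢(Eucl d, ℂ), ∫ x, G₁ x * θ x = ∫ x, G₂ x * θ x) : G₁ =ᵐ[volume] G₂ := by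
  refine ae_eq_of_integral_contDiff_smul_eq h₁ h₂ fun g hg hgc => ?_
  have hg₁ : HasCompactSupport (Complex.ofRealCLM ∘ g) := hgc.comp_left rfl
  have hg₂ : ContDiff ℝ ∞ (Complex.ofRealCLM ∘ g) := by fun_prop
  have := h (hg₁.toSchwartzMap hg₂)
  simpa [mul_comm] using this

/-- The Fourier transform of an `L²` function, characterised by duality. -/
lemma MeasureTheory.MemLp.exists_fourier {f : Eucl d → ℂ} (hf : MemLp f 2) :
    ∀ θ : 𝓢(Eucl d, ℂ), ∫ x, f x * (𝓕 θ) x = ∫ ξ, (𝓕 (hf.toLp f) : Lp ℂ 2 volume) ξ * θ ξ := by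
  intro θ
  have h := congrArg (fun T => T θ) (Lp.fourier_toTemperedDistribution_eq (hf.toLp f))
  simp only [TemperedDistribution.fourier_apply, Lp.toTemperedDistribution_apply,
    smul_eq_mul] at h
  simp only [mul_comm _ (θ _)]
  rw [← h]
  refine integral_congr_ae ?_
  filter_upwards [hf.coeFn_toLp] with x hx
  rw [hx, mul_comm]

lemma fourier_toLp_ae_eq {f G : Eucl d → ℂ} (hf : MemLp f 2) (hG : LocallyIntegrable G)
    (h : ∀ θ : 𝓢(Eucl d, ℂ), ∫ x, f x * (𝓕 θ) x = ∫ ξ, G ξ * θ ξ) :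
    G =ᵐ[volume] (𝓕 (hf.toLp f) : Lp ℂ 2 volume) := by
  refine ae_eq_of_integral_mul_schwartz_eq hG ((Lp.memLp _).locallyIntegrable (by norm_num))
    fun θ => ?_
  rw [← h, hf.exists_fourier]

/-- Schwartz functions separate locally integrable functions, so `G` must be the Plancherel
transform of `f`. This is how a Fourier pair given only by duality acquires `L²` bounds and
Parseval's identity. -/
lemma HasFourier.ae_eq {f : Eucl d → ℝ} {G : Eucl d → ℂ} (hf : MemLp f 2) (h : HasFourier f G) :
    G =ᵐ[volume] (𝓕 ((hf.ofReal (K := ℂ)).toLp _) : Lp ℂ 2 volume) :=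
  fourier_toLp_ae_eq (hf.ofReal (K := ℂ)) h.1 fun θ => (h.2 θ).2.2 |>.trans rfl |> fun h' => by
    simpa using h'

lemma HasFourier.memLp {f : Eucl d → ℝ} {G : Eucl d → ℂ} (hf : MemLp f 2) (h : HasFourier f G) :
    MemLp G 2 :=
  (Lp.memLp _).ae_eq (h.ae_eq hf).symm

/-- A Fourier pair from its defining identity, when the function is in `L²`. -/
lemma hasFourier_of_memLp {f : Eucl d → ℝ} {G : Eucl d → ℂ} (hf : MemLp f 2) (hG : MemLp G 2)
    (h : ∀ θ : 𝓢(Eucl d, ℂ), ∫ x, (f x : ℂ) * (𝓕 θ) x = ∫ ξ, G ξ * θ ξ) : HasFourier f G :=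
  ⟨hG.locallyIntegrable (by norm_num), fun θ => ⟨hf.integrable_ofReal_mul_schwartz θ,
    hG.integrable_mul_schwartz θ, h θ⟩⟩

lemma MeasureTheory.MemLp.exists_hasFourier {f : Eucl d → ℝ} (hf : MemLp f 2) :
    ∃ G, MemLp G 2 ∧ HasFourier f G :=
  ⟨_, Lp.memLp _, hasFourier_of_memLp hf (Lp.memLp _) fun θ => by
    simpa using (hf.ofReal (K := ℂ)).exists_fourier θ⟩

lemma HasFourier.congr {f : Eucl d → ℝ} {G G' : Eucl d → ℂ} (h : HasFourier f G)
    (hG : G =ᵐ[volume] G') : HasFourier f G' := by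
  refine ⟨h.1.congr hG, fun θ => ?_⟩
  have : (fun ξ => G ξ * θ ξ) =ᵐ[volume] fun ξ => G' ξ * θ ξ := by
    filter_upwards [hG] with ξ hξ
    rw [hξ]
  exact ⟨(h.2 θ).1, (h.2 θ).2.1.congr this, (h.2 θ).2.2.trans (integral_congr_ae this)⟩

lemma HasFourier.add {f₁ f₂ : Eucl d → ℝ} {G₁ G₂ : Eucl d → ℂ} (h₁ : HasFourier f₁ G₁)
    (h₂ : HasFourier f₂ G₂) : HasFourier (fun x => f₁ x + f₂ x) (fun ξ => G₁ ξ + G₂ ξ) := by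
  refine ⟨h₁.1.add h₂.1, fun θ => ?_⟩
  obtain ⟨a₁, b₁, -⟩ := h₁.2 θ
  obtain ⟨a₂, b₂, -⟩ := h₂.2 θ
  simp only [Complex.ofReal_add, add_mul]
  refine ⟨a₁.add a₂, b₁.add b₂, ?_⟩
  rw [integral_add (h₁.2 (𝓕 θ)).1 (h₂.2 (𝓕 θ)).1, integral_add b₁ b₂, (h₁.2 θ).2.2, (h₂.2 θ).2.2]

lemma HasFourier.neg {f : Eucl d → ℝ} {G : Eucl d → ℂ} (h : HasFourier f G) :
    HasFourier (fun x => - f x) (fun ξ => - G ξ) := by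
  refine ⟨h.1.neg, fun θ => ?_⟩
  obtain ⟨a, b, e⟩ := h.2 θ
  simp only [Complex.ofReal_neg, neg_mul]
  refine ⟨a.neg, b.neg, ?_⟩
  rw [integral_neg, integral_neg, e]

lemma HasFourier.sub {f₁ f₂ : Eucl d → ℝ} {G₁ G₂ : Eucl d → ℂ} (h₁ : HasFourier f₁ G₁)
    (h₂ : HasFourier f₂ G₂) : HasFourier (fun x => f₁ x - f₂ x) (fun ξ => G₁ ξ - G₂ ξ) := by
  simpa only [sub_eq_add_neg] using h₁.add h₂.neg

/-- Parseval's identity for real `L²` functions. -/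
lemma HasFourier.integral_mul {f₁ f₂ : Eucl d → ℝ} {G₁ G₂ : Eucl d → ℂ} (m₁ : MemLp f₁ 2)
    (m₂ : MemLp f₂ 2) (h₁ : HasFourier f₁ G₁) (h₂ : HasFourier f₂ G₂) :
    ∫ x, f₁ x * f₂ x = (∫ ξ, starRingEnd ℂ (G₁ ξ) * G₂ ξ).re := by
  have key := Lp.inner_fourier_eq ((m₁.ofReal (K := ℂ)).toLp _) ((m₂.ofReal (K := ℂ)).toLp _)
  rw [L2.inner_def, L2.inner_def] at key
  have e₁ : ∫ ξ, starRingEnd ℂ (G₁ ξ) * G₂ ξ = ∫ x, ((f₁ x * f₂ x : ℝ) : ℂ) := by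
    refine Eq.trans ?_ (key.trans ?_)
    · refine integral_congr_ae ?_
      filter_upwards [h₁.ae_eq m₁, h₂.ae_eq m₂] with x hx hx'
      rw [hx, hx', RCLike.inner_apply, mul_comm]
    · refine integral_congr_ae ?_
      filter_upwards [(m₁.ofReal (K := ℂ)).coeFn_toLp, (m₂.ofReal (K := ℂ)).coeFn_toLp] with x hx hx'
      rw [hx, hx', RCLike.inner_apply, mul_comm]
      simp only [RCLike.conj_ofReal, Complex.ofReal_mul]
      rfl
  rw [e₁, integral_complex_ofReal, Complex.ofReal_re]

/-- The real part of a complex function whose Fourier transform is Hermitian. -/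
lemma hasFourier_re {f G : Eucl d → ℂ} (hG : LocallyIntegrable G)
    (hf : ∀ θ : 𝓢(Eucl d, ℂ), Integrable (fun x => f x * θ x))
    (hGi : ∀ θ : 𝓢(Eucl d, ℂ), Integrable (fun x => G x * θ x))
    (h : ∀ θ : 𝓢(Eucl d, ℂ), ∫ x, f x * (𝓕 θ) x = ∫ ξ, G ξ * θ ξ)
    (hherm : ∀ ξ, G (-ξ) = starRingEnd ℂ (G ξ)) : HasFourier (fun x => (f x).re) G := by
  have hc : ∀ θ : 𝓢(Eucl d, ℂ), Integrable (fun x => starRingEnd ℂ (f x) * θ x) := by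
    intro θ
    have h1 := (Complex.conjCLE : ℂ →L[ℝ] ℂ).integrable_comp
      (hf (SchwartzMap.postcompCLM (𝕜 := ℝ) (Complex.conjCLE : ℂ →L[ℝ] ℂ) θ))
    refine h1.congr (Filter.Eventually.of_forall fun x => ?_)
    simp
  have hre : ∀ (θ : 𝓢(Eucl d, ℂ)) x, ((f x).re : ℂ) * θ x
      = (1 / 2) * (f x * θ x + starRingEnd ℂ (f x) * θ x) := by
    intro θ x
    rw [Complex.re_eq_add_conj]
    ring
  refine ⟨hG, fun θ => ⟨?_, hGi θ, ?_⟩⟩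
  · simp only [hre]
    exact ((hf θ).add (hc θ)).const_mul _
  · simp only [hre]
    rw [integral_const_mul, integral_add (hf _) (hc _), h]
    -- Conjugating the identity for `θ'` tests `conj f` against `𝓕 θ`. The reflection in `θ'` is
    -- undone by the Hermitian symmetry of `G`.
    obtain ⟨θ', h1, h2⟩ := SchwartzMap.coe_conj_fourier θ
    have : ∫ x, starRingEnd ℂ (f x) * (𝓕 θ) x = ∫ ξ, G ξ * θ ξ := by
      have e := congrArg (starRingEnd ℂ) (h θ')
      rw [← integral_conj, ← integral_conj, ← integral_neg_eq_self] at e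
      simp only [map_mul, h1, h2, Complex.conj_conj] at e
      rw [← integral_neg_eq_self]
      refine e.trans ?_
      rw [← integral_neg_eq_self]
      refine integral_congr_ae (Filter.Eventually.of_forall fun v => ?_)
      simp [hherm]
    rw [this]
    ring

/-- A Hermitian `L²` function is the Fourier transform of a real `L²` function. -/
lemma exists_hasFourier_of_memLp {G : Eucl d → ℂ} (hG : MemLp G 2)
    (hherm : ∀ ξ, G (-ξ) = starRingEnd ℂ (G ξ)) : ∃ f, MemLp f 2 ∧ HasFourier f G := by
  set g : Lp ℂ 2 (volume : Measure (Eucl d)) := 𝓕⁻ (hG.toLp G) with hg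
  refine ⟨_, (Lp.memLp g).re, hasFourier_re (f := g) (hG.locallyIntegrable (by norm_num))
    (fun θ => (Lp.memLp g).integrable_mul_schwartz θ) hG.integrable_mul_schwartz ?_ hherm⟩
  intro θ
  rw [(Lp.memLp g).exists_fourier θ]
  refine integral_congr_ae ?_
  have : (𝓕 ((Lp.memLp g).toLp g) : Lp ℂ 2 volume) = hG.toLp G := by
    rw [Lp.toLp_coeFn, hg, FourierTransform.fourier_fourierInv_eq]
  rw [this]
  filter_upwards [hG.coeFn_toLp] with x hx
  rw [hx]

/-- A Hermitian `L¹` function is the Fourier transform of a real bounded function. -/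
lemma exists_hasFourier_of_integrable {G : Eucl d → ℂ} (hG : Integrable G)
    (hherm : ∀ ξ, G (-ξ) = starRingEnd ℂ (G ξ)) : ∃ f, HasFourier f G := by
  have hb : ∀ θ : 𝓢(Eucl d, ℂ), Integrable (fun x => G x * θ x) := fun θ =>
    hG.mul_of_top_left (θ.memLp_top)
  have hcont : Continuous (𝓕⁻ G) := by
    rw [Real.fourierInv_eq_fourier_comp_neg]
    exact VectorFourier.fourierIntegral_continuous Real.continuous_fourierChar continuous_inner
      hG.comp_neg
  have hbound : ∀ x, ‖(𝓕⁻ G) x‖ ≤ ∫ y, ‖G y‖ := by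
    intro x
    rw [Real.fourierInv_eq]
    refine (norm_integral_le_integral_norm _).trans_eq ?_
    simp
  refine ⟨_, hasFourier_re (f := 𝓕⁻ G) hG.locallyIntegrable (fun θ => ?_) hb (fun θ => ?_) hherm⟩
  · exact θ.integrable.bdd_mul hcont.aestronglyMeasurable (Filter.Eventually.of_forall hbound)
  -- With the pairing `-⟨x, ξ⟩` the inverse transform becomes a Fourier integral, so the
  -- multiplication formula applies to it.
  · have h1 := VectorFourier.integral_fourierIntegral_smul_eq_flip (𝕜 := ℝ) (V := Eucl d)
      (W := Eucl d) (μ := volume) (ν := volume) (L := -innerₗ (Eucl d)) (f := G) (g := (𝓕 θ : 𝓢(Eucl d, ℂ)))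
      Real.continuous_fourierChar continuous_inner.neg hG (𝓕 θ : 𝓢(Eucl d, ℂ)).integrable
    refine Eq.trans ?_ (h1.trans ?_)
    · refine integral_congr_ae (Filter.Eventually.of_forall fun v => ?_)
      simp [VectorFourier.fourierIntegral, Real.fourierInv_eq]
    · refine integral_congr_ae (Filter.Eventually.of_forall fun v => ?_)
      have : (𝓕⁻ (𝓕 θ) : 𝓢(Eucl d, ℂ)) v = θ v := by
        rw [FourierTransform.fourierInv_fourier_eq]
      beta_reduce
      rw [← this, SchwartzMap.fourierInv_coe, Real.fourierInv_eq]
      simp [VectorFourier.fourierIntegral, real_inner_comm]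

lemma integral_fourier_mul_schwartz {f : Eucl d → ℂ} (hf : Integrable f) (θ : 𝓢(Eucl d, ℂ)) :
    ∫ ξ, (𝓕 f) ξ * θ ξ = ∫ x, f x * (𝓕 θ) x := by
  have h1 := VectorFourier.integral_fourierIntegral_smul_eq_flip (𝕜 := ℝ) (V := Eucl d)
      (W := Eucl d) (μ := volume) (ν := volume) (L := innerₗ (Eucl d)) (f := f) (g := θ)
      Real.continuous_fourierChar continuous_inner hf θ.integrable
  simp only [smul_eq_mul] at h1
  refine h1.trans (integral_congr_ae (Filter.Eventually.of_forall fun v => ?_))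
  simp only [SchwartzMap.fourier_coe, Real.fourier_eq, VectorFourier.fourierIntegral]
  simp [real_inner_comm]

lemma continuous_fourier_of_integrable {f : Eucl d → ℂ} (hf : Integrable f) : Continuous (𝓕 f) :=
  VectorFourier.fourierIntegral_continuous Real.continuous_fourierChar continuous_inner hf

lemma fourier_ae_eq_of_integrable {f : Eucl d → ℂ} (hf : MemLp f 2) (hf' : Integrable f) :
    𝓕 f =ᵐ[volume] (𝓕 (hf.toLp f) : Lp ℂ 2 volume) :=
  fourier_toLp_ae_eq hf (continuous_fourier_of_integrable hf').locallyIntegrable fun θ =>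
    (integral_fourier_mul_schwartz hf' θ).symm

/-- Plancherel's theorem for functions in `L¹ ∩ L²`. -/
lemma eLpNorm_fourier_eq {f : Eucl d → ℂ} (hf : MemLp f 2) (hf' : Integrable f) :
    eLpNorm (𝓕 f) 2 volume = eLpNorm f 2 volume := by
  rw [eLpNorm_congr_ae (fourier_ae_eq_of_integrable hf hf'), ← eLpNorm_congr_ae hf.coeFn_toLp,
    ← ENNReal.toReal_eq_toReal_iff' (Lp.eLpNorm_ne_top _) (Lp.eLpNorm_ne_top _), ← Lp.norm_def,
    ← Lp.norm_def]
  exact Lp.norm_fourier_eq _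

lemma HasFourier.ae_eq_fourier {f : Eucl d → ℝ} {G : Eucl d → ℂ} (hf : Integrable f)
    (h : HasFourier f G) : G =ᵐ[volume] 𝓕 (fun x => (f x : ℂ)) :=
  ae_eq_of_integral_mul_schwartz_eq h.1
    (continuous_fourier_of_integrable hf.ofReal).locallyIntegrable fun θ => by
      rw [← (h.2 θ).2.2]
      exact (integral_fourier_mul_schwartz hf.ofReal θ).symm

end FourierTools

/-! ### Tangential and normal coordinates -/

section Coordinates

variable {d : ℕ}

/-- The tangential part `x'` of `x = (x', x_{d+1})`. -/
noncomputable def tang : Eucl (d + 1) →L[ℝ] Eucl d :=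
  LinearMap.toContinuousLinearMap
    { toFun := fun x => WithLp.toLp 2 fun i => x (Fin.castSucc i)
      map_add' := fun x y => by ext; simp
      map_smul' := fun c x => by ext; simp }

/-- The normal coordinate `x_{d+1}`. -/
noncomputable def normalCoord : Eucl (d + 1) →L[ℝ] ℝ := EuclideanSpace.proj (Fin.last d)

/-- The point `(x', s)`. -/
noncomputable def joinPt (p : Eucl d × ℝ) : Eucl (d + 1) :=
  WithLp.toLp 2 (Fin.snoc (α := fun _ => ℝ) p.1.ofLp p.2)

@[simp] lemma tang_apply (x : Eucl (d + 1)) (i : Fin d) : tang x i = x (Fin.castSucc i) := rfl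

@[simp] lemma normalCoord_apply (x : Eucl (d + 1)) : normalCoord x = x (Fin.last d) := rfl

@[simp] lemma join_castSucc (p : Eucl d × ℝ) (i : Fin d) : joinPt p (Fin.castSucc i) = p.1 i := by
  simp [joinPt]

@[simp] lemma join_last (p : Eucl d × ℝ) : joinPt p (Fin.last d) = p.2 := by
  simp [joinPt]

lemma flat_eq_join (y : Eucl d) : flat y = joinPt (y, 0) := rfl

@[simp] lemma tang_join (p : Eucl d × ℝ) : tang (joinPt p) = p.1 := by
  ext i; simp

@[simp] lemma join_tang (x : Eucl (d + 1)) : joinPt (tang x, x (Fin.last d)) = x := by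
  ext i
  refine Fin.lastCases ?_ (fun i => ?_) i <;> simp

lemma norm_join_sq (p : Eucl d × ℝ) : ‖joinPt p‖ ^ 2 = ‖p.1‖ ^ 2 + p.2 ^ 2 := by
  simp [EuclideanSpace.norm_sq_eq, Fin.sum_univ_castSucc]

@[simp] lemma norm_flat (y : Eucl d) : ‖flat y‖ = ‖y‖ := by
  have h := norm_join_sq (y, (0 : ℝ))
  rw [← flat_eq_join] at h
  simpa using h

lemma contDiff_join : ContDiff ℝ ∞ (joinPt : Eucl d × ℝ → Eucl (d + 1)) := by
  rw [contDiff_euclidean]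
  intro i
  refine Fin.lastCases ?_ (fun i => ?_) i
  · simpa using contDiff_snd
  · simp only [join_castSucc]
    fun_prop

lemma continuous_join : Continuous (joinPt : Eucl d × ℝ → Eucl (d + 1)) := contDiff_join.continuous

lemma contDiff_flat : ContDiff ℝ ∞ (flat : Eucl d → Eucl (d + 1)) :=
  contDiff_join.comp (contDiff_id.prodMk contDiff_const)

/-- The measurable equivalence `(x', s) ↦ (x', s)` between `ℝᵈ × ℝ` and `ℝᵈ⁺¹`. -/
noncomputable def joinEquiv : Eucl d × ℝ ≃ᵐ Eucl (d + 1) where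
  toFun := joinPt
  invFun x := (tang x, x (Fin.last d))
  left_inv p := by simp
  right_inv x := by simp
  measurable_toFun := continuous_join.measurable
  measurable_invFun := by
    refine Measurable.prodMk tang.continuous.measurable ?_
    exact normalCoord.continuous.measurable

@[simp] lemma coe_joinEquiv : ⇑(joinEquiv : Eucl d × ℝ ≃ᵐ Eucl (d + 1)) = joinPt := rfl

/-- Splitting a product of lines at its last coordinate preserves volume. That splitting lists the
distinguished coordinate first, hence the swap. -/
lemma measurePreserving_join : MeasurePreserving (joinEquiv : Eucl d × ℝ ≃ᵐ Eucl (d + 1)) := by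
  have h1 := (EuclideanSpace.volume_preserving_symm_measurableEquiv_toLp (Fin d)).prod
    (MeasurePreserving.id (volume : Measure ℝ))
  have h2 := (Measure.measurePreserving_swap (μ := (volume : Measure (Fin d → ℝ)))
    (ν := (volume : Measure ℝ))).comp h1
  have h3 := (volume_preserving_piFinSuccAbove (fun _ : Fin (d + 1) => ℝ) (Fin.last d)).symm.comp h2
  have h4 := (EuclideanSpace.volume_preserving_symm_measurableEquiv_toLp (Fin (d + 1))).symm.comp h3
  rw [Measure.volume_eq_prod]
  convert h4 using 1
  ext p i
  simp [joinPt, Fin.insertNthEquiv]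

lemma integral_eq_integral_join {E : Type*} [NormedAddCommGroup E] [NormedSpace ℝ E]
    (f : Eucl (d + 1) → E) : ∫ x, f x = ∫ p : Eucl d × ℝ, f (joinPt p) :=
  (measurePreserving_join.integral_comp' f).symm

lemma lintegral_eq_lintegral_join (f : Eucl (d + 1) → ENNReal) :
    ∫⁻ x, f x = ∫⁻ p : Eucl d × ℝ, f (joinPt p) :=
  (measurePreserving_join.lintegral_comp_emb joinEquiv.measurableEmbedding f).symm

lemma integrable_iff_integrable_join {E : Type*} [NormedAddCommGroup E]
    (f : Eucl (d + 1) → E) : Integrable f ↔ Integrable fun p : Eucl d × ℝ => f (joinPt p) :=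
  (measurePreserving_join.integrable_comp_emb joinEquiv.measurableEmbedding).symm

lemma isOpen_halfBall : IsOpen (halfBall d) :=
  (isOpen_lt continuous_norm continuous_const).inter
    (isOpen_lt continuous_const (normalCoord (d := d)).continuous)

lemma measurableSet_halfBall : MeasurableSet (halfBall d) := isOpen_halfBall.measurableSet

lemma halfBall_subset_ball : halfBall d ⊆ Metric.ball 0 1 := fun x hx => by simpa using hx.1

instance isFiniteMeasure_halfBall : IsFiniteMeasure (volume.restrict (halfBall d)) :=
  ⟨by
    rw [Measure.restrict_apply_univ]
    exact (measure_mono halfBall_subset_ball).trans_lt measure_ball_lt_top⟩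

instance isFiniteMeasure_flatBall : IsFiniteMeasure (volume.restrict (flatBall d)) :=
  ⟨by
    rw [Measure.restrict_apply_univ]
    exact measure_ball_lt_top⟩

lemma mem_halfBall_last_lt_one {x : Eucl (d + 1)} (hx : x ∈ halfBall d) : x (Fin.last d) < 1 :=
  ((le_abs_self _).trans (by simpa using PiLp.norm_apply_le x (Fin.last d))).trans_lt hx.1

lemma join_mem_halfBall {p : Eucl d × ℝ} (hp : joinPt p ∈ halfBall d) :
    ‖p.1‖ < 1 ∧ 0 < p.2 ∧ p.2 < 1 := by
  refine ⟨?_, by simpa using hp.2, by simpa using mem_halfBall_last_lt_one hp⟩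
  have h := norm_join_sq p
  have h1 := hp.1
  nlinarith [norm_nonneg p.1, norm_nonneg (joinPt p), sq_nonneg p.2]

end Coordinates

/-! ### Partial Fourier transforms over the half ball -/

section PartialFourier

variable {d : ℕ}

/-- The plane wave `e^{2πi x'·ξ}`. -/
noncomputable def wave (ξ : Eucl d) (x : Eucl (d + 1)) : ℂ := (𝐞 (inner ℝ (tang x) ξ) : ℂ)

@[simp] lemma norm_wave (ξ : Eucl d) (x : Eucl (d + 1)) : ‖wave ξ x‖ = 1 :=
  Circle.norm_coe _

lemma continuous_wave : Continuous fun p : Eucl d × Eucl (d + 1) => wave p.1 p.2 := by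
  unfold wave
  have := Real.continuous_fourierChar
  fun_prop

/-- The partial Fourier transform `∫_{B₁⁺} f(x) e^{2πi x'·ξ} m(ξ, x_{d+1}) dx`. -/
noncomputable def partialFourier (m : Eucl d → ℝ → ℝ) (f : Eucl (d + 1) → ℝ) (ξ : Eucl d) : ℂ :=
  ∫ x in halfBall d, (f x : ℂ) * (wave ξ x * m ξ (x (Fin.last d)))

/-- Multipliers that are continuous and bounded by one on the half space. -/
structure IsUnitMultiplier (m : Eucl d → ℝ → ℝ) : Prop where
  continuous : Continuous fun p : Eucl d × ℝ => m p.1 p.2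
  bound : ∀ ξ s, 0 < s → ‖m ξ s‖ ≤ 1
  even : ∀ ξ s, m (-ξ) s = m ξ s

variable {m : Eucl d → ℝ → ℝ} {f : Eucl (d + 1) → ℝ}

lemma IsUnitMultiplier.continuous_kernel (hm : IsUnitMultiplier m) :
    Continuous fun p : Eucl d × Eucl (d + 1) => wave p.1 p.2 * (m p.1 (p.2 (Fin.last d)) : ℂ) := by
  refine continuous_wave.mul (Complex.continuous_ofReal.comp ?_)
  exact hm.continuous.comp (continuous_fst.prodMk
    ((normalCoord (d := d)).continuous.comp continuous_snd))

lemma IsUnitMultiplier.norm_kernel_le (hm : IsUnitMultiplier m) (ξ : Eucl d) {x : Eucl (d + 1)}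
    (hx : x ∈ halfBall d) : ‖wave ξ x * (m ξ (x (Fin.last d)) : ℂ)‖ ≤ 1 := by
  rw [norm_mul, norm_wave, one_mul, Complex.norm_real]
  exact hm.bound _ _ hx.2

lemma integrable_partialFourier (hm : IsUnitMultiplier m)
    (hf : Integrable f (volume.restrict (halfBall d))) (ξ : Eucl d) :
    Integrable (fun x => (f x : ℂ) * (wave ξ x * m ξ (x (Fin.last d))))
      (volume.restrict (halfBall d)) := by
  refine hf.ofReal.mul_bdd (c := 1)
    (hm.continuous_kernel.comp (continuous_const.prodMk continuous_id)).aestronglyMeasurable ?_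
  filter_upwards [ae_restrict_mem measurableSet_halfBall] with x hx
  exact hm.norm_kernel_le ξ hx

lemma continuous_partialFourier (hm : IsUnitMultiplier m)
    (hf : Integrable f (volume.restrict (halfBall d))) : Continuous (partialFourier m f) := by
  refine continuous_of_dominated (bound := fun x => ‖f x‖)
    (fun ξ => (integrable_partialFourier hm hf ξ).aestronglyMeasurable) (fun ξ => ?_) hf.norm
    (Filter.Eventually.of_forall fun x => ?_)
  · filter_upwards [ae_restrict_mem measurableSet_halfBall] with x hx
    rw [norm_mul, Complex.norm_real]
    exact mul_le_of_le_one_right (norm_nonneg _) (hm.norm_kernel_le ξ hx)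
  · have := hm.continuous_kernel.comp
      (continuous_id.prodMk (continuous_const (y := x)) : Continuous fun ξ : Eucl d => (ξ, x))
    exact (continuous_const (y := (f x : ℂ))).mul this

lemma norm_partialFourier_le (hm : IsUnitMultiplier m)
    (hf : Integrable f (volume.restrict (halfBall d))) (ξ : Eucl d) :
    ‖partialFourier m f ξ‖ ≤ ∫ x in halfBall d, ‖f x‖ := by
  refine (norm_integral_le_integral_norm _).trans ?_
  refine integral_mono_ae (integrable_partialFourier hm hf ξ).norm hf.norm ?_
  filter_upwards [ae_restrict_mem measurableSet_halfBall] with x hx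
  rw [norm_mul, Complex.norm_real]
  exact mul_le_of_le_one_right (norm_nonneg _) (hm.norm_kernel_le ξ hx)

lemma partialFourier_congr {f g : Eucl (d + 1) → ℝ} (h : f =ᵐ[volume.restrict (halfBall d)] g) :
    partialFourier m f = partialFourier m g := by
  ext ξ
  refine integral_congr_ae ?_
  filter_upwards [h] with x hx
  rw [hx]

lemma partialFourier_add (hm : IsUnitMultiplier m) {f g : Eucl (d + 1) → ℝ}
    (hf : Integrable f (volume.restrict (halfBall d)))
    (hg : Integrable g (volume.restrict (halfBall d))) (ξ : Eucl d) :
    partialFourier m (fun x => f x + g x) ξ = partialFourier m f ξ + partialFourier m g ξ := by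
  simp only [partialFourier, Complex.ofReal_add, add_mul]
  exact integral_add (integrable_partialFourier hm hf ξ) (integrable_partialFourier hm hg ξ)

lemma partialFourier_const_mul (c : ℝ) (ξ : Eucl d) :
    partialFourier m (fun x => c * f x) ξ = c * partialFourier m f ξ := by
  simp only [partialFourier, Complex.ofReal_mul, mul_assoc]
  exact integral_const_mul _ _

lemma partialFourier_neg_freq (hm : IsUnitMultiplier m) (ξ : Eucl d) :
    partialFourier m f (-ξ) = starRingEnd ℂ (partialFourier m f ξ) := by
  rw [partialFourier, partialFourier, ← integral_conj]
  refine integral_congr_ae (Filter.Eventually.of_forall fun x => ?_)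
  have : wave (-ξ) x = starRingEnd ℂ (wave ξ x) := by
    simp [wave, AddChar.map_neg_eq_inv]
  simp [hm.even, this]

lemma lintegral_mul_sq_le {α : Type*} [MeasurableSpace α] (μ : Measure α) {a b : α → ENNReal}
    (ha : AEMeasurable a μ) (hb : AEMeasurable b μ) :
    (∫⁻ x, a x * b x ∂μ) ^ 2 ≤ (∫⁻ x, a x ^ 2 ∂μ) * ∫⁻ x, b x ^ 2 ∂μ := by
  have h := ENNReal.lintegral_mul_le_Lp_mul_Lq μ Real.HolderConjugate.two_two ha hb
  simp only [Pi.mul_apply, ENNReal.rpow_two] at h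
  calc (∫⁻ x, a x * b x ∂μ) ^ 2
      ≤ ((∫⁻ x, a x ^ 2 ∂μ) ^ (1 / 2 : ℝ) * (∫⁻ x, b x ^ 2 ∂μ) ^ (1 / 2 : ℝ)) ^ 2 := by gcongr
    _ = _ := by
        rw [mul_pow, ← ENNReal.rpow_natCast, ← ENNReal.rpow_natCast, ← ENNReal.rpow_mul,
          ← ENNReal.rpow_mul]
        norm_num

/-- Plancherel, stated so that it also holds when the right side is infinite: it can then be applied
to every horizontal slice, not only to almost every one. When the right side is finite, support in
the unit ball gives integrability. -/
lemma lintegral_fourierInv_sq_le {f : Eucl d → ℂ} (hf : StronglyMeasurable f)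
    (hsupp : ∀ x, 1 ≤ ‖x‖ → f x = 0) :
    ∫⁻ ξ, ‖(𝓕⁻ f) ξ‖ₑ ^ 2 ≤ ∫⁻ x, ‖f x‖ₑ ^ 2 := by
  have two : ∀ g : Eucl d → ℂ, eLpNorm g 2 volume ^ 2 = ∫⁻ x, ‖g x‖ₑ ^ 2 := fun g => by
    simpa using eLpNorm_nnreal_pow_eq_lintegral (f := g) (μ := volume) (p := 2) (by norm_num)
  by_cases h : ∫⁻ x, ‖f x‖ₑ ^ 2 = ⊤
  · rw [h]; exact le_top
  have h2 : MemLp f 2 := by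
    refine ⟨hf.aestronglyMeasurable, lt_top_iff_ne_top.2 fun h' => h ?_⟩
    rw [← two, h']
    simp
  have h1 : Integrable f := by
    have : IntegrableOn f (Metric.ball 0 1) := by
      have : IsFiniteMeasure (volume.restrict (Metric.ball (0 : Eucl d) 1)) :=
        ⟨by rw [Measure.restrict_apply_univ]; exact measure_ball_lt_top⟩
      exact (h2.restrict _).integrable (by norm_num)
    rwa [integrableOn_iff_integrable_of_support_subset] at this
    intro x hx
    by_contra hx'
    exact hx (hsupp x (by simpa using hx'))
  have h3 := eLpNorm_fourier_eq h2 h1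
  rw [← two f, ← h3, two, Real.fourierInv_eq_fourier_comp_neg]
  have e : 𝓕 (fun x => f (-x)) = fun ξ => (𝓕 f) (-ξ) := by
    ext ξ
    rw [← Real.fourierInv_eq_fourier_neg, Real.fourierInv_eq_fourier_comp_neg]
  rw [e]
  exact (lintegral_neg_eq_self (μ := volume) (fun ξ : Eucl d => ‖(𝓕 f) ξ‖ₑ ^ 2)).le

/-- Weighted `L²` bound for the partial Fourier transform. -/
lemma lintegral_partialFourier_sq_le (hm : IsUnitMultiplier m)
    (hf : MemLp f 2 (volume.restrict (halfBall d))) {k : Eucl d → ENNReal}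
    (hk : ∀ ξ, k ξ * ∫⁻ s in Ioo (0 : ℝ) 1, ‖m ξ s‖ₑ ^ 2 ≤ 1) :
    ∫⁻ ξ, k ξ * ‖partialFourier m f ξ‖ₑ ^ 2 ≤ ∫⁻ x in halfBall d, ‖f x‖ₑ ^ 2 := by
  -- A strongly measurable representative makes every slice measurable, which the inner integrals
  -- need.
  set f' := hf.1.mk f with hf'
  have hff' : f =ᵐ[volume.restrict (halfBall d)] f' := hf.1.ae_eq_mk
  set F : Eucl (d + 1) → ℂ := (halfBall d).indicator fun x => (f' x : ℂ) with hF
  have hFm : StronglyMeasurable F :=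
    (Complex.continuous_ofReal.comp_stronglyMeasurable
      hf.1.stronglyMeasurable_mk).indicator measurableSet_halfBall
  have hfi : Integrable f' (volume.restrict (halfBall d)) :=
    (hf.integrable (by norm_num)).congr hff'
  have hF0 : ∀ p : Eucl d × ℝ, ¬ (‖p.1‖ < 1 ∧ 0 < p.2 ∧ p.2 < 1) → F (joinPt p) = 0 := fun p hp =>
    indicator_of_notMem (fun h => hp (join_mem_halfBall h)) _
  set slice : ℝ → Eucl d → ℂ := fun s x => F (joinPt (x, s)) with hslice
  have hslicem : ∀ s, StronglyMeasurable (slice s) := fun s =>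
    hFm.comp_measurable (continuous_join.comp (by fun_prop : Continuous fun x : Eucl d => (x, s))).measurable
  have hφm : StronglyMeasurable fun q : Eucl d × ℝ => (𝓕⁻ (slice q.2)) q.1 := by
    simp only [Real.fourierInv_eq, Circle.smul_def, smul_eq_mul]
    have : StronglyMeasurable fun r : (Eucl d × ℝ) × Eucl d =>
        (𝐞 (inner ℝ r.2 r.1.1) : ℂ) * slice r.1.2 r.2 := by
      refine StronglyMeasurable.mul ?_ ?_
      · have := Real.continuous_fourierChar
        exact (by fun_prop : Continuous fun r : (Eucl d × ℝ) × Eucl d =>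
          (𝐞 (inner ℝ r.2 r.1.1) : ℂ)).stronglyMeasurable
      · exact hFm.comp_measurable (continuous_join.comp
          (by fun_prop : Continuous fun r : (Eucl d × ℝ) × Eucl d => (r.2, r.1.2))).measurable
    exact this.integral_prod_right'
  -- Fubini: the multiplier depends on `x` only through the height `s`, so the transform is an
  -- average over `s` of inverse Fourier transforms of slices.
  have hT : ∀ ξ, partialFourier m f ξ = ∫ s in Ioo (0 : ℝ) 1, (m ξ s : ℂ) * (𝓕⁻ (slice s)) ξ := by
    intro ξ
    have hint := integrable_partialFourier hm hfi ξ
    have e0 : (halfBall d).indicator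
        (fun x => (f' x : ℂ) * (wave ξ x * m ξ (x (Fin.last d)))) =
        fun x => F x * (wave ξ x * m ξ (x (Fin.last d))) := by
      ext x
      by_cases hx : x ∈ halfBall d <;> simp [hF, hx]
    replace hint := (integrable_indicator_iff measurableSet_halfBall).2 hint
    rw [e0, integrable_iff_integrable_join] at hint
    rw [partialFourier_congr hff', partialFourier, ← integral_indicator measurableSet_halfBall, e0,
      integral_eq_integral_join]
    rw [Measure.volume_eq_prod, integral_prod_symm _ hint, ← integral_indicator measurableSet_Ioo]
    refine integral_congr_ae (Filter.Eventually.of_forall fun s => ?_)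
    by_cases hs : s ∈ Ioo (0 : ℝ) 1
    · simp only [hs, indicator_of_mem, Real.fourierInv_eq]
      rw [← integral_const_mul]
      refine integral_congr_ae (Filter.Eventually.of_forall fun x => ?_)
      simp only [wave, tang_join, join_last, hslice, Circle.smul_def, smul_eq_mul]
      ring
    · simp only [hs, not_false_eq_true, indicator_of_notMem]
      refine integral_eq_zero_of_ae (Filter.Eventually.of_forall fun x => ?_)
      simp [hF0 (x, s) fun h => hs h.2]
  have hmm : ∀ ξ, Measurable (m ξ) := fun ξ =>
    (hm.continuous.comp (by fun_prop : Continuous fun s : ℝ => (ξ, s))).measurable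
  -- Cauchy–Schwarz in `s`, with `hk` absorbing the weight and the multiplier; then Tonelli, and
  -- Plancherel on each slice.
  calc ∫⁻ ξ, k ξ * ‖partialFourier m f ξ‖ₑ ^ 2
      ≤ ∫⁻ ξ, ∫⁻ s in Ioo (0 : ℝ) 1, ‖(𝓕⁻ (slice s)) ξ‖ₑ ^ 2 := by
        refine lintegral_mono fun ξ => ?_
        have h1 : ‖partialFourier m f ξ‖ₑ ≤ ∫⁻ s in Ioo (0 : ℝ) 1, ‖m ξ s‖ₑ * ‖(𝓕⁻ (slice s)) ξ‖ₑ := by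
          rw [hT]
          refine (enorm_integral_le_lintegral_enorm _).trans_eq ?_
          refine lintegral_congr fun s => ?_
          rw [enorm_mul]
          congr 1
          simp [enorm_eq_nnnorm, Complex.nnnorm_real]
        have h2 := lintegral_mul_sq_le (volume.restrict (Ioo (0 : ℝ) 1))
          (a := fun s => ‖m ξ s‖ₑ) (b := fun s => ‖(𝓕⁻ (slice s)) ξ‖ₑ)
          (hmm ξ).enorm.aemeasurable
          ((hφm.comp_measurable (measurable_prodMk_left (x := ξ))).enorm.aemeasurable)
        have h3 := mul_le_mul_right ((pow_le_pow_left' h1 2).trans h2) (k ξ)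
        rw [← mul_assoc] at h3
        exact h3.trans (mul_le_of_le_one_left' (hk ξ))
    _ = ∫⁻ s in Ioo (0 : ℝ) 1, ∫⁻ ξ, ‖(𝓕⁻ (slice s)) ξ‖ₑ ^ 2 := by
        refine lintegral_lintegral_swap ?_
        exact (hφm.enorm.pow_const 2).aemeasurable
    _ ≤ ∫⁻ s in Ioo (0 : ℝ) 1, ∫⁻ x, ‖slice s x‖ₑ ^ 2 := by
        refine lintegral_mono fun s => lintegral_fourierInv_sq_le (hslicem s) fun x hx => ?_
        exact hF0 (x, s) fun h => absurd h.1 (not_lt.2 hx)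
    _ ≤ ∫⁻ s, ∫⁻ x, ‖slice s x‖ₑ ^ 2 := setLIntegral_le_lintegral _ _
    _ = ∫⁻ x, ‖F x‖ₑ ^ 2 := by
        rw [lintegral_eq_lintegral_join, Measure.volume_eq_prod, lintegral_prod_symm]
        exact ((hFm.comp_measurable continuous_join.measurable).enorm.pow_const 2).aemeasurable
    _ = ∫⁻ x in halfBall d, ‖f x‖ₑ ^ 2 := by
        rw [← lintegral_indicator measurableSet_halfBall]
        refine lintegral_congr_ae ?_
        have h := (ae_restrict_iff' measurableSet_halfBall).1 hff'
        filter_upwards [h] with x hx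
        by_cases hx' : x ∈ halfBall d
        · simp [hF, hx', hx hx', enorm_eq_nnnorm, Complex.nnnorm_real]
        · simp [hF, hx']

end PartialFourier

/-! ### Integration by parts in the half ball -/

section IntegrationByParts

open Filter Topology

variable {d : ℕ} {f : Eucl (d + 1) → ℝ} {Df : Eucl (d + 1) → Fin (d + 1) → ℝ}

lemma HasH1Gradient.integrable (hf : HasH1Gradient f Df) :
    Integrable f (volume.restrict (halfBall d)) := hf.memLp.integrable (by norm_num)

lemma HasH1Gradient.integrable_grad (hf : HasH1Gradient f Df) (i : Fin (d + 1)) :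
    Integrable (fun x => Df x i) (volume.restrict (halfBall d)) :=
  (hf.memLp_grad i).integrable (by norm_num)

lemma hasCompactSupport_of_eq_zero {k : ℕ} {E : Type*} [Zero E] {q : Eucl k → E}
    (h : ∀ x, 1 ≤ ‖x‖ → q x = 0) : HasCompactSupport q := by
  refine HasCompactSupport.of_support_subset_isCompact (isCompact_closedBall (0 : Eucl k) 1) ?_
  intro x hx
  by_contra h'
  exact hx (h x (le_of_lt (by simpa using h')))

lemma continuous_partialDeriv {k : ℕ} {q : Eucl k → ℝ} (hq : ContDiff ℝ ∞ q) (i : Fin k) :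
    Continuous (partialDeriv i q) :=
  (hq.continuous_fderiv (by simp)).clm_apply continuous_const

lemma contDiff_partialDeriv {k : ℕ} {q : Eucl k → ℝ} (hq : ContDiff ℝ ∞ q) (i : Fin k) :
    ContDiff ℝ ∞ (partialDeriv i q) :=
  (hq.fderiv_right (m := ∞) (by simp)).clm_apply contDiff_const

lemma hasCompactSupport_partialDeriv {k : ℕ} {q : Eucl k → ℝ} (hq : HasCompactSupport q)
    (i : Fin k) : HasCompactSupport (partialDeriv i q) :=
  hq.fderiv_apply ℝ _

lemma exists_bound_partialDeriv {k : ℕ} {q : Eucl k → ℝ} (hq : ContDiff ℝ ∞ q)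
    (hc : HasCompactSupport q) (i : Fin k) : ∃ C, ∀ x, ‖partialDeriv i q x‖ ≤ C :=
  (continuous_partialDeriv hq i).bounded_above_of_compact_support
    (hasCompactSupport_partialDeriv hc i)

/-- Outside the closed ball this is clear. A point of the sphere is a limit of such points, and the
derivative is continuous. -/
lemma partialDeriv_eq_zero {k : ℕ} {q : Eucl k → ℝ} (hq : ContDiff ℝ ∞ q) (i : Fin k)
    (h : ∀ x, 1 ≤ ‖x‖ → q x = 0) (x : Eucl k) (hx : 1 ≤ ‖x‖) : partialDeriv i q x = 0 := by
  have hx' : x ∈ closure {y : Eucl k | 1 < ‖y‖} := by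
    have hx0 : x ≠ 0 := by
      rintro rfl
      simp at hx
      linarith
    refine mem_closure_of_tendsto (b := atTop) (f := fun n : ℕ => (1 + 1 / ((n : ℝ) + 1)) • x) ?_ ?_
    · have h1 : Tendsto (fun n : ℕ => 1 + 1 / ((n : ℝ) + 1)) atTop (𝓝 (1 + 0)) :=
        tendsto_const_nhds.add tendsto_one_div_add_atTop_nhds_zero_nat
      simpa using h1.smul_const x
    · refine Eventually.of_forall fun n => ?_
      simp only [mem_ofPred_eq, norm_smul, Real.norm_eq_abs]
      have : (0 : ℝ) < 1 / ((n : ℝ) + 1) := by positivity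
      rw [abs_of_pos (by linarith)]
      nlinarith
  have hcl : IsClosed {y : Eucl k | partialDeriv i q y = 0} :=
    isClosed_eq (continuous_partialDeriv hq i) continuous_const
  refine (hcl.closure_subset_iff.2 fun y hy => ?_) hx'
  have hev : q =ᶠ[𝓝 y] fun _ => 0 := by
    filter_upwards [(isOpen_lt continuous_const continuous_norm).mem_nhds hy] with z hz
    exact h z (le_of_lt hz)
  simp [partialDeriv, hev.fderiv_eq]

/-- The support of `q` may touch the sphere, so `q` need not be a test function. The dilates `q(c
x)` with `c > 1` are supported inside the open half ball, and `c → 1` is taken by dominated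
convergence. -/
lemma HasH1Gradient.integral_of_tsupport (hf : HasH1Gradient f Df) {q : Eucl (d + 1) → ℝ}
    (hq : ContDiff ℝ ∞ q) (hq0 : ∀ x, 1 ≤ ‖x‖ → q x = 0)
    (hqs : tsupport q ⊆ {x | 0 < x (Fin.last d)}) (i : Fin (d + 1)) :
    ∫ x in halfBall d, f x * partialDeriv i q x = - ∫ x in halfBall d, Df x i * q x := by
  have hqc := hasCompactSupport_of_eq_zero hq0
  have hsub : tsupport q ⊆ Metric.closedBall 0 1 := by
    refine closure_minimal (fun x hx => ?_) Metric.isClosed_closedBall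
    by_contra h'
    exact hx (hq0 x (le_of_lt (by simpa using h')))
  set c : ℕ → ℝ := fun n => 1 + 1 / ((n : ℝ) + 1) with hc
  have hc1 : ∀ n, 1 < c n := fun n => by
    have : (0 : ℝ) < 1 / ((n : ℝ) + 1) := by positivity
    simp only [hc]; linarith
  have hc2 : ∀ n, c n ≤ 2 := fun n => by
    have : 1 / ((n : ℝ) + 1) ≤ 1 := by
      rw [div_le_one (by positivity)]
      linarith [n.cast_nonneg (α := ℝ)]
    simp only [hc]; linarith
  have hct : Tendsto c atTop (𝓝 1) := by
    have h1 : Tendsto c atTop (𝓝 (1 + 0)) :=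
      tendsto_const_nhds.add tendsto_one_div_add_atTop_nhds_zero_nat
    simpa using h1
  have hcx : ∀ x : Eucl (d + 1), Tendsto (fun n => c n • x) atTop (𝓝 x) := fun x => by
    simpa using hct.smul_const x
  set θ : ℕ → Eucl (d + 1) → ℝ := fun n x => q (c n • x) with hθ
  have htest : ∀ n, IsTest (halfBall d) (θ n) := by
    intro n
    have hcn : c n ≠ 0 := by linarith [hc1 n]
    have e : θ n = q ∘ (Homeomorph.smulOfNeZero (c n) hcn) := rfl
    have ht : tsupport (θ n) = (Homeomorph.smulOfNeZero (c n) hcn) ⁻¹' tsupport q := by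
      rw [e, tsupport_comp_eq_preimage]
    refine ⟨hq.comp (contDiff_const_smul _), ?_, ?_⟩
    · rw [e]
      exact hqc.comp_homeomorph _
    · rw [ht]
      intro x hx
      have h1 : c n • x ∈ tsupport q := hx
      have h2 := hsub h1
      have h3 := hqs h1
      rw [mem_closedBall_zero_iff, norm_smul, Real.norm_eq_abs, abs_of_pos (by linarith [hc1 n])] at h2
      simp only [mem_ofPred_eq, PiLp.smul_apply, smul_eq_mul] at h3
      refine ⟨?_, (mul_pos_iff_of_pos_left (by linarith [hc1 n])).1 h3⟩
      by_contra! hx1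
      nlinarith [hc1 n]
  have hderiv : ∀ n x, partialDeriv i (θ n) x = c n * partialDeriv i q (c n • x) := by
    intro n x
    have h1 : HasFDerivAt (fun x : Eucl (d + 1) => c n • x)
        (c n • ContinuousLinearMap.id ℝ (Eucl (d + 1))) x :=
      (hasFDerivAt_id x).const_smul (c n)
    have h2 := ((hq.differentiable (by simp)) (c n • x)).hasFDerivAt.comp x h1
    have h3 : fderiv ℝ (θ n) x = _ := h2.fderiv
    simp [partialDeriv, h3]
  obtain ⟨C, hC⟩ := exists_bound_partialDeriv hq hqc i
  obtain ⟨C', hC'⟩ := hq.continuous.bounded_above_of_compact_support hqc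
  have lim1 : Tendsto (fun n => ∫ x in halfBall d, f x * partialDeriv i (θ n) x) atTop
      (𝓝 (∫ x in halfBall d, f x * partialDeriv i q x)) := by
    refine tendsto_integral_of_dominated_convergence (fun x => ‖f x‖ * (2 * C)) (fun n => ?_)
      (hf.integrable.norm.mul_const _) (fun n => ?_) ?_
    · exact hf.integrable.aestronglyMeasurable.mul
        (continuous_partialDeriv (htest n).1 i).aestronglyMeasurable
    · refine Eventually.of_forall fun x => ?_
      rw [norm_mul, hderiv, norm_mul, Real.norm_eq_abs (c n), abs_of_pos (by linarith [hc1 n])]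
      gcongr
      · exact hc2 n
      · exact hC _
    · refine Eventually.of_forall fun x => ?_
      simp only [hderiv]
      have := hct.mul (((continuous_partialDeriv hq i).tendsto x).comp (hcx x))
      simpa using this.const_mul (f x)
  have lim2 : Tendsto (fun n => - ∫ x in halfBall d, Df x i * θ n x) atTop
      (𝓝 (- ∫ x in halfBall d, Df x i * q x)) := by
    refine (tendsto_integral_of_dominated_convergence (fun x => ‖Df x i‖ * C') (fun n => ?_)
      ((hf.integrable_grad i).norm.mul_const _) (fun n => ?_) ?_).neg
    · exact (hf.integrable_grad i).aestronglyMeasurable.mul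
        (htest n).1.continuous.aestronglyMeasurable
    · refine Eventually.of_forall fun x => ?_
      rw [norm_mul]
      gcongr
      exact hC' _
    · refine Eventually.of_forall fun x => ?_
      exact ((hq.continuous.tendsto x).comp (hcx x)).const_mul (Df x i)
  refine tendsto_nhds_unique lim1 ?_
  simpa only [hf.weak_deriv _ (htest _) i] using lim2

/-- A smooth function on the real line vanishing on `(-∞, 1]` and equal to one on `[2, ∞)`. -/
noncomputable def cutoff (t : ℝ) : ℝ := Real.smoothTransition (t - 1)

lemma contDiff_cutoff : ContDiff ℝ ∞ cutoff :=
  Real.smoothTransition.contDiff.comp (contDiff_id.sub contDiff_const)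

lemma norm_cutoff_le (t : ℝ) : ‖cutoff t‖ ≤ 1 := by
  rw [Real.norm_eq_abs, cutoff, abs_of_nonneg (Real.smoothTransition.nonneg _)]
  exact Real.smoothTransition.le_one _

lemma cutoff_of_le {t : ℝ} (h : t ≤ 1) : cutoff t = 0 :=
  Real.smoothTransition.zero_of_nonpos (by linarith)

lemma cutoff_of_ge {t : ℝ} (h : 2 ≤ t) : cutoff t = 1 :=
  Real.smoothTransition.one_of_one_le (by linarith)

lemma deriv_cutoff_of_gt {t : ℝ} (h : 2 < t) : deriv cutoff t = 0 := by
  have : cutoff =ᶠ[𝓝 t] fun _ => 1 := by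
    filter_upwards [lt_mem_nhds h] with s hs
    exact cutoff_of_ge hs.le
  simp [this.deriv_eq]

lemma deriv_cutoff_of_lt {t : ℝ} (h : t < 1) : deriv cutoff t = 0 := by
  have : cutoff =ᶠ[𝓝 t] fun _ => 0 := by
    filter_upwards [gt_mem_nhds h] with s hs
    exact cutoff_of_le (le_of_lt hs)
  simp [this.deriv_eq]

/-- The derivative is supported in `[1, 2]`. The product `t * deriv cutoff t` is scale invariant, so
it bounds `x_{d+1}` times the normal derivative of `cutoff (N x_{d+1})` uniformly in `N`. -/
lemma exists_bound_mul_deriv_cutoff : ∃ C, ∀ t, ‖t * deriv cutoff t‖ ≤ C := by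
  refine Continuous.bounded_above_of_compact_support
    (continuous_id.mul (contDiff_cutoff.continuous_deriv (by simp))) ?_
  refine HasCompactSupport.of_support_subset_isCompact (isCompact_Icc (a := (1 : ℝ)) (b := 2)) ?_
  intro t ht
  by_contra h'
  rw [mem_Icc, not_and_or, not_le, not_le] at h'
  rcases h' with hlt | hgt
  · exact ht (by simp [deriv_cutoff_of_lt hlt])
  · exact ht (by simp [deriv_cutoff_of_gt hgt])

/-- Green's formula without boundary term: the test function vanishes on the sphere, and also on
the flat part of the boundary when the derivative is normal. -/
lemma HasH1Gradient.integral_eq (hf : HasH1Gradient f Df) {q : Eucl (d + 1) → ℝ}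
    (hq : ContDiff ℝ ∞ q) (hq0 : ∀ x, 1 ≤ ‖x‖ → q x = 0) (i : Fin (d + 1))
    (hqi : i = Fin.last d → ∀ x, x (Fin.last d) = 0 → q x = 0) :
    ∫ x in halfBall d, f x * partialDeriv i q x = - ∫ x in halfBall d, Df x i * q x := by
  have hqc := hasCompactSupport_of_eq_zero hq0
  set N : ℕ → ℝ := fun n => (n : ℝ) + 1 with hN
  have hNpos : ∀ n, 0 < N n := fun n => by simp only [hN]; positivity
  have hev : ∀ s : ℝ, 0 < s → ∀ᶠ n in atTop, 2 < N n * s := by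
    intro s hs
    have : Tendsto (fun n : ℕ => N n * s) atTop atTop :=
      (tendsto_natCast_atTop_atTop.atTop_add tendsto_const_nhds).atTop_mul_const hs
    exact this.eventually_gt_atTop 2
  -- `χ n` vanishes in a layer of thickness `1 / N n` along the flat boundary, which brings the test
  -- function back to the previous case.
  set χ : ℕ → Eucl (d + 1) → ℝ := fun n x => cutoff (N n * x (Fin.last d)) with hχ
  have hχs : ∀ n, ContDiff ℝ ∞ (χ n) := fun n =>
    contDiff_cutoff.comp (contDiff_const.mul (normalCoord (d := d)).contDiff)
  set θ : ℕ → Eucl (d + 1) → ℝ := fun n x => χ n x * q x with hθ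
  have hθs : ∀ n, ContDiff ℝ ∞ (θ n) := fun n => (hχs n).mul hq
  have hθ0 : ∀ n x, 1 ≤ ‖x‖ → θ n x = 0 := fun n x hx => by simp [hθ, hq0 x hx]
  have hθt : ∀ n, tsupport (θ n) ⊆ {x | 0 < x (Fin.last d)} := by
    intro n
    have : tsupport (θ n) ⊆ {x | 1 ≤ N n * x (Fin.last d)} := by
      refine closure_minimal (fun x hx => ?_) (isClosed_le continuous_const
        (continuous_const.mul (normalCoord (d := d)).continuous))
      by_contra h'
      exact hx (by simp [hθ, hχ, cutoff_of_le (le_of_lt (not_le.1 h'))])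
    intro x hx
    have h1 : 1 ≤ N n * x (Fin.last d) := this hx
    exact (mul_pos_iff_of_pos_left (hNpos n)).1 (lt_of_lt_of_le one_pos h1)
  have hχd : ∀ n x, partialDeriv i (χ n) x =
      if i = Fin.last d then N n * deriv cutoff (N n * x (Fin.last d)) else 0 := by
    intro n x
    have h1 : HasFDerivAt (fun x : Eucl (d + 1) => N n * x (Fin.last d)) (N n • normalCoord) x :=
      (normalCoord (d := d)).hasFDerivAt.const_mul (N n)
    have h2 := ((contDiff_cutoff.differentiable (by simp))
      (N n * x (Fin.last d))).hasDerivAt.comp_hasFDerivAt x h1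
    have h3 : fderiv ℝ (χ n) x = _ := h2.fderiv
    rw [partialDeriv, h3]
    simp only [smul_apply, normalCoord_apply, smul_eq_mul]
    by_cases hi : i = Fin.last d
    · subst hi
      simp
      ring
    · simp [hi, Ne.symm hi]
  have hθd : ∀ n x, partialDeriv i (θ n) x =
      χ n x * partialDeriv i q x + partialDeriv i (χ n) x * q x := by
    intro n x
    have := fderiv_fun_mul ((hχs n).differentiable (by simp) x) (hq.differentiable (by simp) x)
    simp only [partialDeriv]
    rw [this]
    simp [mul_comm]
  obtain ⟨C, hC⟩ := exists_bound_partialDeriv hq hqc i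
  obtain ⟨C', hC'⟩ := hq.continuous.bounded_above_of_compact_support hqc
  obtain ⟨K, hK⟩ := exists_bound_mul_deriv_cutoff
  obtain ⟨M, hM⟩ : ∃ M, ∀ x, ‖fderiv ℝ q x‖ ≤ M :=
    (hq.continuous_fderiv (by simp)).bounded_above_of_compact_support (hqc.fderiv ℝ)
  -- The derivative of the cutoff is of size `1 / x_{d+1}`, but `q` vanishes on the flat part and is
  -- therefore at most `M x_{d+1}` by the mean value inequality. For tangential derivatives the term
  -- is zero.
  have hbound : ∀ n x, 0 < x (Fin.last d) → ‖partialDeriv i (χ n) x * q x‖ ≤ M * K := by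
    intro n x hx
    have hM0 : 0 ≤ M := (norm_nonneg _).trans (hM 0)
    have hK0 : 0 ≤ K := (norm_nonneg _).trans (hK 0)
    rw [hχd]
    split_ifs with hi
    · have h0 : q (flat (tang x)) = 0 := hqi hi _ (by simp [flat_eq_join])
      have h1 : ‖q x - q (flat (tang x))‖ ≤ M * ‖x - flat (tang x)‖ :=
        Convex.norm_image_sub_le_of_norm_fderiv_le (𝕜 := ℝ)
          (fun y _ => hq.differentiable (by simp) y) (fun y _ => hM y) convex_univ
          (mem_univ _) (mem_univ _)
      have h2 : ‖x - flat (tang x)‖ = x (Fin.last d) := by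
        have : x - flat (tang x) = joinPt (0, x (Fin.last d)) := by
          ext j
          refine Fin.lastCases ?_ (fun j => ?_) j <;> simp [flat_eq_join]
        have h3 := norm_join_sq ((0 : Eucl d), x (Fin.last d))
        rw [this]
        simp only [norm_zero] at h3
        exact (sq_eq_sq₀ (norm_nonneg _) hx.le).1 (by linarith)
      rw [h0, sub_zero, h2] at h1
      calc ‖N n * deriv cutoff (N n * x (Fin.last d)) * q x‖
          = ‖N n * deriv cutoff (N n * x (Fin.last d))‖ * ‖q x‖ := norm_mul _ _
        _ ≤ ‖N n * deriv cutoff (N n * x (Fin.last d))‖ * (M * x (Fin.last d)) := by gcongr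
        _ = M * ‖N n * x (Fin.last d) * deriv cutoff (N n * x (Fin.last d))‖ := by
            simp only [norm_mul, Real.norm_eq_abs, abs_of_pos hx]
            ring
        _ ≤ M * K := by
            gcongr
            exact hK _
    · simpa using mul_nonneg hM0 hK0
  have hpos : ∀ᵐ x ∂volume.restrict (halfBall d), 0 < x (Fin.last d) := by
    filter_upwards [ae_restrict_mem measurableSet_halfBall] with x hx
    exact hx.2
  have lim1 : Tendsto (fun n => ∫ x in halfBall d, f x * partialDeriv i (θ n) x) atTop
      (𝓝 (∫ x in halfBall d, f x * partialDeriv i q x)) := by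
    refine tendsto_integral_of_dominated_convergence (fun x => ‖f x‖ * (C + M * K)) (fun n => ?_)
      (hf.integrable.norm.mul_const _) (fun n => ?_) ?_
    · exact hf.integrable.aestronglyMeasurable.mul
        (continuous_partialDeriv (hθs n) i).aestronglyMeasurable
    · filter_upwards [hpos] with x hx
      rw [norm_mul, hθd]
      gcongr
      refine (norm_add_le _ _).trans (add_le_add ?_ (hbound n x hx))
      rw [norm_mul]
      exact (mul_le_of_le_one_left (norm_nonneg _) (norm_cutoff_le _)).trans (hC x)
    · filter_upwards [hpos] with x hx
      refine tendsto_const_nhds.congr' ?_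
      filter_upwards [hev _ hx] with n hn
      rw [hθd, hχd]
      simp only [hχ, cutoff_of_ge hn.le, deriv_cutoff_of_gt hn]
      simp
  have lim2 : Tendsto (fun n => - ∫ x in halfBall d, Df x i * θ n x) atTop
      (𝓝 (- ∫ x in halfBall d, Df x i * q x)) := by
    refine (tendsto_integral_of_dominated_convergence (fun x => ‖Df x i‖ * C') (fun n => ?_)
      ((hf.integrable_grad i).norm.mul_const _) (fun n => ?_) ?_).neg
    · exact (hf.integrable_grad i).aestronglyMeasurable.mul
        (hθs n).continuous.aestronglyMeasurable
    · refine Eventually.of_forall fun x => ?_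
      rw [norm_mul]
      gcongr
      rw [norm_mul]
      exact (mul_le_of_le_one_left (norm_nonneg _) (norm_cutoff_le _)).trans (hC' x)
    · filter_upwards [hpos] with x hx
      refine tendsto_const_nhds.congr' ?_
      filter_upwards [hev _ hx] with n hn
      simp only [hθ, hχ, cutoff_of_ge hn.le, one_mul]
  refine tendsto_nhds_unique lim1 ?_
  simpa only [hf.integral_of_tsupport (hθs _) (hθ0 _) (hθt _) i] using lim2

/-- The weak gradient of the product `p f` of a smooth function and an `H¹` function. -/
noncomputable def prodGrad (p f : Eucl (d + 1) → ℝ) (Df : Eucl (d + 1) → Fin (d + 1) → ℝ)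
    (x : Eucl (d + 1)) (i : Fin (d + 1)) : ℝ :=
  p x * Df x i + f x * partialDeriv i p x

lemma partialDeriv_mul {k : ℕ} {p q : Eucl k → ℝ} (hp : ContDiff ℝ ∞ p) (hq : ContDiff ℝ ∞ q)
    (i : Fin k) (x : Eucl k) : partialDeriv i (fun x => p x * q x) x =
      p x * partialDeriv i q x + q x * partialDeriv i p x := by
  have := fderiv_fun_mul (hp.differentiable (by simp) x) (hq.differentiable (by simp) x)
  simp only [partialDeriv]
  rw [this]
  simp

lemma MeasureTheory.MemLp.mul_contDiff {p g : Eucl (d + 1) → ℝ} (hp : ContDiff ℝ ∞ p)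
    (hp0 : HasCompactSupport p) (hg : MemLp g 2 (volume.restrict (halfBall d))) :
    MemLp (fun x => p x * g x) 2 (volume.restrict (halfBall d)) := by
  obtain ⟨C, hC⟩ := hp.continuous.bounded_above_of_compact_support hp0
  refine hg.of_le_mul (c := C) (hp.continuous.aestronglyMeasurable.mul hg.1)
    (Eventually.of_forall fun x => ?_)
  rw [norm_mul]
  gcongr
  exact hC x

variable {p : Eucl (d + 1) → ℝ}

lemma HasH1Gradient.memLp_mul (hf : HasH1Gradient f Df) (hp : ContDiff ℝ ∞ p)
    (hp0 : ∀ x, 1 ≤ ‖x‖ → p x = 0) :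
    MemLp (fun x => p x * f x) 2 (volume.restrict (halfBall d)) :=
  hf.memLp.mul_contDiff hp (hasCompactSupport_of_eq_zero hp0)

lemma HasH1Gradient.memLp_prodGrad (hf : HasH1Gradient f Df) (hp : ContDiff ℝ ∞ p)
    (hp0 : ∀ x, 1 ≤ ‖x‖ → p x = 0) (i : Fin (d + 1)) :
    MemLp (fun x => prodGrad p f Df x i) 2 (volume.restrict (halfBall d)) := by
  have hc := hasCompactSupport_of_eq_zero hp0
  refine ((hf.memLp_grad i).mul_contDiff hp hc).add ?_
  simpa only [mul_comm] using
    hf.memLp.mul_contDiff (contDiff_partialDeriv hp i) (hasCompactSupport_partialDeriv hc i)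

/-- Apply the previous formula to `p Θ`. The factor `p` supplies the vanishing on the sphere, so `Θ`
may be a plane wave without decay. -/
lemma HasH1Gradient.integral_mul_real (hf : HasH1Gradient f Df) (hp : ContDiff ℝ ∞ p)
    (hp0 : ∀ x, 1 ≤ ‖x‖ → p x = 0) {Θ : Eucl (d + 1) → ℝ} (hΘ : ContDiff ℝ ∞ Θ) (i : Fin (d + 1))
    (hi : i = Fin.last d → ∀ x, x (Fin.last d) = 0 → Θ x = 0) :
    ∫ x in halfBall d, p x * f x * partialDeriv i Θ x =
      - ∫ x in halfBall d, prodGrad p f Df x i * Θ x := by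
  have hc := hasCompactSupport_of_eq_zero hp0
  have h := hf.integral_eq (hp.mul hΘ) (fun x hx => by simp [hp0 x hx]) i
    (fun h x hx => by simp [hi h x hx])
  have i1 : ∀ {g r : Eucl (d + 1) → ℝ}, Integrable g (volume.restrict (halfBall d)) →
      Continuous r → HasCompactSupport r →
      Integrable (fun x => g x * r x) (volume.restrict (halfBall d)) := by
    intro g r hg hr hrc
    obtain ⟨C, hC⟩ := hr.bounded_above_of_compact_support hrc
    exact hg.mul_bdd (c := C) hr.aestronglyMeasurable (Eventually.of_forall hC)
  have c1 : HasCompactSupport fun x => p x * partialDeriv i Θ x := hc.mul_right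
  have c2 : HasCompactSupport fun x => partialDeriv i p x * Θ x :=
    (hasCompactSupport_partialDeriv hc i).mul_right
  have c3 : HasCompactSupport fun x => p x * Θ x := hc.mul_right
  have j1 : Integrable (fun x => f x * (p x * partialDeriv i Θ x)) (volume.restrict (halfBall d)) :=
    i1 hf.integrable (hp.continuous.mul (continuous_partialDeriv hΘ i)) c1
  have j2 : Integrable (fun x => f x * (partialDeriv i p x * Θ x)) (volume.restrict (halfBall d)) :=
    i1 hf.integrable ((continuous_partialDeriv hp i).mul hΘ.continuous) c2
  have j3 : Integrable (fun x => Df x i * (p x * Θ x)) (volume.restrict (halfBall d)) :=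
    i1 (hf.integrable_grad i) (hp.continuous.mul hΘ.continuous) c3
  have e1 : ∫ x in halfBall d, f x * partialDeriv i (fun x => p x * Θ x) x =
      (∫ x in halfBall d, f x * (p x * partialDeriv i Θ x)) +
        ∫ x in halfBall d, f x * (partialDeriv i p x * Θ x) := by
    rw [← integral_add j1 j2]
    refine integral_congr_ae (Eventually.of_forall fun x => ?_)
    simp only [partialDeriv_mul hp hΘ]
    ring
  have e2 : ∫ x in halfBall d, prodGrad p f Df x i * Θ x =
      (∫ x in halfBall d, Df x i * (p x * Θ x)) +
        ∫ x in halfBall d, f x * (partialDeriv i p x * Θ x) := by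
    rw [← integral_add j3 j2]
    refine integral_congr_ae (Eventually.of_forall fun x => ?_)
    simp only [prodGrad]
    ring
  have e3 : ∫ x in halfBall d, p x * f x * partialDeriv i Θ x =
      ∫ x in halfBall d, f x * (p x * partialDeriv i Θ x) := by
    refine integral_congr_ae (Eventually.of_forall fun x => ?_)
    ring
  rw [e1] at h
  rw [e2, e3]
  linarith

/-- Green's formula for `p f` with complex test functions. -/
lemma HasH1Gradient.integral_mul_complex (hf : HasH1Gradient f Df) (hp : ContDiff ℝ ∞ p)
    (hp0 : ∀ x, 1 ≤ ‖x‖ → p x = 0) {Θ : Eucl (d + 1) → ℂ} (hΘ : ContDiff ℝ ∞ Θ) (i : Fin (d + 1))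
    (hi : i = Fin.last d → ∀ x, x (Fin.last d) = 0 → Θ x = 0) :
    ∫ x in halfBall d, ((p x * f x : ℝ) : ℂ) * fderiv ℝ Θ x (EuclideanSpace.single i 1) =
      - ∫ x in halfBall d, (prodGrad p f Df x i : ℂ) * Θ x := by
  have ib : ∀ {g : Eucl (d + 1) → ℝ} {r : Eucl (d + 1) → ℂ},
      Integrable g (volume.restrict (halfBall d)) → Continuous r →
      Integrable (fun x => (g x : ℂ) * r x) (volume.restrict (halfBall d)) := by
    intro g r hg hr
    obtain ⟨C, hC⟩ := (isCompact_closedBall (0 : Eucl (d + 1)) 1).exists_bound_of_continuousOn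
      hr.continuousOn
    refine hg.ofReal.mul_bdd (c := C) hr.aestronglyMeasurable ?_
    filter_upwards [ae_restrict_mem measurableSet_halfBall] with x hx
    exact hC x (Metric.ball_subset_closedBall (halfBall_subset_ball hx))
  have I1 := ib ((hf.memLp_mul hp hp0).integrable (by norm_num))
    ((hΘ.continuous_fderiv (by simp)).clm_apply
      (continuous_const (y := (EuclideanSpace.single i 1 : Eucl (d + 1)))))
  have I2 := ib ((hf.memLp_prodGrad hp hp0 i).integrable (by norm_num)) hΘ.continuous
  have hre : ContDiff ℝ ∞ fun x => (Θ x).re := Complex.reCLM.contDiff.comp hΘ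
  have him : ContDiff ℝ ∞ fun x => (Θ x).im := Complex.imCLM.contDiff.comp hΘ
  have dre : ∀ x, partialDeriv i (fun x => (Θ x).re) x =
      (fderiv ℝ Θ x (EuclideanSpace.single i 1)).re := fun x => by
    have := (Complex.reCLM.hasFDerivAt.comp x (hΘ.differentiable (by simp) x).hasFDerivAt).fderiv
    change fderiv ℝ (Complex.reCLM ∘ Θ) x _ = _
    rw [this]; rfl
  have dim : ∀ x, partialDeriv i (fun x => (Θ x).im) x =
      (fderiv ℝ Θ x (EuclideanSpace.single i 1)).im := fun x => by
    have := (Complex.imCLM.hasFDerivAt.comp x (hΘ.differentiable (by simp) x).hasFDerivAt).fderiv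
    change fderiv ℝ (Complex.imCLM ∘ Θ) x _ = _
    rw [this]; rfl
  have hr := hf.integral_mul_real hp hp0 hre i fun h x hx => by simp [hi h x hx]
  have hm := hf.integral_mul_real hp hp0 him i fun h x hx => by simp [hi h x hx]
  simp only [dre, dim] at hr hm
  have re_int : ∀ {g : Eucl (d + 1) → ℂ}, Integrable g (volume.restrict (halfBall d)) →
      (∫ x in halfBall d, g x).re = ∫ x in halfBall d, (g x).re := fun hg => (integral_re hg).symm
  have im_int : ∀ {g : Eucl (d + 1) → ℂ}, Integrable g (volume.restrict (halfBall d)) →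
      (∫ x in halfBall d, g x).im = ∫ x in halfBall d, (g x).im := fun hg => (integral_im hg).symm
  apply Complex.ext
  · rw [Complex.neg_re, re_int I1, re_int I2]
    simpa only [Complex.re_ofReal_mul] using hr
  · rw [Complex.neg_im, im_int I1, im_int I2]
    simpa only [Complex.im_ofReal_mul] using hm

end IntegrationByParts

/-! ### The exponential multipliers -/

section Multipliers

variable {d : ℕ}

/-- The symbol `|2πξ|` of `(-Δ)^{1/2}`. -/
noncomputable def rho (ξ : Eucl d) : ℝ := 2 * Real.pi * ‖ξ‖

/-- The multiplier `1`. -/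
def multOne (_ : Eucl d) (_ : ℝ) : ℝ := 1

/-- The multiplier `e^{-|2πξ|s}`. -/
noncomputable def multExp (ξ : Eucl d) (s : ℝ) : ℝ := Real.exp (-(rho ξ * s))

/-- The multiplier `|2πξ|s e^{-|2πξ|s}`. -/
noncomputable def multLin (ξ : Eucl d) (s : ℝ) : ℝ := rho ξ * s * Real.exp (-(rho ξ * s))

lemma rho_nonneg (ξ : Eucl d) : 0 ≤ rho ξ := by unfold rho; positivity

lemma rho_neg (ξ : Eucl d) : rho (-ξ) = rho ξ := by simp [rho]

lemma continuous_rho : Continuous (rho : Eucl d → ℝ) := by unfold rho; fun_prop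

lemma isUnitMultiplier_one : IsUnitMultiplier (multOne : Eucl d → ℝ → ℝ) :=
  ⟨continuous_const, fun ξ s _ => by simp [multOne], fun _ _ => rfl⟩

lemma isUnitMultiplier_exp : IsUnitMultiplier (multExp : Eucl d → ℝ → ℝ) := by
  refine ⟨?_, fun ξ s hs => ?_, fun ξ s => by simp [multExp, rho_neg]⟩
  · have := continuous_rho (d := d)
    unfold multExp
    fun_prop
  · rw [multExp, Real.norm_eq_abs, Real.abs_exp, Real.exp_le_one_iff]
    have := mul_nonneg (rho_nonneg ξ) hs.le
    linarith

lemma mul_exp_neg_le_one {x : ℝ} : x * Real.exp (-x) ≤ 1 := by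
  rw [Real.exp_neg, ← div_eq_mul_inv, div_le_one (Real.exp_pos _)]
  linarith [Real.add_one_le_exp x]

lemma isUnitMultiplier_lin : IsUnitMultiplier (multLin : Eucl d → ℝ → ℝ) := by
  refine ⟨?_, fun ξ s hs => ?_, fun ξ s => by simp [multLin, rho_neg]⟩
  · have := continuous_rho (d := d)
    unfold multLin
    fun_prop
  · have := mul_nonneg (rho_nonneg ξ) hs.le
    rw [multLin, Real.norm_eq_abs, abs_of_nonneg (by positivity)]
    exact mul_exp_neg_le_one

/-- From `(x/4 - 1)² ≥ 0` one gets `x ≤ (1 + x/4)² ≤ e^{x/2}`, hence `x² ≤ e^x`. This gives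
`multLin` the same square bound as `multExp`. -/
lemma mul_exp_neg_sq_le {x : ℝ} (hx : 0 ≤ x) : (x * Real.exp (-x)) ^ 2 ≤ Real.exp (-x) := by
  have h1 : x ≤ Real.exp (x / 2) := by
    have h2 : 1 + x / 4 ≤ Real.exp (x / 4) := by linarith [Real.add_one_le_exp (x / 4)]
    have h3 : Real.exp (x / 2) = Real.exp (x / 4) ^ 2 := by
      rw [← Real.exp_nat_mul]; congr 1; push_cast; ring
    rw [h3]
    nlinarith [sq_nonneg (x / 4 - 1)]
  have h4 : x ^ 2 ≤ Real.exp x := by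
    have : Real.exp x = Real.exp (x / 2) ^ 2 := by
      rw [← Real.exp_nat_mul]; congr 1; push_cast; ring
    rw [this]
    gcongr
  calc (x * Real.exp (-x)) ^ 2 = x ^ 2 * Real.exp (-x) * Real.exp (-x) := by ring
    _ ≤ Real.exp x * Real.exp (-x) * Real.exp (-x) := by gcongr
    _ = Real.exp (-x) := by rw [← Real.exp_add]; simp

/-- `ρ ∫₀¹ e^{-ρ s} ds = 1 - e^{-ρ}`. This is the source of the half derivative gained by pairing
with decaying exponentials, on the interval of heights that the half ball occupies. -/
lemma rho_mul_lintegral_le {m : ℝ → ℝ} (ξ : Eucl d)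
    (h : ∀ s, 0 < s → m s ^ 2 ≤ Real.exp (-(rho ξ * s))) :
    ENNReal.ofReal (rho ξ) * ∫⁻ s in Ioo (0 : ℝ) 1, ‖m s‖ₑ ^ 2 ≤ 1 := by
  have h1 : ∫⁻ s in Ioo (0 : ℝ) 1, ‖m s‖ₑ ^ 2 ≤
      ∫⁻ s in Ioo (0 : ℝ) 1, ENNReal.ofReal (Real.exp (-(rho ξ * s))) := by
    refine setLIntegral_mono (by fun_prop) fun s hs => ?_
    rw [← ofReal_norm, ← ENNReal.ofReal_pow (norm_nonneg _)]
    refine ENNReal.ofReal_le_ofReal ?_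
    simpa using h s hs.1
  rcases (rho_nonneg ξ).eq_or_lt with h0 | h0
  · simp [← h0]
  have h2 : IntegrableOn (fun s => Real.exp (-(rho ξ * s))) (Ioo 0 1) := by
    refine (Continuous.integrableOn_Icc (a := 0) (b := 1) ?_).mono_set Ioo_subset_Icc_self
    fun_prop
  refine (mul_le_mul_right h1 _).trans ?_
  rw [← ofReal_integral_eq_lintegral_ofReal h2 (Filter.Eventually.of_forall fun s =>
    (Real.exp_pos _).le), ← ENNReal.ofReal_mul h0.le, ENNReal.ofReal_le_one]
  have h3 : ∫ s in Ioo (0 : ℝ) 1, Real.exp (-(rho ξ * s)) =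
      (1 - Real.exp (-rho ξ)) / rho ξ := by
    rw [← integral_Ioc_eq_integral_Ioo, ← intervalIntegral.integral_of_le zero_le_one]
    have := intervalIntegral.integral_eq_sub_of_hasDerivAt (a := 0) (b := 1)
      (f := fun s => - (Real.exp (-(rho ξ * s)) / rho ξ))
      (f' := fun s => Real.exp (-(rho ξ * s))) (fun s _ => ?_)
      (Continuous.intervalIntegrable (by fun_prop) _ _)
    · rw [this]; simp; field_simp; ring
    · have h4 : HasDerivAt (fun s => -(rho ξ * s)) (-(rho ξ * 1)) s :=
        ((hasDerivAt_id s).const_mul (rho ξ)).neg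
      have h5 := (h4.exp.div_const (rho ξ)).neg
      have h6 : -(Real.exp (-(rho ξ * s)) * -(rho ξ * 1) / rho ξ) = Real.exp (-(rho ξ * s)) := by
        field_simp
      rw [h6] at h5
      exact h5
  rw [h3, mul_div_cancel₀ _ h0.ne']
  linarith [Real.exp_pos (-rho ξ)]

lemma rho_mul_lintegral_multExp_le (ξ : Eucl d) :
    ENNReal.ofReal (rho ξ) * ∫⁻ s in Ioo (0 : ℝ) 1, ‖multExp ξ s‖ₑ ^ 2 ≤ 1 := by
  refine rho_mul_lintegral_le ξ fun s hs => ?_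
  have h1 : Real.exp (-(rho ξ * s)) ≤ 1 := by
    rw [Real.exp_le_one_iff]
    linarith [mul_nonneg (rho_nonneg ξ) hs.le]
  rw [multExp]
  nlinarith [Real.exp_pos (-(rho ξ * s))]

lemma rho_mul_lintegral_multLin_le (ξ : Eucl d) :
    ENNReal.ofReal (rho ξ) * ∫⁻ s in Ioo (0 : ℝ) 1, ‖multLin ξ s‖ₑ ^ 2 ≤ 1 :=
  rho_mul_lintegral_le ξ fun _ hs => mul_exp_neg_sq_le (mul_nonneg (rho_nonneg ξ) hs.le)

lemma IsUnitMultiplier.lintegral_le {m : Eucl d → ℝ → ℝ} (hm : IsUnitMultiplier m) (ξ : Eucl d) :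
    1 * ∫⁻ s in Ioo (0 : ℝ) 1, ‖m ξ s‖ₑ ^ 2 ≤ 1 := by
  rw [one_mul]
  calc ∫⁻ s in Ioo (0 : ℝ) 1, ‖m ξ s‖ₑ ^ 2 ≤ ∫⁻ s in Ioo (0 : ℝ) 1, 1 := by
        refine setLIntegral_mono measurable_const fun s hs => ?_
        refine pow_le_one₀ (by positivity) ?_
        rw [← ofReal_norm]
        exact ENNReal.ofReal_le_one.2 (hm.bound ξ s hs.1)
    _ = 1 := by simp

end Multipliers

/-! ### Integration by parts for partial Fourier transforms -/

section Identities

variable {d : ℕ} {f p : Eucl (d + 1) → ℝ} {Df : Eucl (d + 1) → Fin (d + 1) → ℝ}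

/-- The symbol `2πi ξⱼ` of `∂ⱼ`. -/
noncomputable def symb (j : Fin d) (ξ : Eucl d) : ℂ := 2 * Real.pi * Complex.I * ξ j

lemma wave_eq_exp (ξ : Eucl d) (x : Eucl (d + 1)) :
    wave ξ x = Complex.exp (((2 * Real.pi * inner ℝ (tang x) ξ : ℝ) : ℂ) * Complex.I) := by
  rw [wave, Real.fourierChar_apply]

lemma contDiff_wave (ξ : Eucl d) : ContDiff ℝ ∞ (wave ξ) := by
  have : wave ξ = fun x => Complex.exp (((2 * Real.pi * inner ℝ (tang x) ξ : ℝ) : ℂ) * Complex.I) :=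
    funext (wave_eq_exp ξ)
  rw [this]
  refine ContDiff.cexp (ContDiff.mul ?_ contDiff_const)
  refine Complex.ofRealCLM.contDiff.comp (contDiff_const.mul ?_)
  exact (tang (d := d)).contDiff.inner ℝ contDiff_const

lemma fderiv_wave (ξ : Eucl d) (x v : Eucl (d + 1)) :
    fderiv ℝ (wave ξ) x v = 2 * Real.pi * Complex.I * (inner ℝ (tang v) ξ : ℝ) * wave ξ x := by
  have h1 : HasFDerivAt (fun x : Eucl (d + 1) => inner ℝ ξ (tang x))
      ((innerSL ℝ ξ).comp tang) x := ((innerSL ℝ ξ).comp tang).hasFDerivAt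
  have h2 := (Complex.ofRealCLM.hasFDerivAt.comp x (h1.const_mul (2 * Real.pi))).mul_const Complex.I
  have h3 := h2.cexp
  have h4 : wave ξ = fun x => Complex.exp (((2 * Real.pi * inner ℝ ξ (tang x) : ℝ) : ℂ) * Complex.I) :=
    funext fun x => by rw [wave_eq_exp, real_inner_comm]
  have h5 := h3.fderiv
  rw [h4]
  simp only [Function.comp_def, Complex.ofRealCLM_apply] at h5
  rw [h5]
  simp [real_inner_comm]
  ring

lemma tang_single_castSucc (j : Fin d) :
    tang (EuclideanSpace.single (Fin.castSucc j) (1 : ℝ)) = EuclideanSpace.single j 1 := by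
  ext i
  simp

lemma tang_single_last : tang (EuclideanSpace.single (Fin.last d) (1 : ℝ)) = 0 := by
  ext i
  simp [(Fin.castSucc_lt_last i).ne]

variable {g : ℝ → ℝ}

lemma contDiff_wave_mul (hg : ContDiff ℝ ∞ g) (ξ : Eucl d) :
    ContDiff ℝ ∞ fun x => wave ξ x * (g (x (Fin.last d)) : ℂ) :=
  (contDiff_wave ξ).mul
    (Complex.ofRealCLM.contDiff.comp (hg.comp (normalCoord (d := d)).contDiff))

lemma fderiv_wave_mul (hg : ContDiff ℝ ∞ g) (ξ : Eucl d) (x v : Eucl (d + 1)) :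
    fderiv ℝ (fun x => wave ξ x * (g (x (Fin.last d)) : ℂ)) x v =
      2 * Real.pi * Complex.I * (inner ℝ (tang v) ξ : ℝ) * (wave ξ x * g (x (Fin.last d)))
        + wave ξ x * (v (Fin.last d) * deriv g (x (Fin.last d)) : ℝ) := by
  have h1 := ((hg.differentiable (by simp)) (x (Fin.last d))).hasDerivAt.comp_hasFDerivAt x
    (normalCoord (d := d)).hasFDerivAt
  have h2 := Complex.ofRealCLM.hasFDerivAt.comp x h1
  have h3 := ((contDiff_wave ξ).differentiable (by simp) x).hasFDerivAt.mul h2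
  have h4 : fderiv ℝ (fun x => wave ξ x * (g (x (Fin.last d)) : ℂ)) x = _ := h3.fderiv
  rw [h4]
  simp [fderiv_wave]
  ring

lemma HasH1Gradient.partialFourier_tangential (hf : HasH1Gradient f Df) (hp : ContDiff ℝ ∞ p)
    (hp0 : ∀ x, 1 ≤ ‖x‖ → p x = 0) {m : Eucl d → ℝ → ℝ} (hm : ∀ ξ, ContDiff ℝ ∞ (m ξ))
    (j : Fin d) (ξ : Eucl d) :
    partialFourier m (fun x => prodGrad p f Df x (Fin.castSucc j)) ξ =
      - (symb j ξ * partialFourier m (fun x => p x * f x) ξ) := by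
  have h := hf.integral_mul_complex hp hp0 (contDiff_wave_mul (hm ξ) ξ) (Fin.castSucc j)
    (fun h => absurd h (Fin.castSucc_lt_last j).ne)
  rw [partialFourier, ← neg_eq_iff_eq_neg, ← h, partialFourier, ← integral_const_mul]
  refine integral_congr_ae (Filter.Eventually.of_forall fun x => ?_)
  simp only [fderiv_wave_mul (hm ξ), tang_single_castSucc, symb]
  have : (inner ℝ (EuclideanSpace.single j (1 : ℝ)) ξ : ℝ) = ξ j := by
    simp [EuclideanSpace.inner_single_left]
  rw [this]
  simp [(Fin.castSucc_lt_last j).ne']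
  ring

/-- Since the profile vanishes at height zero, the flat boundary contributes nothing. Traces enter
only through the constant profile, which is treated separately. -/
lemma HasH1Gradient.integral_wave_normal (hf : HasH1Gradient f Df) (hp : ContDiff ℝ ∞ p)
    (hp0 : ∀ x, 1 ≤ ‖x‖ → p x = 0) (hg : ContDiff ℝ ∞ g) (hg0 : g 0 = 0) (ξ : Eucl d) :
    partialFourier (fun _ => deriv g) (fun x => p x * f x) ξ =
      - partialFourier (fun _ => g) (fun x => prodGrad p f Df x (Fin.last d)) ξ := by
  have h := hf.integral_mul_complex hp hp0 (contDiff_wave_mul hg ξ) (Fin.last d)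
    (fun _ x hx => by simp [hx, hg0])
  rw [partialFourier, partialFourier, ← h]
  refine integral_congr_ae (Filter.Eventually.of_forall fun x => ?_)
  simp only [fderiv_wave_mul hg, tang_single_last]
  simp

lemma contDiff_multExp (ξ : Eucl d) : ContDiff ℝ ∞ (multExp ξ) := by
  unfold multExp; fun_prop

lemma contDiff_multLin (ξ : Eucl d) : ContDiff ℝ ∞ (multLin ξ) := by
  unfold multLin; fun_prop

lemma hasDerivAt_multExp (ξ : Eucl d) (s : ℝ) :
    HasDerivAt (multExp ξ) (-(rho ξ * multExp ξ s)) s := by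
  have h4 : HasDerivAt (fun s => -(rho ξ * s)) (-(rho ξ * 1)) s :=
    ((hasDerivAt_id s).const_mul (rho ξ)).neg
  convert! h4.exp using 1
  simp [multExp]; ring

lemma hasDerivAt_multLin (ξ : Eucl d) (s : ℝ) :
    HasDerivAt (multLin ξ) (rho ξ * (multExp ξ s - multLin ξ s)) s := by
  have h1 := ((hasDerivAt_id s).const_mul (rho ξ)).mul (hasDerivAt_multExp ξ s)
  convert! h1 using 1
  simp [multExp, multLin]; ring

/-- The profile `e^{-ρ s} - 1` vanishes on the flat boundary. The subtracted constant leaves the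
`multOne` term, which carries the trace of `p f`. -/
lemma HasH1Gradient.rho_mul_partialFourier_exp (hf : HasH1Gradient f Df)
    (hp : ContDiff ℝ ∞ p) (hp0 : ∀ x, 1 ≤ ‖x‖ → p x = 0) (ξ : Eucl d) :
    rho ξ * partialFourier multExp (fun x => p x * f x) ξ =
      partialFourier multExp (fun x => prodGrad p f Df x (Fin.last d)) ξ -
        partialFourier multOne (fun x => prodGrad p f Df x (Fin.last d)) ξ := by
  have hD := (hf.memLp_prodGrad hp hp0 (Fin.last d)).integrable (by norm_num)
  have h := hf.integral_wave_normal hp hp0 (g := fun s => multExp ξ s - 1)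
    ((contDiff_multExp ξ).sub contDiff_const) (by simp [multExp]) ξ
  have hd : deriv (fun s => multExp ξ s - 1) = fun s => -(rho ξ * multExp ξ s) :=
    funext fun s => ((hasDerivAt_multExp ξ s).sub_const 1).deriv
  rw [hd] at h
  have e1 : partialFourier (fun _ s => -(rho ξ * multExp ξ s)) (fun x => p x * f x) ξ =
      - (rho ξ * partialFourier multExp (fun x => p x * f x) ξ) := by
    rw [partialFourier, partialFourier, ← integral_const_mul, ← integral_neg]
    refine integral_congr_ae (Filter.Eventually.of_forall fun x => ?_)
    simp; ring
  have e2 : partialFourier (fun _ s => multExp ξ s - 1)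
      (fun x => prodGrad p f Df x (Fin.last d)) ξ =
      partialFourier multExp (fun x => prodGrad p f Df x (Fin.last d)) ξ -
        partialFourier multOne (fun x => prodGrad p f Df x (Fin.last d)) ξ := by
    rw [partialFourier, partialFourier, partialFourier,
      ← integral_sub (integrable_partialFourier isUnitMultiplier_exp hD ξ)
        (integrable_partialFourier isUnitMultiplier_one hD ξ)]
    refine integral_congr_ae (Filter.Eventually.of_forall fun x => ?_)
    simp [multOne]; ring
  rw [e1, e2] at h
  exact neg_injective h

/-- The profile `ρ s e^{-ρ s}` already vanishes at `s = 0`, so no trace term appears. -/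
lemma HasH1Gradient.rho_mul_partialFourier_lin (hf : HasH1Gradient f Df)
    (hp : ContDiff ℝ ∞ p) (hp0 : ∀ x, 1 ≤ ‖x‖ → p x = 0) (ξ : Eucl d) :
    rho ξ * partialFourier multLin (fun x => p x * f x) ξ =
      rho ξ * partialFourier multExp (fun x => p x * f x) ξ +
        partialFourier multLin (fun x => prodGrad p f Df x (Fin.last d)) ξ := by
  have hv := (hf.memLp_mul hp hp0).integrable (by norm_num)
  have h := hf.integral_wave_normal hp hp0 (contDiff_multLin ξ) (by simp [multLin]) ξ
  have hd : deriv (multLin ξ) = fun s => rho ξ * (multExp ξ s - multLin ξ s) :=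
    funext fun s => (hasDerivAt_multLin ξ s).deriv
  rw [hd] at h
  have e1 : partialFourier (fun _ s => rho ξ * (multExp ξ s - multLin ξ s)) (fun x => p x * f x) ξ =
      rho ξ * partialFourier multExp (fun x => p x * f x) ξ -
        rho ξ * partialFourier multLin (fun x => p x * f x) ξ := by
    rw [partialFourier, partialFourier, partialFourier, ← integral_const_mul, ← integral_const_mul,
      ← integral_sub ((integrable_partialFourier isUnitMultiplier_exp hv ξ).const_mul _)
        ((integrable_partialFourier isUnitMultiplier_lin hv ξ).const_mul _)]
    refine integral_congr_ae (Filter.Eventually.of_forall fun x => ?_)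
    simp; ring
  have e2 : partialFourier (fun _ => multLin ξ) (fun x => prodGrad p f Df x (Fin.last d)) ξ =
      partialFourier multLin (fun x => prodGrad p f Df x (Fin.last d)) ξ := rfl
  rw [e1, e2] at h
  linear_combination -h

end Identities

/-! ### Traces on the flat boundary -/

section Traces

open Filter Topology

variable {d : ℕ} {f p : Eucl (d + 1) → ℝ} {Df : Eucl (d + 1) → Fin (d + 1) → ℝ}

/-- Integration in the normal direction maps `L²(B₁⁺)` to `L²(ℝᵈ)`. -/
lemma exists_normal_integral {g : Eucl (d + 1) → ℝ}
    (hg : MemLp g 2 (volume.restrict (halfBall d))) :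
    ∃ b : Eucl d → ℝ, MemLp b 2 ∧ Integrable b ∧ (∀ y, 1 ≤ ‖y‖ → b y = 0) ∧
      ∀ κ : Eucl d → ℂ, Continuous κ → (∃ C, ∀ y, ‖κ y‖ ≤ C) →
        ∫ y, (b y : ℂ) * κ y = ∫ x in halfBall d, (g x : ℂ) * κ (tang x) := by
  set g' := hg.1.mk g with hg'
  have hgg' : g =ᵐ[volume.restrict (halfBall d)] g' := hg.1.ae_eq_mk
  have hg2 : MemLp g' 2 (volume.restrict (halfBall d)) := hg.ae_eq hgg'
  set G : Eucl (d + 1) → ℝ := (halfBall d).indicator g' with hG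
  have hGm : StronglyMeasurable G := hg.1.stronglyMeasurable_mk.indicator measurableSet_halfBall
  have hGi : Integrable G :=
    (integrable_indicator_iff measurableSet_halfBall).2 (hg2.integrable (by norm_num))
  have hG2 : MemLp G 2 := (memLp_indicator_iff_restrict measurableSet_halfBall).2 hg2
  have hG0 : ∀ p : Eucl d × ℝ, ¬ (‖p.1‖ < 1 ∧ 0 < p.2 ∧ p.2 < 1) → G (joinPt p) = 0 := fun p hp =>
    indicator_of_notMem (fun h => hp (join_mem_halfBall h)) _
  have hGj : Integrable (fun q : Eucl d × ℝ => G (joinPt q)) (volume.prod volume) :=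
    (integrable_iff_integrable_join G).1 hGi
  have hGjm : StronglyMeasurable fun q : Eucl d × ℝ => G (joinPt q) :=
    hGm.comp_measurable continuous_join.measurable
  refine ⟨fun y => ∫ s, G (joinPt (y, s)), ?_, hGj.integral_prod_left, fun y hy => ?_,
    fun κ hκ hb => ?_⟩
  · refine ⟨hGjm.integral_prod_right'.aestronglyMeasurable, ?_⟩
    have two : ∀ {α : Type} [MeasurableSpace α] (μ : Measure α) (g : α → ℝ),
        eLpNorm g 2 μ ^ 2 = ∫⁻ x, ‖g x‖ₑ ^ 2 ∂μ := fun μ g => by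
      simpa using eLpNorm_nnreal_pow_eq_lintegral (f := g) (μ := μ) (p := 2) (by norm_num)
    have key : ∫⁻ y, ‖∫ s, G (joinPt (y, s))‖ₑ ^ 2 ≤ ∫⁻ x, ‖G x‖ₑ ^ 2 := by
      rw [lintegral_eq_lintegral_join, Measure.volume_eq_prod, lintegral_prod _
        (hGjm.enorm.pow_const 2).aemeasurable]
      refine lintegral_mono fun y => ?_
      -- The fibre over `y` lies in an interval of length one, so Cauchy–Schwarz gives the bound
      -- with constant one.
      have h1 : ∫ s, G (joinPt (y, s)) = ∫ s in Ioo (0 : ℝ) 1, G (joinPt (y, s)) := by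
        rw [setIntegral_eq_integral_of_forall_compl_eq_zero]
        exact fun s hs => hG0 (y, s) fun h => hs h.2
      have hm : Measurable fun s => ‖G (joinPt (y, s))‖ₑ :=
        (hGjm.comp_measurable (measurable_prodMk_left (x := y))).enorm
      have h2 := lintegral_mul_sq_le (volume.restrict (Ioo (0 : ℝ) 1))
        (a := fun _ => 1) (b := fun s => ‖G (joinPt (y, s))‖ₑ) aemeasurable_const hm.aemeasurable
      simp only [one_mul, one_pow, lintegral_one, Measure.restrict_apply_univ, Real.volume_Ioo,
        sub_zero, ENNReal.ofReal_one] at h2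
      have h3 : ‖∫ s, G (joinPt (y, s))‖ₑ ≤ ∫⁻ s in Ioo (0 : ℝ) 1, ‖G (joinPt (y, s))‖ₑ := by
        rw [h1]
        exact enorm_integral_le_lintegral_enorm _
      exact (pow_le_pow_left' h3 2).trans (h2.trans (setLIntegral_le_lintegral _ _))
    rw [← two, ← two] at key
    refine lt_top_iff_ne_top.2 fun h => ?_
    rw [h] at key
    simp at key
    exact hG2.2.ne key
  · refine integral_eq_zero_of_ae (Eventually.of_forall fun s => ?_)
    exact hG0 (y, s) fun h => absurd h.1 (not_lt.2 hy)
  · obtain ⟨C, hC⟩ := hb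
    have e1 : ∫ x in halfBall d, (g x : ℂ) * κ (tang x) = ∫ x, (G x : ℂ) * κ (tang x) := by
      rw [← integral_indicator measurableSet_halfBall]
      refine integral_congr_ae ?_
      filter_upwards [(ae_restrict_iff' measurableSet_halfBall).1 hgg'] with x hx
      by_cases hx' : x ∈ halfBall d
      · simp [hG, hx', hx hx']
      · simp [hG, hx']
    have hint : Integrable (fun q : Eucl d × ℝ => (G (joinPt q) : ℂ) * κ q.1)
        (volume.prod volume) := by
      refine hGj.ofReal.mul_bdd (c := C) (hκ.comp continuous_fst).aestronglyMeasurable ?_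
      exact Eventually.of_forall fun q => hC q.1
    rw [e1, integral_eq_integral_join]
    simp only [tang_join]
    rw [Measure.volume_eq_prod, integral_prod _ hint]
    refine integral_congr_ae (Eventually.of_forall fun y => ?_)
    beta_reduce
    rw [← integral_complex_ofReal, ← integral_mul_const]

lemma partialDeriv_comp_tang {κ : Eucl d → ℝ} (hκ : ContDiff ℝ ∞ κ) (x : Eucl (d + 1)) :
    partialDeriv (Fin.last d) (fun x => κ (tang x)) x = 0 := by
  have h := (hκ.differentiable (by simp) (tang x)).hasFDerivAt.comp x (tang (d := d)).hasFDerivAt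
  have h' : fderiv ℝ (fun x => κ (tang x)) x = _ := h.fderiv
  rw [partialDeriv, h']
  simp [tang_single_last]

lemma partialDeriv_comp_smul {k : ℕ} {q : Eucl k → ℝ} (hq : ContDiff ℝ ∞ q) (i : Fin k) (c : ℝ)
    (x : Eucl k) : partialDeriv i (fun x => q (c • x)) x = c * partialDeriv i q (c • x) := by
  have h1 : HasFDerivAt (fun x : Eucl k => c • x) (c • ContinuousLinearMap.id ℝ (Eucl k)) x :=
    (hasFDerivAt_id x).const_smul c
  have h2 := ((hq.differentiable (by simp)) (c • x)).hasFDerivAt.comp x h1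
  have h3 : fderiv ℝ (fun x => q (c • x)) x = _ := h2.fderiv
  simp [partialDeriv, h3]

/-- Tested with functions of `x'`, the normal derivative of `p f` gives minus the trace. -/
lemma HasFlatTrace.integral_prodGrad (hf : HasH1Gradient f Df) {t : Eucl d → ℝ}
    (ht : HasFlatTrace f Df t) (hp : ContDiff ℝ ∞ p) (hp0 : ∀ x, 1 ≤ ‖x‖ → p x = 0)
    {κ : Eucl d → ℝ} (hκ : IsTest (flatBall d) κ) :
    ∫ x in halfBall d, prodGrad p f Df x (Fin.last d) * κ (tang x) =
      - ∫ y in flatBall d, t y * p (flat y) * κ y := by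
  have hpc := hasCompactSupport_of_eq_zero hp0
  obtain ⟨hκs, hκc, hκt⟩ := hκ
  have hκT : ContDiff ℝ ∞ fun x : Eucl (d + 1) => κ (tang x) := hκs.comp tang.contDiff
  set c : ℕ → ℝ := fun n => 1 + 1 / ((n : ℝ) + 1) with hc
  have hc1 : ∀ n, 1 < c n := fun n => by
    have : (0 : ℝ) < 1 / ((n : ℝ) + 1) := by positivity
    simp only [hc]; linarith
  have hc2 : ∀ n, c n ≤ 2 := fun n => by
    have : 1 / ((n : ℝ) + 1) ≤ 1 := by
      rw [div_le_one (by positivity)]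
      linarith [n.cast_nonneg (α := ℝ)]
    simp only [hc]; linarith
  have hct : Tendsto c atTop (𝓝 1) := by
    have h1 : Tendsto c atTop (𝓝 (1 + 0)) :=
      tendsto_const_nhds.add tendsto_one_div_add_atTop_nhds_zero_nat
    simpa using h1
  have hcx : ∀ x : Eucl (d + 1), Tendsto (fun n => c n • x) atTop (𝓝 x) := fun x => by
    simpa using hct.smul_const x
  -- Only `p` is dilated: this pulls the support into the open unit ball, while `κ` stays a function
  -- of `x'` and has no normal derivative.
  set q : ℕ → Eucl (d + 1) → ℝ := fun n x => p (c n • x) with hq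
  have hqs : ∀ n, ContDiff ℝ ∞ (q n) := fun n => hp.comp (contDiff_const_smul _)
  set θ : ℕ → Eucl (d + 1) → ℝ := fun n x => q n x * κ (tang x) with hθ
  have htest : ∀ n, IsTest (Metric.ball 0 1) (θ n) := by
    intro n
    have hsub : tsupport (θ n) ⊆ {x | c n * ‖x‖ ≤ 1} := by
      refine closure_minimal (fun x hx => ?_)
        (isClosed_le (continuous_const.mul continuous_norm) continuous_const)
      by_contra h'
      refine hx ?_
      have h1 : 1 ≤ ‖c n • x‖ := by
        rw [norm_smul, Real.norm_eq_abs, abs_of_pos (by linarith [hc1 n])]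
        exact le_of_lt (not_le.1 h')
      simp [hθ, hq, hp0 _ h1]
    have hball : tsupport (θ n) ⊆ Metric.ball 0 1 := by
      intro x hx
      have h1 : c n * ‖x‖ ≤ 1 := hsub hx
      rw [mem_ball_zero_iff]
      by_contra! h2
      nlinarith [hc1 n]
    refine ⟨(hqs n).mul hκT, ?_, hball⟩
    exact (isCompact_closedBall (0 : Eucl (d + 1)) 1).of_isClosed_subset (isClosed_tsupport _)
      (hball.trans Metric.ball_subset_closedBall)
  have hG := fun n => ht.2 (θ n) (htest n)
  obtain ⟨C, hC⟩ := exists_bound_partialDeriv hp hpc (Fin.last d)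
  obtain ⟨C', hC'⟩ := hp.continuous.bounded_above_of_compact_support hpc
  obtain ⟨W, hW⟩ := hκs.continuous.bounded_above_of_compact_support hκc
  have hC0 : 0 ≤ C := (norm_nonneg _).trans (hC 0)
  have hC0' : 0 ≤ C' := (norm_nonneg _).trans (hC' 0)
  have hW0 : 0 ≤ W := (norm_nonneg _).trans (hW 0)
  have hθd : ∀ n x, partialDeriv (Fin.last d) (θ n) x =
      c n * partialDeriv (Fin.last d) p (c n • x) * κ (tang x) := by
    intro n x
    rw [partialDeriv_mul (hqs n) hκT, partialDeriv_comp_tang hκs, partialDeriv_comp_smul hp]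
    ring
  have lim1 : Tendsto (fun n => ∫ x in halfBall d, (f x * partialDeriv (Fin.last d) (θ n) x +
      Df x (Fin.last d) * θ n x)) atTop
      (𝓝 (∫ x in halfBall d, prodGrad p f Df x (Fin.last d) * κ (tang x))) := by
    refine tendsto_integral_of_dominated_convergence
      (fun x => ‖f x‖ * (2 * C * W) + ‖Df x (Fin.last d)‖ * (C' * W)) (fun n => ?_)
      ((hf.integrable.norm.mul_const _).add ((hf.integrable_grad _).norm.mul_const _))
      (fun n => ?_) ?_
    · exact (hf.integrable.aestronglyMeasurable.mul
        (continuous_partialDeriv (htest n).1 _).aestronglyMeasurable).add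
        ((hf.integrable_grad _).aestronglyMeasurable.mul
          (htest n).1.continuous.aestronglyMeasurable)
    · refine Eventually.of_forall fun x => (norm_add_le _ _).trans (add_le_add ?_ ?_)
      · rw [norm_mul, hθd, norm_mul, norm_mul, Real.norm_eq_abs (c n),
          abs_of_pos (by linarith [hc1 n])]
        gcongr
        · exact hc2 n
        · exact hC _
        · exact hW _
      · rw [norm_mul, norm_mul]
        gcongr
        · exact hC' _
        · exact hW _
    · refine Eventually.of_forall fun x => ?_
      simp only [hθd]
      have h1 := ((hct.mul (((continuous_partialDeriv hp (Fin.last d)).tendsto x).comp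
        (hcx x))).mul_const (κ (tang x))).const_mul (f x)
      have h2 := (((hp.continuous.tendsto x).comp (hcx x)).mul_const (κ (tang x))).const_mul
        (Df x (Fin.last d))
      convert! h1.add h2 using 2
      simp only [prodGrad]
      ring
  -- So far `t` is only locally integrable in the open flat ball; the compact support of `κ` there
  -- is what provides a dominating function.
  have hti : IntegrableOn t (tsupport κ) := ht.1.integrableOn_compact_subset hκt hκc
  have hti' : Integrable ((tsupport κ).indicator t) :=
    (integrable_indicator_iff (isClosed_tsupport κ).measurableSet).2 hti
  have hind : ∀ (r : Eucl d → ℝ), (fun y => t y * r y * κ y) =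
      fun y => (tsupport κ).indicator t y * r y * κ y := by
    intro r
    ext y
    by_cases hy : y ∈ tsupport κ
    · simp [hy]
    · simp [image_eq_zero_of_notMem_tsupport hy]
  have lim2 : Tendsto (fun n => - ∫ y in flatBall d, t y * θ n (flat y)) atTop
      (𝓝 (- ∫ y in flatBall d, t y * p (flat y) * κ y)) := by
    have e : ∀ n y, t y * θ n (flat y) = t y * q n (flat y) * κ y := fun n y => by
      simp only [hθ, flat_eq_join, tang_join]; ring
    simp only [e, hind]
    refine (tendsto_integral_of_dominated_convergence
      (fun y => ‖(tsupport κ).indicator t y‖ * C' * W) (fun n => ?_)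
      ((hti'.norm.mul_const _).mul_const _).restrict (fun n => ?_) ?_).neg
    · exact ((hti'.aestronglyMeasurable.mul
        ((hqs n).continuous.comp contDiff_flat.continuous).aestronglyMeasurable).mul
        hκs.continuous.aestronglyMeasurable).restrict
    · refine Eventually.of_forall fun y => ?_
      rw [norm_mul, norm_mul]
      gcongr
      · exact hC' _
      · exact hW _
    · refine Eventually.of_forall fun y => ?_
      exact (((hp.continuous.tendsto (flat y)).comp (hcx (flat y))).const_mul _).mul_const _
  exact tendsto_nhds_unique lim1 (by simpa only [hG] using lim2)

/-- The trace of `p f`, extended by zero, is in `L¹ ∩ L²`, and its Fourier transform is given by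
the normal derivative. -/
lemma HasFlatTrace.trace_mul (hf : HasH1Gradient f Df) {t : Eucl d → ℝ}
    (ht : HasFlatTrace f Df t) (hp : ContDiff ℝ ∞ p) (hp0 : ∀ x, 1 ≤ ‖x‖ → p x = 0) :
    MemLp (fun y => t y * p (flat y)) 2 ∧ Integrable (fun y => t y * p (flat y)) ∧
      ∀ ξ, partialFourier multOne (fun x => prodGrad p f Df x (Fin.last d)) ξ =
        - (𝓕⁻ fun y => ((t y * p (flat y) : ℝ) : ℂ)) ξ := by
  obtain ⟨b, hb2, hb1, hb0, hbκ⟩ := exists_normal_integral (hf.memLp_prodGrad hp hp0 (Fin.last d))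
  have hpf : Continuous fun y : Eucl d => p (flat y) := hp.continuous.comp contDiff_flat.continuous
  -- The fibre integral of the normal derivative of `p f` is minus the trace of `p f`, by testing.
  -- Thus a trace known only to be locally integrable inherits `L¹` and `L²` bounds.
  have hsum : ∀ᵐ y, y ∈ flatBall d → t y * p (flat y) + b y = 0 := by
    refine IsOpen.ae_eq_zero_of_integral_contDiff_smul_eq_zero Metric.isOpen_ball ?_ ?_
    · refine LocallyIntegrableOn.add ?_ (hb1.locallyIntegrable.locallyIntegrableOn _)
      exact ht.1.mul_continuousOn hpf.continuousOn Metric.isOpen_ball.isLocallyClosed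
    · intro κ hκ hκc hκt
      have h1 := ht.integral_prodGrad hf hp hp0 ⟨hκ, hκc, hκt⟩
      have h2 := hbκ (fun y => (κ y : ℂ)) (by fun_prop) (by
        obtain ⟨C, hC⟩ := hκ.continuous.bounded_above_of_compact_support hκc
        exact ⟨C, fun y => by simpa using hC y⟩)
      have h3 : ∫ y, b y * κ y =
          ∫ x in halfBall d, prodGrad p f Df x (Fin.last d) * κ (tang x) := by
        simp only [← Complex.ofReal_mul, integral_complex_ofReal] at h2
        exact_mod_cast h2
      have hti : IntegrableOn t (tsupport κ) := ht.1.integrableOn_compact_subset hκt hκc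
      have hi1 : Integrable fun y => κ y • (t y * p (flat y)) := by
        have hti' : Integrable ((tsupport κ).indicator t) :=
          (integrable_indicator_iff (isClosed_tsupport κ).measurableSet).2 hti
        obtain ⟨C, hC⟩ := (hpf.mul hκ.continuous).bounded_above_of_compact_support
          hκc.mul_left
        refine (hti'.mul_bdd (c := C) (hpf.mul hκ.continuous).aestronglyMeasurable
          (Eventually.of_forall hC)).congr (Eventually.of_forall fun y => ?_)
        by_cases hy : y ∈ tsupport κ
        · simp [hy]; ring
        · simp [image_eq_zero_of_notMem_tsupport hy]
      have hi2 : Integrable fun y => κ y • b y := by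
        obtain ⟨C, hC⟩ := hκ.continuous.bounded_above_of_compact_support hκc
        exact hb1.bdd_mul hκ.continuous.aestronglyMeasurable (Eventually.of_forall hC)
      simp only [smul_add]
      rw [integral_add hi1 hi2]
      have e1 : ∫ y, κ y • (t y * p (flat y)) = ∫ y in flatBall d, t y * p (flat y) * κ y := by
        rw [setIntegral_eq_integral_of_forall_compl_eq_zero]
        · exact integral_congr_ae (Eventually.of_forall fun y => by simp [mul_comm])
        · intro y hy
          simp [image_eq_zero_of_notMem_tsupport fun h => hy (hκt h)]
      have e2 : ∫ y, κ y • b y = ∫ y, b y * κ y :=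
        integral_congr_ae (Eventually.of_forall fun y => by simp [mul_comm])
      rw [e1, e2, h3, h1]
      ring
  have hae : (fun y => t y * p (flat y)) =ᵐ[volume] fun y => - b y := by
    filter_upwards [hsum] with y hy
    by_cases h : y ∈ flatBall d
    · linarith [hy h]
    · have h1 : 1 ≤ ‖y‖ := by simpa [flatBall] using h
      simp [hb0 y h1, hp0 (flat y) (by simpa using h1)]
  refine ⟨hb2.neg.ae_eq hae.symm, hb1.neg.congr hae.symm, fun ξ => ?_⟩
  have h2 := hbκ (fun y => (𝐞 (inner ℝ y ξ) : ℂ)) (by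
    have := Real.continuous_fourierChar
    fun_prop) ⟨1, fun y => (Circle.norm_coe _).le⟩
  have e : partialFourier multOne (fun x => prodGrad p f Df x (Fin.last d)) ξ =
      ∫ x in halfBall d, ((prodGrad p f Df x (Fin.last d) : ℝ) : ℂ) * (𝐞 (inner ℝ (tang x) ξ) : ℂ) := by
    refine integral_congr_ae (Eventually.of_forall fun x => ?_)
    simp [multOne, wave]
  rw [e, ← h2, Real.fourierInv_eq, ← integral_neg]
  refine integral_congr_ae ?_
  filter_upwards [hae] with y hy
  rw [hy, Circle.smul_def]
  simp [mul_comm]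

/-- The constant function one is an `H¹` function on the half ball. -/
lemma hasH1Gradient_one : HasH1Gradient (fun _ : Eucl (d + 1) => (1 : ℝ)) (fun _ _ => 0) := by
  refine ⟨memLp_const _, fun i => memLp_const _, fun θ hθ i => ?_⟩
  obtain ⟨hs, hc, ht⟩ := hθ
  have hi : Integrable (partialDeriv i θ) := (continuous_partialDeriv hs i).integrable_of_hasCompactSupport
    (hasCompactSupport_partialDeriv hc i)
  have hi' : Integrable θ := hs.continuous.integrable_of_hasCompactSupport hc
  have h := integral_mul_fderiv_eq_neg_fderiv_mul_of_integrable (μ := volume)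
    (f := fun _ : Eucl (d + 1) => (1 : ℝ)) (g := θ) (v := EuclideanSpace.single i 1)
    (by simp) (by simp only [one_mul]; exact hi) (by simpa using hi')
    (fun x _ => differentiableAt_const _) (fun x _ => hs.differentiable (by simp) x)
  simp only [fderiv_const_apply, zero_apply, zero_mul, integral_zero, neg_zero, one_mul] at h ⊢
  rw [setIntegral_eq_integral_of_forall_compl_eq_zero]
  · exact h
  · intro x hx
    have : x ∉ tsupport (partialDeriv i θ) := fun h' =>
      hx (ht (closure_minimal (fun y hy => by
        by_contra h2
        exact hy (by
          have : fderiv ℝ θ y = 0 := by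
            by_contra h3
            exact h2 (tsupport_fderiv_subset ℝ (subset_tsupport _ h3))
          simp [partialDeriv, this])) (isClosed_tsupport θ) h'))
    exact image_eq_zero_of_notMem_tsupport this

/-- The trace of the constant function one is one. -/
lemma hasFlatTrace_one :
    HasFlatTrace (fun _ : Eucl (d + 1) => (1 : ℝ)) (fun _ _ => 0) (fun _ : Eucl d => (1 : ℝ)) := by
  refine ⟨(locallyIntegrable_const _).locallyIntegrableOn _, fun θ hθ => ?_⟩
  obtain ⟨hs, hc, ht⟩ := hθ
  have hθ0 : ∀ x, 1 ≤ ‖x‖ → θ x = 0 := fun x hx =>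
    image_eq_zero_of_notMem_tsupport fun h => by
      have := ht h
      rw [mem_ball_zero_iff] at this
      linarith
  have hd0 := partialDeriv_eq_zero hs (Fin.last d) hθ0
  simp only [one_mul, zero_mul, add_zero]
  have hcont := continuous_partialDeriv hs (Fin.last d)
  have hint : Integrable (partialDeriv (Fin.last d) θ) :=
    hcont.integrable_of_hasCompactSupport (hasCompactSupport_partialDeriv hc _)
  set H : Set (Eucl (d + 1)) := {x | 0 < x (Fin.last d)} with hH
  have hHm : MeasurableSet H := (isOpen_lt continuous_const (normalCoord (d := d)).continuous).measurableSet
  have e1 : ∫ x in halfBall d, partialDeriv (Fin.last d) θ x =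
      ∫ x, H.indicator (partialDeriv (Fin.last d) θ) x := by
    rw [← integral_indicator measurableSet_halfBall]
    refine integral_congr_ae (Eventually.of_forall fun x => ?_)
    by_cases h1 : 0 < x (Fin.last d)
    · by_cases h2 : ‖x‖ < 1
      · simp [hH, halfBall, h1, h2]
      · simp [hH, halfBall, h1, h2, hd0 x (not_lt.1 h2)]
    · simp [hH, halfBall, h1]
  have hint2 := (integrable_iff_integrable_join _).1 (hint.indicator hHm)
  rw [e1, integral_eq_integral_join, Measure.volume_eq_prod, integral_prod _ hint2]
  -- The fundamental theorem of calculus along the vertical half line above `y`.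
  have e2 : ∀ y : Eucl d, ∫ s, H.indicator (partialDeriv (Fin.last d) θ) (joinPt (y, s)) =
      - θ (flat y) := by
    intro y
    have hj : Continuous fun s : ℝ => joinPt (y, s) := continuous_join.comp (by fun_prop)
    have hline : ∀ s : ℝ, HasDerivAt (fun s => θ (joinPt (y, s)))
        (partialDeriv (Fin.last d) θ (joinPt (y, s))) s := by
      intro s
      have h1 : HasDerivAt (fun s : ℝ => joinPt (y, s)) (EuclideanSpace.single (Fin.last d) 1) s := by
        have h2 : (fun s : ℝ => joinPt (y, s)) =
            fun s : ℝ => flat y + s • EuclideanSpace.single (Fin.last d) 1 := by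
          ext s i
          refine Fin.lastCases ?_ (fun i => ?_) i
          · simp [flat_eq_join]
          · simp [flat_eq_join, (Fin.castSucc_lt_last i).ne]
        rw [h2]
        simpa using ((hasDerivAt_id s).smul_const
          (EuclideanSpace.single (Fin.last d) (1 : ℝ))).const_add (flat y)
      exact (hs.differentiable (by simp) _).hasFDerivAt.comp_hasDerivAt s h1
    have hjn : ∀ s : ℝ, s ≤ ‖joinPt (y, s)‖ := fun s => by
      simpa using (le_abs_self _).trans (PiLp.norm_apply_le (joinPt (y, s)) (Fin.last d))
    have hz : ∀ s : ℝ, 1 < s → partialDeriv (Fin.last d) θ (joinPt (y, s)) = 0 := fun s hs1 =>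
      hd0 _ (hs1.le.trans (hjn s))
    have e3 : ∫ s, H.indicator (partialDeriv (Fin.last d) θ) (joinPt (y, s)) =
        ∫ s in Ioi (0 : ℝ), partialDeriv (Fin.last d) θ (joinPt (y, s)) := by
      rw [← integral_indicator measurableSet_Ioi]
      refine integral_congr_ae (Eventually.of_forall fun s => ?_)
      by_cases h : 0 < s <;> simp [hH, h]
    have hii : IntegrableOn (fun s => partialDeriv (Fin.last d) θ (joinPt (y, s))) (Ioi 0) := by
      have : IntegrableOn (fun s => partialDeriv (Fin.last d) θ (joinPt (y, s))) (Icc 0 1) :=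
        (hcont.comp hj).integrableOn_Icc
      refine this.of_forall_sdiff_eq_zero measurableSet_Ioi fun s hs' => hz s ?_
      by_contra h1
      exact hs'.2 ⟨(mem_Ioi.1 hs'.1).le, not_lt.1 h1⟩
    rw [e3, integral_Ioi_of_hasDerivAt_of_tendsto (m := 0)
      ((hs.continuous.comp hj).continuousWithinAt) (fun s _ => hline s) hii]
    · simp [flat_eq_join]
    · refine tendsto_const_nhds.congr' ?_
      filter_upwards [eventually_ge_atTop 1] with s hs1
      exact (hθ0 _ (hs1.trans (hjn s))).symm
  simp only [e2]
  rw [integral_neg, setIntegral_eq_integral_of_forall_compl_eq_zero]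
  intro y hy
  exact hθ0 _ (by simpa [flatBall] using hy)

end Traces

/-! ### Representation of Fourier pairings by `L²` functions on the half ball -/

section Pairings

variable {d : ℕ} {m : Eucl d → ℝ → ℝ} {f : Eucl (d + 1) → ℝ}

lemma eLpNorm_two_sq {α E : Type*} [MeasurableSpace α] [NormedAddCommGroup E] (μ : Measure α)
    (g : α → E) : eLpNorm g 2 μ ^ 2 = ∫⁻ x, ‖g x‖ₑ ^ 2 ∂μ := by
  simpa using eLpNorm_nnreal_pow_eq_lintegral (f := g) (μ := μ) (p := 2) (by norm_num)

lemma integrable_of_memLp_halfBall (hf : MemLp f 2 (volume.restrict (halfBall d))) :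
    Integrable f (volume.restrict (halfBall d)) := hf.integrable (by norm_num)

/-- The `L²` norm of `√k · partialFourier m f` is controlled by that of `f`. -/
lemma memLp_sqrt_mul_partialFourier (hm : IsUnitMultiplier m) {k : Eucl d → ℝ}
    (hkc : Continuous k) (hk0 : ∀ ξ, 0 ≤ k ξ)
    (hk : ∀ ξ, ENNReal.ofReal (k ξ) * ∫⁻ s in Ioo (0 : ℝ) 1, ‖m ξ s‖ₑ ^ 2 ≤ 1)
    (hf : MemLp f 2 (volume.restrict (halfBall d))) :
    MemLp (fun ξ => (√(k ξ) : ℂ) * partialFourier m f ξ) 2 ∧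
      eLpNorm (fun ξ => (√(k ξ) : ℂ) * partialFourier m f ξ) 2 volume ≤
        eLpNorm f 2 (volume.restrict (halfBall d)) := by
  have h := lintegral_partialFourier_sq_le hm hf hk
  have e : ∀ ξ, ‖(√(k ξ) : ℂ) * partialFourier m f ξ‖ₑ ^ 2 =
      ENNReal.ofReal (k ξ) * ‖partialFourier m f ξ‖ₑ ^ 2 := fun ξ => by
    rw [enorm_mul, mul_pow]
    congr 1
    rw [← ofReal_norm, Complex.norm_real, Real.norm_eq_abs, abs_of_nonneg (Real.sqrt_nonneg _),
      ← ENNReal.ofReal_pow (Real.sqrt_nonneg _), Real.sq_sqrt (hk0 ξ)]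
  simp only [← e, ← eLpNorm_two_sq] at h
  have h' := (ENNReal.pow_le_pow_left_iff two_ne_zero).1 h
  refine ⟨⟨?_, h'.trans_lt hf.2⟩, h'⟩
  refine (Continuous.mul ?_ (continuous_partialFourier hm
    (integrable_of_memLp_halfBall hf))).aestronglyMeasurable
  exact Complex.continuous_ofReal.comp hkc.sqrt

lemma memLp_partialFourier (hm : IsUnitMultiplier m)
    (hf : MemLp f 2 (volume.restrict (halfBall d))) :
    MemLp (partialFourier m f) 2 ∧
      eLpNorm (partialFourier m f) 2 volume ≤ eLpNorm f 2 (volume.restrict (halfBall d)) := by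
  simpa using memLp_sqrt_mul_partialFourier hm (k := fun _ => 1) continuous_const
    (fun _ => zero_le_one) (fun ξ => by simpa using hm.lintegral_le ξ) hf

/-- `G` pairs continuously with the partial Fourier transforms of `L²` functions. -/
def IsPairable (m : Eucl d → ℝ → ℝ) (G : Eucl d → ℂ) : Prop :=
  ∃ C : ℝ, ∀ f : Eucl (d + 1) → ℝ, MemLp f 2 (volume.restrict (halfBall d)) →
    Integrable (fun ξ => G ξ * partialFourier m f ξ) ∧
      ‖∫ ξ, G ξ * partialFourier m f ξ‖ ≤ C * (eLpNorm f 2 (volume.restrict (halfBall d))).toReal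

lemma norm_integral_mul_le {G T : Eucl d → ℂ} (hG : MemLp G 2) (hT : MemLp T 2) :
    ‖∫ ξ, G ξ * T ξ‖ ≤ (eLpNorm G 2 volume).toReal * (eLpNorm T 2 volume).toReal := by
  have h1 : ‖∫ ξ, G ξ * T ξ‖ₑ ≤ eLpNorm G 2 volume * eLpNorm T 2 volume := by
    refine (enorm_integral_le_lintegral_enorm _).trans ?_
    simp only [enorm_mul]
    have h := lintegral_mul_sq_le volume hG.1.enorm hT.1.enorm
    rw [← eLpNorm_two_sq, ← eLpNorm_two_sq, ← mul_pow] at h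
    exact (ENNReal.pow_le_pow_left_iff two_ne_zero).1 h
  have h2 := ENNReal.toReal_mono (ENNReal.mul_ne_top hG.2.ne hT.2.ne) h1
  rwa [ENNReal.toReal_mul, toReal_enorm] at h2

/-- The factor `√ρ` is absorbed by the gain of half a derivative in the partial transform. Gradient
symbols have the form `ρ g = √ρ (√ρ g)` times a bounded factor, and are covered by `√ρ g ∈ L²`. -/
lemma isPairable_sqrt_rho (hm : IsUnitMultiplier m)
    (hk : ∀ ξ, ENNReal.ofReal (rho ξ) * ∫⁻ s in Ioo (0 : ℝ) 1, ‖m ξ s‖ₑ ^ 2 ≤ 1)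
    {K : Eucl d → ℂ} (hK : MemLp K 2) : IsPairable m (fun ξ => (√(rho ξ) : ℂ) * K ξ) := by
  refine ⟨(eLpNorm K 2 volume).toReal, fun f hf => ?_⟩
  obtain ⟨h1, h2⟩ := memLp_sqrt_mul_partialFourier hm continuous_rho rho_nonneg hk hf
  have e : ∀ ξ, (√(rho ξ) : ℂ) * K ξ * partialFourier m f ξ =
      K ξ * ((√(rho ξ) : ℂ) * partialFourier m f ξ) := fun ξ => by ring
  simp only [e]
  refine ⟨hK.integrable_mul h1, (norm_integral_mul_le hK h1).trans ?_⟩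
  gcongr
  exact hf.2.ne

/-- Functions that are integrable near the origin and square integrable away from it. -/
def IsL1L2 (G : Eucl d → ℂ) : Prop :=
  Integrable ((Metric.ball 0 1).indicator G) ∧ MemLp ((Metric.ball 0 1)ᶜ.indicator G) 2

lemma IsL1L2.bdd_mul {G α : Eucl d → ℂ} (hG : IsL1L2 G) (hα : Measurable α)
    (hb : ∃ C, ∀ ξ, ‖α ξ‖ ≤ C) : IsL1L2 fun ξ => G ξ * α ξ := by
  obtain ⟨C, hC⟩ := hb
  have e : ∀ s : Set (Eucl d), s.indicator (fun ξ => G ξ * α ξ) =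
      fun ξ => s.indicator G ξ * α ξ := fun s => by
    ext ξ
    by_cases h : ξ ∈ s <;> simp [h]
  refine ⟨?_, ?_⟩
  · rw [e]
    exact hG.1.mul_bdd hα.aestronglyMeasurable (Filter.Eventually.of_forall hC)
  · rw [e]
    refine hG.2.of_le_mul (c := C) (hG.2.1.mul hα.aestronglyMeasurable)
      (Filter.Eventually.of_forall fun ξ => ?_)
    rw [norm_mul, mul_comm]
    gcongr
    exact hC ξ

lemma IsL1L2.integrable_mul {G T : Eucl d → ℂ} (hG : IsL1L2 G) (hT : MemLp T 2)
    (hb : ∃ C, ∀ ξ, ‖T ξ‖ ≤ C) : Integrable fun ξ => G ξ * T ξ := by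
  obtain ⟨C, hC⟩ := hb
  have h1 := hG.1.mul_bdd hT.1 (Filter.Eventually.of_forall hC)
  have h2 := hG.2.integrable_mul hT
  refine (h1.add h2).congr (Filter.Eventually.of_forall fun ξ => ?_)
  by_cases h : ξ ∈ Metric.ball (0 : Eucl d) 1 <;> simp [h]

/-- Near the origin `G` is integrable and the partial transform is bounded by the `L¹` norm of `f`.
Away from it both factors are in `L²`. The constant `M` is the Hölder factor between `L²` and `L¹`
on the half ball. -/
lemma isPairable_of_isL1L2 (hm : IsUnitMultiplier m) {G : Eucl d → ℂ} (hG : IsL1L2 G) :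
    IsPairable m G := by
  set M : ENNReal := (volume.restrict (halfBall d)) univ ^ (1 / 1 - 1 / 2 : ℝ) with hM
  have hMt : M ≠ ⊤ := ENNReal.rpow_ne_top_of_nonneg (by norm_num) (measure_ne_top _ _)
  refine ⟨(∫ ξ, ‖(Metric.ball 0 1).indicator G ξ‖) * M.toReal +
    (eLpNorm ((Metric.ball 0 1)ᶜ.indicator G) 2 volume).toReal, fun f hf => ?_⟩
  have hfi := integrable_of_memLp_halfBall hf
  obtain ⟨h1, h2⟩ := memLp_partialFourier hm hf
  have hb := norm_partialFourier_le hm hfi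
  refine ⟨hG.integrable_mul h1 ⟨_, hb⟩, ?_⟩
  have i1 := hG.1.mul_bdd h1.1 (Filter.Eventually.of_forall hb)
  have i2 : Integrable fun ξ => (Metric.ball 0 1)ᶜ.indicator G ξ * partialFourier m f ξ :=
    hG.2.integrable_mul h1
  have e : ∫ ξ, G ξ * partialFourier m f ξ =
      (∫ ξ, (Metric.ball 0 1).indicator G ξ * partialFourier m f ξ) +
        ∫ ξ, (Metric.ball 0 1)ᶜ.indicator G ξ * partialFourier m f ξ := by
    rw [← integral_add i1 i2]
    refine integral_congr_ae (Filter.Eventually.of_forall fun ξ => ?_)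
    by_cases h : ξ ∈ Metric.ball (0 : Eucl d) 1 <;> simp [h]
  have hL1 : ∫ x in halfBall d, ‖f x‖ ≤
      (eLpNorm f 2 (volume.restrict (halfBall d))).toReal * M.toReal := by
    have h3 := eLpNorm_le_eLpNorm_mul_rpow_measure_univ (p := 1) (q := 2) (by norm_num) hf.1
    rw [integral_norm_eq_lintegral_enorm hfi.1, ← eLpNorm_one_eq_lintegral_enorm,
      ← ENNReal.toReal_mul]
    refine ENNReal.toReal_mono (ENNReal.mul_ne_top hf.2.ne hMt) ?_
    simpa [hM] using h3
  rw [e, add_mul]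
  refine (norm_add_le _ _).trans (add_le_add ?_ ?_)
  · refine (norm_integral_le_integral_norm _).trans ?_
    calc ∫ ξ, ‖(Metric.ball 0 1).indicator G ξ * partialFourier m f ξ‖
        ≤ ∫ ξ, ‖(Metric.ball 0 1).indicator G ξ‖ * ∫ x in halfBall d, ‖f x‖ := by
          refine integral_mono i1.norm (hG.1.norm.mul_const _) fun ξ => ?_
          beta_reduce
          rw [norm_mul]
          gcongr
          exact hb ξ
      _ = (∫ ξ, ‖(Metric.ball 0 1).indicator G ξ‖) * ∫ x in halfBall d, ‖f x‖ :=
          integral_mul_const _ _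
      _ ≤ (∫ ξ, ‖(Metric.ball 0 1).indicator G ξ‖) *
          ((eLpNorm f 2 (volume.restrict (halfBall d))).toReal * M.toReal) := by gcongr
      _ = _ := by ring
  · refine (norm_integral_mul_le hG.2 h1).trans ?_
    gcongr
    exact hf.2.ne

/-- Riesz representation of a Fourier pairing. -/
lemma IsPairable.exists_representation (hm : IsUnitMultiplier m) {G : Eucl d → ℂ}
    (hG : IsPairable m G) : ∃ E : Eucl (d + 1) → ℝ, MemLp E 2 (volume.restrict (halfBall d)) ∧
      ∀ f, MemLp f 2 (volume.restrict (halfBall d)) →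
        ∫ x in halfBall d, f x * E x = (∫ ξ, G ξ * partialFourier m f ξ).re := by
  obtain ⟨C, hC⟩ := hG
  set ν := volume.restrict (halfBall d) with hν
  let ℓ : Lp ℝ 2 ν →ₗ[ℝ] ℝ :=
    { toFun := fun f => (∫ ξ, G ξ * partialFourier m f ξ).re
      map_add' := fun f g => by
        have h1 : partialFourier m (f + g : Lp ℝ 2 ν) = fun ξ =>
            partialFourier m f ξ + partialFourier m g ξ := by
          rw [partialFourier_congr (Lp.coeFn_add f g)]
          exact funext fun ξ => partialFourier_add hm
            (integrable_of_memLp_halfBall (Lp.memLp f)) (integrable_of_memLp_halfBall (Lp.memLp g)) ξ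
        simp only [h1, mul_add]
        rw [integral_add (hC f (Lp.memLp f)).1 (hC g (Lp.memLp g)).1, Complex.add_re]
      map_smul' := fun c f => by
        have h1 : partialFourier m (c • f : Lp ℝ 2 ν) = fun ξ => c * partialFourier m f ξ := by
          rw [partialFourier_congr (Lp.coeFn_smul c f)]
          exact funext fun ξ => partialFourier_const_mul c ξ
        simp only [h1, mul_left_comm _ (c : ℂ)]
        rw [integral_const_mul, Complex.re_ofReal_mul]
        rfl }
  let L : Lp ℝ 2 ν →L[ℝ] ℝ := ℓ.mkContinuous C fun f => by
    refine (Complex.abs_re_le_norm _).trans ((hC f (Lp.memLp f)).2.trans_eq ?_)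
    rw [Lp.norm_def]
  set E := (InnerProductSpace.toDual ℝ (Lp ℝ 2 ν)).symm L with hE
  refine ⟨E, Lp.memLp E, fun f hf => ?_⟩
  have h1 : inner ℝ E (hf.toLp f) = L (hf.toLp f) := by
    rw [hE, InnerProductSpace.toDual_symm_apply]
  rw [L2.inner_def] at h1
  have h2 : L (hf.toLp f) = (∫ ξ, G ξ * partialFourier m f ξ).re := by
    change (∫ ξ, G ξ * partialFourier m (hf.toLp f) ξ).re = _
    rw [partialFourier_congr hf.coeFn_toLp]
  rw [← h2, ← h1]
  refine integral_congr_ae ?_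
  filter_upwards [hf.coeFn_toLp] with x hx
  rw [hx]
  simp

end Pairings

/-! ### Extension of boundary data to the half ball -/

section Extension

variable {d : ℕ}

/-- The symbol `i ξⱼ / |ξ|` of the Riesz transform. -/
noncomputable def riesz (j : Fin d) (ξ : Eucl d) : ℂ := symb j ξ / rho ξ

lemma rho_eq_zero_iff {ξ : Eucl d} : rho ξ = 0 ↔ ξ = 0 := by simp [rho, Real.pi_ne_zero]

/-- At `ξ = 0` both sides vanish, so the value given to the quotient there is harmless. -/
lemma symb_eq (j : Fin d) (ξ : Eucl d) : symb j ξ = rho ξ * riesz j ξ := by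
  by_cases h : ξ = 0
  · simp [h, symb, riesz, rho]
  · have : (rho ξ : ℂ) ≠ 0 := by exact_mod_cast fun h' => h (rho_eq_zero_iff.1 h')
    rw [riesz, mul_div_cancel₀ _ this]

lemma continuous_symb (j : Fin d) : Continuous (symb j) := by
  unfold symb
  fun_prop

lemma measurable_riesz (j : Fin d) : Measurable (riesz j) :=
  (continuous_symb j).measurable.div (Complex.continuous_ofReal.comp continuous_rho).measurable

lemma norm_symb_le (j : Fin d) (ξ : Eucl d) : ‖symb j ξ‖ ≤ rho ξ := by
  have h := PiLp.norm_apply_le ξ j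
  simp only [symb, rho, norm_mul, Complex.norm_ofNat, Complex.norm_real, Complex.norm_I, mul_one,
    Real.norm_eq_abs, abs_of_pos Real.pi_pos]
  gcongr
  simpa using h

lemma norm_riesz_le (j : Fin d) (ξ : Eucl d) : ‖riesz j ξ‖ ≤ 1 := by
  rw [riesz, norm_div, Complex.norm_real, Real.norm_eq_abs, abs_of_nonneg (rho_nonneg ξ)]
  exact div_le_one_of_le₀ (norm_symb_le j ξ) (rho_nonneg ξ)

lemma symb_neg (j : Fin d) (ξ : Eucl d) : symb j (-ξ) = starRingEnd ℂ (symb j ξ) := by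
  have h2 : starRingEnd ℂ 2 = 2 := Complex.conj_ofReal 2
  simp [symb, h2]

lemma riesz_neg (j : Fin d) (ξ : Eucl d) : riesz j (-ξ) = starRingEnd ℂ (riesz j ξ) := by
  simp [riesz, symb_neg, rho_neg]

lemma sum_symb_sq (ξ : Eucl d) : ∑ j, symb j ξ * symb j ξ = -(rho ξ : ℂ) ^ 2 := by
  have h : ∀ j, symb j ξ * symb j ξ = -(4 * Real.pi ^ 2) * ((ξ j ^ 2 : ℝ) : ℂ) := fun j => by
    have := Complex.I_sq
    simp only [symb]
    push_cast
    linear_combination (4 * (Real.pi : ℂ) ^ 2 * (ξ j : ℂ) ^ 2) * this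
  simp only [h]
  rw [← Finset.mul_sum, ← Complex.ofReal_sum]
  have h2 : ∑ j, ξ j ^ 2 = ‖ξ‖ ^ 2 := by simp [EuclideanSpace.norm_sq_eq]
  rw [h2, rho]
  push_cast
  ring

/-- The pairing of `f` with the plane wave `e^{2πi x'·ξ} (α + β |2πξ|s) e^{-|2πξ|s}`. -/
noncomputable def pairSym (α β : Eucl d → ℂ) (f : Eucl (d + 1) → ℝ) (ξ : Eucl d) : ℂ :=
  α ξ * partialFourier multExp f ξ + β ξ * partialFourier multLin f ξ

/-- The pairing of `f` with the `j`-th derivative of the plane wave in `pairSym`. -/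
noncomputable def pairSymGrad (α β : Eucl d → ℂ) (j : Fin (d + 1)) (f : Eucl (d + 1) → ℝ)
    (ξ : Eucl d) : ℂ :=
  Fin.lastCases (motive := fun _ => ℂ)
    (rho ξ * ((β ξ - α ξ) * partialFourier multExp f ξ - β ξ * partialFourier multLin f ξ))
    (fun k => symb k ξ * pairSym α β f ξ) j

/-- Bounded measurable Hermitian multipliers. -/
structure IsBddSymbol (α : Eucl d → ℂ) : Prop where
  measurable : Measurable α
  bound : ∃ C, ∀ ξ, ‖α ξ‖ ≤ C
  neg : ∀ ξ, α (-ξ) = starRingEnd ℂ (α ξ)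

lemma isBddSymbol_const (c : ℝ) : IsBddSymbol fun _ : Eucl d => (c : ℂ) :=
  ⟨measurable_const, ⟨‖(c : ℂ)‖, fun _ => le_rfl⟩, fun _ => by simp⟩

lemma isBddSymbol_riesz (j : Fin d) : IsBddSymbol (riesz j) :=
  ⟨measurable_riesz j, ⟨1, norm_riesz_le j⟩, riesz_neg j⟩

lemma IsBddSymbol.mul {α β : Eucl d → ℂ} (hα : IsBddSymbol α) (hβ : IsBddSymbol β) :
    IsBddSymbol fun ξ => α ξ * β ξ := by
  obtain ⟨C, hC⟩ := hα.bound
  obtain ⟨C', hC'⟩ := hβ.bound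
  refine ⟨hα.measurable.mul hβ.measurable, ⟨C * C', fun ξ => ?_⟩, fun ξ => by
    simp [hα.neg, hβ.neg]⟩
  rw [norm_mul]
  exact mul_le_mul (hC ξ) (hC' ξ) (norm_nonneg _) ((norm_nonneg _).trans (hC ξ))

lemma IsBddSymbol.sub {α β : Eucl d → ℂ} (hα : IsBddSymbol α) (hβ : IsBddSymbol β) :
    IsBddSymbol fun ξ => α ξ - β ξ := by
  obtain ⟨C, hC⟩ := hα.bound
  obtain ⟨C', hC'⟩ := hβ.bound
  exact ⟨hα.measurable.sub hβ.measurable, ⟨C + C', fun ξ =>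
    (norm_sub_le _ _).trans (add_le_add (hC ξ) (hC' ξ))⟩, fun ξ => by simp [hα.neg, hβ.neg]⟩

/-! ### Green's formula on the level of symbols -/

section H1

variable {f p : Eucl (d + 1) → ℝ} {Df : Eucl (d + 1) → Fin (d + 1) → ℝ} {α β : Eucl d → ℂ}

lemma HasH1Gradient.pairSymGrad_castSucc (hf : HasH1Gradient f Df) (hp : ContDiff ℝ ∞ p)
    (hp0 : ∀ x, 1 ≤ ‖x‖ → p x = 0) (k : Fin d) (ξ : Eucl d) :
    pairSymGrad α β (Fin.castSucc k) (fun x => p x * f x) ξ =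
      - pairSym α β (fun x => prodGrad p f Df x (Fin.castSucc k)) ξ := by
  simp only [pairSymGrad, Fin.lastCases_castSucc, pairSym,
    hf.partialFourier_tangential hp hp0 contDiff_multExp,
    hf.partialFourier_tangential hp hp0 contDiff_multLin]
  ring

/-- The profile `(α + β ρ s) e^{-ρ s}` has the value `α` at `s = 0`, hence the boundary term. The
`β` part vanishes there and leaves no trace. -/
lemma HasH1Gradient.pairSymGrad_last (hf : HasH1Gradient f Df) (hp : ContDiff ℝ ∞ p)
    (hp0 : ∀ x, 1 ≤ ‖x‖ → p x = 0) (ξ : Eucl d) :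
    pairSymGrad α β (Fin.last d) (fun x => p x * f x) ξ =
      - pairSym α β (fun x => prodGrad p f Df x (Fin.last d)) ξ +
        α ξ * partialFourier multOne (fun x => prodGrad p f Df x (Fin.last d)) ξ := by
  have h1 := hf.rho_mul_partialFourier_exp hp hp0 ξ
  have h2 := hf.rho_mul_partialFourier_lin hp hp0 ξ
  simp only [pairSymGrad, Fin.lastCases_last, pairSym]
  linear_combination (-α ξ) * h1 - β ξ * h2

end H1

lemma exists_representation_comb {G₁ G₂ : Eucl d → ℂ} (h₁ : IsPairable multExp G₁)
    (h₂ : IsPairable multLin G₂) : ∃ E : Eucl (d + 1) → ℝ,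
      MemLp E 2 (volume.restrict (halfBall d)) ∧
      ∀ f, MemLp f 2 (volume.restrict (halfBall d)) →
        Integrable (fun ξ => G₁ ξ * partialFourier multExp f ξ + G₂ ξ * partialFourier multLin f ξ) ∧
        ∫ x in halfBall d, f x * E x =
          (∫ ξ, (G₁ ξ * partialFourier multExp f ξ + G₂ ξ * partialFourier multLin f ξ)).re := by
  obtain ⟨E₁, m₁, r₁⟩ := h₁.exists_representation isUnitMultiplier_exp
  obtain ⟨E₂, m₂, r₂⟩ := h₂.exists_representation isUnitMultiplier_lin
  obtain ⟨C₁, c₁⟩ := h₁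
  obtain ⟨C₂, c₂⟩ := h₂
  refine ⟨fun x => E₁ x + E₂ x, m₁.add m₂, fun f hf => ⟨(c₁ f hf).1.add (c₂ f hf).1, ?_⟩⟩
  rw [integral_add (c₁ f hf).1 (c₂ f hf).1, Complex.add_re, ← r₁ f hf, ← r₂ f hf]
  simp only [mul_add]
  exact integral_add (hf.integrable_mul m₁) (hf.integrable_mul m₂)

/-- A component `E` of the extension with Fourier data `g`, with its gradient. -/
structure IsExtension (α β g : Eucl d → ℂ) (E : Eucl (d + 1) → ℝ)
    (DE : Eucl (d + 1) → Fin (d + 1) → ℝ) : Prop where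
  memLp : MemLp E 2 (volume.restrict (halfBall d))
  memLp_grad : ∀ j, MemLp (fun x => DE x j) 2 (volume.restrict (halfBall d))
  integrable : ∀ f, MemLp f 2 (volume.restrict (halfBall d)) →
    Integrable fun ξ => g ξ * pairSym α β f ξ
  integral_eq : ∀ f, MemLp f 2 (volume.restrict (halfBall d)) →
    ∫ x in halfBall d, f x * E x = (∫ ξ, g ξ * pairSym α β f ξ).re
  integrable_grad : ∀ j f, MemLp f 2 (volume.restrict (halfBall d)) →
    Integrable fun ξ => g ξ * pairSymGrad α β j f ξ
  integral_grad_eq : ∀ j f, MemLp f 2 (volume.restrict (halfBall d)) →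
    ∫ x in halfBall d, f x * DE x j = (∫ ξ, g ξ * pairSymGrad α β j f ξ).re

/-- `E` and the entries of its gradient are defined by duality as elements of `L²`. `E` uses the
splitting of `g` at the origin. Every gradient symbol is `ρ` times bounded factors, so the gradient
uses `√ρ g ∈ L²`. -/
lemma exists_isExtension {α β g : Eucl d → ℂ} (hα : IsBddSymbol α) (hβ : IsBddSymbol β)
    (hg : IsL1L2 g) (hg' : MemLp (fun ξ => (√(rho ξ) : ℂ) * g ξ) 2) :
    ∃ E DE, IsExtension α β g E DE := by
  have hsq : ∀ ξ : Eucl d, (rho ξ : ℂ) = (√(rho ξ) : ℂ) * (√(rho ξ) : ℂ) := fun ξ => by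
    rw [← Complex.ofReal_mul, Real.mul_self_sqrt (rho_nonneg ξ)]
  obtain ⟨E, mE, rE⟩ := exists_representation_comb
    (isPairable_of_isL1L2 isUnitMultiplier_exp (hg.bdd_mul hα.measurable hα.bound))
    (isPairable_of_isL1L2 isUnitMultiplier_lin (hg.bdd_mul hβ.measurable hβ.bound))
  have key : ∀ {γ : Eucl d → ℂ}, IsBddSymbol γ →
      MemLp (fun ξ => (√(rho ξ) : ℂ) * g ξ * γ ξ) 2 := by
    intro γ hγ
    obtain ⟨C, hC⟩ := hγ.bound
    refine hg'.of_le_mul (c := C) (hg'.1.mul hγ.measurable.aestronglyMeasurable)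
      (Filter.Eventually.of_forall fun ξ => ?_)
    rw [norm_mul, mul_comm]
    gcongr
    exact hC ξ
  have grad : ∀ {γ δ : Eucl d → ℂ}, IsBddSymbol γ → IsBddSymbol δ → ∃ D : Eucl (d + 1) → ℝ,
      MemLp D 2 (volume.restrict (halfBall d)) ∧
      ∀ f, MemLp f 2 (volume.restrict (halfBall d)) →
        Integrable (fun ξ => g ξ * (rho ξ * (γ ξ * partialFourier multExp f ξ +
          δ ξ * partialFourier multLin f ξ))) ∧
        ∫ x in halfBall d, f x * D x = (∫ ξ, g ξ * (rho ξ * (γ ξ * partialFourier multExp f ξ +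
          δ ξ * partialFourier multLin f ξ))).re := by
    intro γ δ hγ hδ
    obtain ⟨D, mD, rD⟩ := exists_representation_comb
      (isPairable_sqrt_rho isUnitMultiplier_exp rho_mul_lintegral_multExp_le (key hγ))
      (isPairable_sqrt_rho isUnitMultiplier_lin rho_mul_lintegral_multLin_le (key hδ))
    refine ⟨D, mD, fun f hf => ?_⟩
    have e : (fun ξ => g ξ * (rho ξ * (γ ξ * partialFourier multExp f ξ +
        δ ξ * partialFourier multLin f ξ))) = fun ξ =>
        (√(rho ξ) : ℂ) * ((√(rho ξ) : ℂ) * g ξ * γ ξ) * partialFourier multExp f ξ +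
          (√(rho ξ) : ℂ) * ((√(rho ξ) : ℂ) * g ξ * δ ξ) * partialFourier multLin f ξ := by
      ext ξ
      rw [hsq]
      ring
    rw [e]
    exact rD f hf
  have grad' : ∀ j, ∃ D : Eucl (d + 1) → ℝ, MemLp D 2 (volume.restrict (halfBall d)) ∧
      ∀ f, MemLp f 2 (volume.restrict (halfBall d)) →
        Integrable (fun ξ => g ξ * pairSymGrad α β j f ξ) ∧
        ∫ x in halfBall d, f x * D x = (∫ ξ, g ξ * pairSymGrad α β j f ξ).re := by
    intro j
    refine Fin.lastCases ?_ (fun k => ?_) j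
    -- The coefficients come from `∂ₛ [(α + β ρ s) e^{-ρ s}] = ρ (β - α - β ρ s) e^{-ρ s}`.
    · obtain ⟨D, mD, rD⟩ := grad (hβ.sub hα) ((isBddSymbol_const (-1)).mul hβ)
      refine ⟨D, mD, fun f hf => ?_⟩
      have e : (fun ξ => g ξ * pairSymGrad α β (Fin.last d) f ξ) = fun ξ =>
          g ξ * (rho ξ * ((β ξ - α ξ) * partialFourier multExp f ξ +
            ((-1 : ℝ) : ℂ) * β ξ * partialFourier multLin f ξ)) := by
        ext ξ
        simp only [pairSymGrad, Fin.lastCases_last]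
        push_cast
        ring
      rw [e]
      exact rD f hf
    · obtain ⟨D, mD, rD⟩ := grad ((isBddSymbol_riesz k).mul hα) ((isBddSymbol_riesz k).mul hβ)
      refine ⟨D, mD, fun f hf => ?_⟩
      have e : (fun ξ => g ξ * pairSymGrad α β (Fin.castSucc k) f ξ) = fun ξ =>
          g ξ * (rho ξ * (riesz k ξ * α ξ * partialFourier multExp f ξ +
            riesz k ξ * β ξ * partialFourier multLin f ξ)) := by
        ext ξ
        simp only [pairSymGrad, Fin.lastCases_castSucc, pairSym, symb_eq]
        ring
      rw [e]
      exact rD f hf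
  choose D mD rD using grad'
  have e : ∀ f : Eucl (d + 1) → ℝ, (fun ξ => g ξ * pairSym α β f ξ) = fun ξ =>
      g ξ * α ξ * partialFourier multExp f ξ + g ξ * β ξ * partialFourier multLin f ξ := fun f => by
    ext ξ
    simp only [pairSym]
    ring
  refine ⟨E, fun x j => D j x, mE, mD, fun f hf => ?_, fun f hf => ?_, fun j f hf => (rD j f hf).1,
    fun j f hf => (rD j f hf).2⟩
  · rw [e]
    exact (rE f hf).1
  · rw [e]
    exact (rE f hf).2

/-! ### Weak derivatives and trace of the extension -/

section Green

variable {α β g : Eucl d → ℂ} {E : Eucl (d + 1) → ℝ} {DE : Eucl (d + 1) → Fin (d + 1) → ℝ}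
  {q : Eucl (d + 1) → ℝ}

lemma memLp_of_contDiff (hq : ContDiff ℝ ∞ q) (hq0 : ∀ x, 1 ≤ ‖x‖ → q x = 0) :
    MemLp q 2 (volume.restrict (halfBall d)) :=
  (hq.continuous.memLp_of_hasCompactSupport (hasCompactSupport_of_eq_zero hq0)).restrict _

lemma memLp_partialDeriv (hq : ContDiff ℝ ∞ q) (hq0 : ∀ x, 1 ≤ ‖x‖ → q x = 0) (j : Fin (d + 1)) :
    MemLp (partialDeriv j q) 2 (volume.restrict (halfBall d)) :=
  memLp_of_contDiff (contDiff_partialDeriv hq j) (partialDeriv_eq_zero hq j hq0)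

/-- A smooth cutoff `q` is the product of `q` with the `H¹` function one, so the identities for `H¹`
functions apply to it. -/
lemma pairSymGrad_castSucc_of_contDiff (hq : ContDiff ℝ ∞ q) (hq0 : ∀ x, 1 ≤ ‖x‖ → q x = 0)
    (k : Fin d) (ξ : Eucl d) : pairSymGrad α β (Fin.castSucc k) q ξ =
      - pairSym α β (partialDeriv (Fin.castSucc k) q) ξ := by
  simpa [prodGrad] using (hasH1Gradient_one (d := d)).pairSymGrad_castSucc (α := α) (β := β) hq hq0 k ξ

/-- The trace of the constant function is one, so the boundary term is the transform of `q`
restricted to the flat boundary. -/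
lemma pairSymGrad_last_of_contDiff (hq : ContDiff ℝ ∞ q) (hq0 : ∀ x, 1 ≤ ‖x‖ → q x = 0)
    (ξ : Eucl d) : pairSymGrad α β (Fin.last d) q ξ =
      - pairSym α β (partialDeriv (Fin.last d) q) ξ
        - α ξ * (𝓕⁻ fun y => ((q (flat y) : ℝ) : ℂ)) ξ := by
  have h1 := (hasH1Gradient_one (d := d)).pairSymGrad_last (α := α) (β := β) hq hq0 ξ
  have h2 := (HasFlatTrace.trace_mul hasH1Gradient_one hasFlatTrace_one hq hq0).2.2 ξ
  rw [h2] at h1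
  simp only [prodGrad, mul_one, mul_zero, zero_add, one_mul] at h1
  rw [h1]
  ring

lemma IsExtension.integral_castSucc (h : IsExtension α β g E DE) (hq : ContDiff ℝ ∞ q)
    (hq0 : ∀ x, 1 ≤ ‖x‖ → q x = 0) (k : Fin d) :
    ∫ x in halfBall d, (E x * partialDeriv (Fin.castSucc k) q x + DE x (Fin.castSucc k) * q x) = 0 := by
  have m1 := memLp_of_contDiff hq hq0
  have m2 := memLp_partialDeriv hq hq0 (Fin.castSucc k)
  have i1 : Integrable (fun x => E x * partialDeriv (Fin.castSucc k) q x)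
      (volume.restrict (halfBall d)) := h.memLp.integrable_mul m2
  have i2 : Integrable (fun x => DE x (Fin.castSucc k) * q x)
      (volume.restrict (halfBall d)) := (h.memLp_grad _).integrable_mul m1
  rw [integral_add i1 i2]
  simp only [mul_comm (E _), mul_comm (DE _ _)]
  rw [h.integral_eq _ m2, h.integral_grad_eq _ _ m1]
  simp only [pairSymGrad_castSucc_of_contDiff hq hq0, mul_neg]
  rw [integral_neg, Complex.neg_re]
  ring

/-- The identity for the symbols, integrated against `g`: the interior terms cancel and the boundary
value `α g` of the extension is left, which identifies its trace. -/
lemma IsExtension.integral_last (h : IsExtension α β g E DE) (hq : ContDiff ℝ ∞ q)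
    (hq0 : ∀ x, 1 ≤ ‖x‖ → q x = 0) :
    ∫ x in halfBall d, (E x * partialDeriv (Fin.last d) q x + DE x (Fin.last d) * q x) =
      - (∫ ξ, g ξ * (α ξ * (𝓕⁻ fun y => ((q (flat y) : ℝ) : ℂ)) ξ)).re := by
  have m1 := memLp_of_contDiff hq hq0
  have m2 := memLp_partialDeriv hq hq0 (Fin.last d)
  have i1 : Integrable (fun x => E x * partialDeriv (Fin.last d) q x)
      (volume.restrict (halfBall d)) := h.memLp.integrable_mul m2
  have i2 : Integrable (fun x => DE x (Fin.last d) * q x)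
      (volume.restrict (halfBall d)) := (h.memLp_grad _).integrable_mul m1
  rw [integral_add i1 i2]
  simp only [mul_comm (E _), mul_comm (DE _ _)]
  rw [h.integral_eq _ m2, h.integral_grad_eq _ _ m1, ← Complex.add_re,
    ← integral_add (h.integrable _ m2) (h.integrable_grad _ _ m1), ← Complex.neg_re,
    ← integral_neg]
  congr 2
  ext ξ
  rw [pairSymGrad_last_of_contDiff hq hq0]
  ring

lemma IsExtension.integral_eq_zero (h : IsExtension α β g E DE) (hq : ContDiff ℝ ∞ q)
    (hq0 : ∀ x, 1 ≤ ‖x‖ → q x = 0) (hq1 : ∀ x, x (Fin.last d) = 0 → q x = 0) (j : Fin (d + 1)) :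
    ∫ x in halfBall d, (E x * partialDeriv j q x + DE x j * q x) = 0 := by
  refine Fin.lastCases ?_ (fun k => h.integral_castSucc hq hq0 k) j
  rw [h.integral_last hq hq0]
  have : (fun y : Eucl d => ((q (flat y) : ℝ) : ℂ)) = fun _ => 0 := by
    ext y
    simp [hq1 (flat y) (by simp [flat_eq_join])]
  simp [this, Real.fourierInv_eq]

lemma IsExtension.hasH1Gradient (h : IsExtension α β g E DE) : HasH1Gradient E DE := by
  refine ⟨h.memLp, h.memLp_grad, fun θ hθ i => ?_⟩
  have h0 : ∀ x, x ∉ halfBall d → θ x = 0 := fun x hx =>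
    image_eq_zero_of_notMem_tsupport fun h' => hx (hθ.2.2 h')
  have hq0 : ∀ x, 1 ≤ ‖x‖ → θ x = 0 := fun x hx => h0 x fun h' => absurd h'.1 (not_lt.2 hx)
  have key := h.integral_eq_zero hθ.1 hq0 (fun x hx => h0 x fun h' => absurd h'.2 (by simp [hx])) i
  have i1 : Integrable (fun x => E x * partialDeriv i θ x) (volume.restrict (halfBall d)) :=
    h.memLp.integrable_mul (memLp_partialDeriv hθ.1 hq0 i)
  have i2 : Integrable (fun x => DE x i * θ x) (volume.restrict (halfBall d)) :=
    (h.memLp_grad _).integrable_mul (memLp_of_contDiff hθ.1 hq0)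
  rw [integral_add i1 i2] at key
  linarith

lemma prodGrad_mul_add {p : Eucl (d + 1) → ℝ} (hp : ContDiff ℝ ∞ p) (hq : ContDiff ℝ ∞ q)
    (j : Fin (d + 1)) (x : Eucl (d + 1)) :
    p x * E x * partialDeriv j q x + prodGrad p E DE x j * q x =
      E x * partialDeriv j (fun x => p x * q x) x + DE x j * (p x * q x) := by
  rw [partialDeriv_mul hp hq, prodGrad]
  ring

/-- The product of an `H¹` function and a cutoff function is an `H¹` function. -/
lemma HasH1Gradient.mul {f p : Eucl (d + 1) → ℝ} {Df : Eucl (d + 1) → Fin (d + 1) → ℝ}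
    (hf : HasH1Gradient f Df) (hp : ContDiff ℝ ∞ p)
    (hp0 : ∀ x, 1 ≤ ‖x‖ → p x = 0) : HasH1Gradient (fun x => p x * f x) (prodGrad p f Df) :=
  ⟨hf.memLp_mul hp hp0, hf.memLp_prodGrad hp hp0, fun θ hθ i =>
    hf.integral_mul_real hp hp0 hθ.1 i fun _ x hx =>
      image_eq_zero_of_notMem_tsupport fun h' => absurd (hθ.2.2 h').2 (by simp [hx])⟩

lemma HasH1Gradient.zeroOnSphere_mul {f p : Eucl (d + 1) → ℝ}
    {Df : Eucl (d + 1) → Fin (d + 1) → ℝ} (hf : HasH1Gradient f Df) (hp : ContDiff ℝ ∞ p)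
    (hp0 : ∀ x, 1 ≤ ‖x‖ → p x = 0) : ZeroOnSphere (fun x => p x * f x) (prodGrad p f Df) := by
  intro θ hθ i
  have h := hf.integral_mul_real hp hp0 hθ.1 i fun _ x hx =>
    image_eq_zero_of_notMem_tsupport fun h' => absurd (hθ.2.2 h') (by simp [hx])
  have b1 := hθ.1.continuous.bounded_above_of_compact_support hθ.2.1
  have b2 := exists_bound_partialDeriv hθ.1 hθ.2.1 i
  obtain ⟨C1, hC1⟩ := b1
  obtain ⟨C2, hC2⟩ := b2
  rw [integral_add, h]
  · ring
  · exact (integrable_of_memLp_halfBall (hf.memLp_mul hp hp0)).mul_bdd (c := C2)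
      (continuous_partialDeriv hθ.1 i).aestronglyMeasurable (Filter.Eventually.of_forall hC2)
  · exact (integrable_of_memLp_halfBall (hf.memLp_prodGrad hp hp0 i)).mul_bdd (c := C1)
      hθ.1.continuous.aestronglyMeasurable (Filter.Eventually.of_forall hC1)

/-- A Schwartz bump equal to one near a point turns integrability against Schwartz functions into
integrability near that point. -/
lemma HasFourier.locallyIntegrable {z : Eucl d → ℝ} (hz : HasFourier z g) :
    LocallyIntegrable z := by
  intro x
  let b : ContDiffBump x := ⟨1, 2, one_pos, one_lt_two⟩
  have hc : HasCompactSupport fun y => ((b y : ℝ) : ℂ) :=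
    b.hasCompactSupport.comp_left (g := fun t : ℝ => (t : ℂ)) Complex.ofReal_zero
  have hb : ContDiff ℝ ∞ fun y => ((b y : ℝ) : ℂ) :=
    Complex.ofRealCLM.contDiff.comp b.contDiff
  have hi := (hz.2 (hc.toSchwartzMap hb)).1
  refine ⟨Metric.closedBall x 1, Metric.closedBall_mem_nhds x one_pos, ?_⟩
  have h2 : IntegrableOn (fun y => (z y : ℂ)) (Metric.closedBall x 1) := by
    refine hi.integrableOn.congr_fun (fun y hy => ?_) measurableSet_closedBall
    have : b y = 1 := b.one_of_mem_closedBall hy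
    simp [this]
  exact h2.re

lemma HasFourier.integral_mul_fourierInv {z : Eucl d → ℝ} (hz : HasFourier z g) {θ : Eucl d → ℝ}
    (hθ : ContDiff ℝ ∞ θ) (hc : HasCompactSupport θ) :
    ∫ ξ, g ξ * (𝓕⁻ fun y => ((θ y : ℝ) : ℂ)) ξ = ((∫ y, z y * θ y : ℝ) : ℂ) := by
  have hc' : HasCompactSupport fun y => ((θ y : ℝ) : ℂ) :=
    hc.comp_left (g := fun t : ℝ => (t : ℂ)) Complex.ofReal_zero
  have hθ' : ContDiff ℝ ∞ fun y => ((θ y : ℝ) : ℂ) := Complex.ofRealCLM.contDiff.comp hθ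
  have h := (hz.2 (𝓕⁻ (hc'.toSchwartzMap hθ'))).2.2
  rw [FourierTransform.fourier_fourierInv_eq] at h
  rw [← integral_complex_ofReal]
  simp only [SchwartzMap.fourierInv_coe] at h
  simp only [Complex.ofReal_mul]
  exact h.symm

/-- The trace of the extension (with `α = 1`) of a function `z` with Fourier transform `g`. -/
lemma IsExtension.hasFlatTrace (h : IsExtension (fun _ => 1) β g E DE) {z : Eucl d → ℝ}
    (hz : HasFourier z g) {p : Eucl (d + 1) → ℝ} (hp : ContDiff ℝ ∞ p)
    (hp0 : ∀ x, 1 ≤ ‖x‖ → p x = 0) :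
    HasFlatTrace (fun x => p x * E x) (prodGrad p E DE) (fun y => p (flat y) * z y) := by
  have hpf : Continuous fun y : Eucl d => p (flat y) := hp.continuous.comp contDiff_flat.continuous
  refine ⟨(hz.locallyIntegrable.locallyIntegrableOn _).continuousOn_mul hpf.continuousOn
    Metric.isOpen_ball.isLocallyClosed, fun θ hθ => ?_⟩
  have hq : ContDiff ℝ ∞ fun x => p x * θ x := hp.mul hθ.1
  have hq0 : ∀ x, 1 ≤ ‖x‖ → p x * θ x = 0 := fun x hx => by simp [hp0 x hx]
  simp only [prodGrad_mul_add hp hθ.1]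
  rw [h.integral_last hq hq0]
  simp only [one_mul]
  have hqf : ∀ y : Eucl d, 1 ≤ ‖y‖ → p (flat y) * θ (flat y) = 0 := fun y hy =>
    hq0 _ (by rwa [norm_flat])
  rw [hz.integral_mul_fourierInv (θ := fun y => p (flat y) * θ (flat y))
    (hq.comp contDiff_flat) (hasCompactSupport_of_eq_zero hqf), Complex.ofReal_re,
    setIntegral_eq_integral_of_forall_compl_eq_zero]
  · congr 2
    ext y
    ring
  · intro y hy
    have := hqf y (by simpa [flatBall] using hy)
    linear_combination z y * this

end Green

end Extension

/-! ### The Lamé system for the extension -/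

section Stress

variable {d : ℕ}

/-- The coefficients `α` of the components of the extension of a normal displacement. -/
noncomputable def extExp (b : ℝ) (i : Fin (d + 1)) : Eucl d → ℂ :=
  Fin.lastCases (motive := fun _ => Eucl d → ℂ) (fun _ => 1) (fun k ξ => b * riesz k ξ) i

/-- The coefficients `β` of the components of the extension of a normal displacement. -/
noncomputable def extLin (b : ℝ) (i : Fin (d + 1)) : Eucl d → ℂ :=
  Fin.lastCases (motive := fun _ => Eucl d → ℂ) (fun _ => ((1 - b : ℝ) : ℂ))
    (fun k ξ => ((b - 1 : ℝ) : ℂ) * riesz k ξ) i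

lemma isBddSymbol_extExp (b : ℝ) (i : Fin (d + 1)) : IsBddSymbol (extExp b i) := by
  refine Fin.lastCases ?_ (fun k => ?_) i
  · simpa [extExp] using isBddSymbol_const (d := d) 1
  · simpa [extExp] using (isBddSymbol_const b).mul (isBddSymbol_riesz k)

lemma isBddSymbol_extLin (b : ℝ) (i : Fin (d + 1)) : IsBddSymbol (extLin b i) := by
  refine Fin.lastCases ?_ (fun k => ?_) i
  · simpa [extLin] using isBddSymbol_const (d := d) (1 - b)
  · simpa [extLin] using (isBddSymbol_const (b - 1)).mul (isBddSymbol_riesz k)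

/-- The pairing of `f` with `∂ⱼ` of the `i`-th component of the extension. -/
noncomputable def gradSym (b : ℝ) (i j : Fin (d + 1)) (f : Eucl (d + 1) → ℝ) (ξ : Eucl d) : ℂ :=
  pairSymGrad (extExp b i) (extLin b i) j f ξ

/-- The pairing of `f` with the `(i, j)` entry of the stress tensor of the extension. -/
noncomputable def stressSym (mu lam b : ℝ) (i j : Fin (d + 1)) (f : Eucl (d + 1) → ℝ)
    (ξ : Eucl d) : ℂ :=
  mu * (gradSym b i j f ξ + gradSym b j i f ξ) +
    if i = j then lam * ∑ k, gradSym b k k f ξ else 0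

/-- The squares of the Riesz symbols add up to `-1` away from the origin. The factor `ρ` makes the
relation valid at the origin as well. -/
lemma rho_mul_sum_riesz_sq (ξ : Eucl d) :
    rho ξ * ∑ j, riesz j ξ * riesz j ξ = (-rho ξ : ℂ) := by
  by_cases h : (rho ξ : ℂ) = 0
  · simp [h]
  · have := sum_symb_sq ξ
    simp only [symb_eq] at this
    have e : ∀ j, (rho ξ : ℂ) * riesz j ξ * (rho ξ * riesz j ξ) =
        (rho ξ : ℂ) * (rho ξ * (riesz j ξ * riesz j ξ)) := fun j => by ring
    simp only [e, ← Finset.mul_sum] at this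
    apply mul_left_cancel₀ h
    rw [this]
    ring

variable {b mu lam : ℝ} {f : Eucl (d + 1) → ℝ} {ξ : Eucl d}

lemma gradSym_tangential_tangential (k l : Fin d) :
    gradSym b (Fin.castSucc k) (Fin.castSucc l) f ξ = rho ξ * (riesz l ξ * riesz k ξ) *
      (b * partialFourier multExp f ξ + (b - 1) * partialFourier multLin f ξ) := by
  simp [gradSym, pairSymGrad, pairSym, extExp, extLin, symb_eq]
  ring

lemma gradSym_tangential_normal (k : Fin d) :
    gradSym b (Fin.castSucc k) (Fin.last d) f ξ = rho ξ * riesz k ξ *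
      (- partialFourier multExp f ξ - (b - 1) * partialFourier multLin f ξ) := by
  simp only [gradSym, pairSymGrad, extExp, extLin, Fin.lastCases_last, Fin.lastCases_castSucc]
  push_cast
  ring

lemma gradSym_normal_tangential (k : Fin d) :
    gradSym b (Fin.last d) (Fin.castSucc k) f ξ = rho ξ * riesz k ξ *
      (partialFourier multExp f ξ - (b - 1) * partialFourier multLin f ξ) := by
  simp only [gradSym, pairSymGrad, pairSym, extExp, extLin, symb_eq, Fin.lastCases_last,
    Fin.lastCases_castSucc]
  push_cast
  ring

lemma gradSym_normal_normal :
    gradSym b (Fin.last d) (Fin.last d) f ξ = rho ξ *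
      (-b * partialFourier multExp f ξ + (b - 1) * partialFourier multLin f ξ) := by
  simp only [gradSym, pairSymGrad, extExp, extLin, Fin.lastCases_last]
  push_cast
  ring

/-- The divergence of the extension is a pure exponential: the `ρ s e^{-ρ s}` parts of the
tangential and normal contributions cancel. -/
lemma sum_gradSym : ∑ k, gradSym b k k f ξ = -(2 * b * rho ξ * partialFourier multExp f ξ) := by
  rw [Fin.sum_univ_castSucc]
  simp only [gradSym_tangential_tangential, gradSym_normal_normal]
  rw [← Finset.sum_mul, ← Finset.mul_sum, rho_mul_sum_riesz_sq]
  ring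

/-- The tangential block of the stress pairing with `R = ρ`, `r` the Riesz symbols, and `a`, `c` the
exponential and linear transforms of the tangential components. Only `R ∑ r² = -R` is used. -/
lemma sum_sum_tangential {r a c : Fin d → ℂ} {R : ℂ} (h : R * ∑ j, r j * r j = -R) (A B D : ℂ) :
    ∑ k, ∑ l, (R * (r l * r k) * (A * -(R * r l * a k) + B * -(R * r l * c k)) +
      if k = l then D * (R * r l * a k) else 0) =
      (A * R ^ 2 + D * R) * ∑ k, r k * a k + B * R ^ 2 * ∑ k, r k * c k := by
  rw [Finset.mul_sum, Finset.mul_sum, ← Finset.sum_add_distrib]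
  refine Finset.sum_congr rfl fun k _ => ?_
  rw [Finset.sum_add_distrib, Finset.sum_ite_eq]
  have e : ∀ l, R * (r l * r k) * (A * -(R * r l * a k) + B * -(R * r l * c k)) =
      (R * r k * -(A * a k + B * c k)) * (R * (r l * r l)) := fun l => by ring
  simp only [e, ← Finset.mul_sum, h, Finset.mem_univ, if_true]
  ring

/-- Green's formula for the stress of the extension tested with `p u`. The extension is in
equilibrium, so the interior terms cancel. Its shear stress is a multiple of `ρ s e^{-ρ s}` and
vanishes on the flat boundary, so only the trace of the normal component of `p u` survives,
multiplied by the normal traction `2b(μ + λ) ρ`. -/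
lemma HasH1Gradient.sum_stressSym_prodGrad {u : Fin (d + 1) → Eucl (d + 1) → ℝ}
    {Du : Fin (d + 1) → Eucl (d + 1) → Fin (d + 1) → ℝ} {p : Eucl (d + 1) → ℝ} {t : Eucl d → ℝ}
    (hu : ∀ j, HasH1Gradient (u j) (Du j)) (ht : HasFlatTrace (u (Fin.last d)) (Du (Fin.last d)) t)
    (hp : ContDiff ℝ ∞ p) (hp0 : ∀ x, 1 ≤ ‖x‖ → p x = 0) (hb : (lam + 2 * mu) * b = mu)
    (ξ : Eucl d) :
    ∑ i, ∑ j, stressSym mu lam b i j (fun x => prodGrad p (u i) (Du i) x j) ξ =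
      2 * b * (mu + lam) * (rho ξ * (𝓕⁻ fun y => ((t y * p (flat y) : ℝ) : ℂ)) ξ) := by
  have hb' : ((lam : ℂ) + 2 * mu) * b = mu := by exact_mod_cast hb
  have h0 : ∀ i k, partialFourier multExp (fun x => prodGrad p (u i) (Du i) x (Fin.castSucc k)) ξ =
      -(rho ξ * riesz k ξ * partialFourier multExp (fun x => p x * u i x) ξ) := fun i k => by
    rw [(hu i).partialFourier_tangential hp hp0 contDiff_multExp, symb_eq]
  have h1 : ∀ i k, partialFourier multLin (fun x => prodGrad p (u i) (Du i) x (Fin.castSucc k)) ξ =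
      -(rho ξ * riesz k ξ * partialFourier multLin (fun x => p x * u i x) ξ) := fun i k => by
    rw [(hu i).partialFourier_tangential hp hp0 contDiff_multLin, symb_eq]
  have n0 := fun i => (hu i).rho_mul_partialFourier_exp hp hp0 ξ
  have n1 := fun i => (hu i).rho_mul_partialFourier_lin hp hp0 ξ
  have htr := (HasFlatTrace.trace_mul (hu _) ht hp hp0).2.2 ξ
  set T := (𝓕⁻ fun y => ((t y * p (flat y) : ℝ) : ℂ)) ξ
  set R : ℂ := (rho ξ : ℂ)
  have m1 : ∀ i, partialFourier multLin (fun x => prodGrad p (u i) (Du i) x (Fin.last d)) ξ =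
      R * partialFourier multLin (fun x => p x * u i x) ξ -
        R * partialFourier multExp (fun x => p x * u i x) ξ := fun i => by
    linear_combination -n1 i
  -- The trace enters only here: among the entries tested with a normal derivative, only the
  -- normal-normal stress contains the exponential profile.
  have m0 : partialFourier multExp (fun x => prodGrad p (u (Fin.last d)) (Du (Fin.last d)) x
      (Fin.last d)) ξ = R * partialFourier multExp (fun x => p x * u (Fin.last d) x) ξ - T := by
    linear_combination -n0 (Fin.last d) + htr
  have hR : R * ∑ j, riesz j ξ * riesz j ξ = -R := rho_mul_sum_riesz_sq ξ
  have c1 : ∀ k : Fin d, ∀ f, stressSym mu lam b (Fin.castSucc k) (Fin.last d) f ξ =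
      -(2 * mu * (b - 1) * (R * riesz k ξ)) * partialFourier multLin f ξ := fun k f => by
    rw [stressSym, gradSym_tangential_normal, gradSym_normal_tangential,
      if_neg (Fin.castSucc_lt_last k).ne]
    ring
  have c2 : ∀ k : Fin d, ∀ f, stressSym mu lam b (Fin.last d) (Fin.castSucc k) f ξ =
      -(2 * mu * (b - 1) * (R * riesz k ξ)) * partialFourier multLin f ξ := fun k f => by
    rw [stressSym, gradSym_tangential_normal, gradSym_normal_tangential,
      if_neg (Fin.castSucc_lt_last k).ne']
    ring
  have c3 : ∀ f, stressSym mu lam b (Fin.last d) (Fin.last d) f ξ =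
      -(2 * b * (mu + lam) * R) * partialFourier multExp f ξ +
        2 * mu * (b - 1) * R * partialFourier multLin f ξ := fun f => by
    rw [stressSym, gradSym_normal_normal, sum_gradSym, if_pos rfl]
    ring
  have c4 : ∀ k l : Fin d, ∀ f, stressSym mu lam b (Fin.castSucc k) (Fin.castSucc l) f ξ =
      R * (riesz l ξ * riesz k ξ) * (2 * mu * b * partialFourier multExp f ξ +
        2 * mu * (b - 1) * partialFourier multLin f ξ) +
      if k = l then (2 * lam * b * R) * -partialFourier multExp f ξ else 0 := fun k l f => by
    rw [stressSym, gradSym_tangential_tangential, gradSym_tangential_tangential, sum_gradSym]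
    simp only [Fin.castSucc_inj]
    split_ifs <;> ring
  rw [Fin.sum_univ_castSucc]
  simp only [Fin.sum_univ_castSucc]
  rw [Finset.sum_add_distrib]
  simp only [c1, c2, c3, c4, h0, h1, m1, m0, neg_neg]
  rw [sum_sum_tangential hR]
  have e1 : ∀ k : Fin d, -(2 * mu * (b - 1) * (R * riesz k ξ)) *
      (R * partialFourier multLin (fun x => p x * u (Fin.castSucc k) x) ξ -
        R * partialFourier multExp (fun x => p x * u (Fin.castSucc k) x) ξ) =
      -(2 * mu * (b - 1) * R ^ 2) *
          (riesz k ξ * partialFourier multLin (fun x => p x * u (Fin.castSucc k) x) ξ) +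
        (2 * mu * (b - 1) * R ^ 2) *
          (riesz k ξ * partialFourier multExp (fun x => p x * u (Fin.castSucc k) x) ξ) :=
    fun k => by ring
  have e2 : ∀ k : Fin d, -(2 * mu * (b - 1) * (R * riesz k ξ)) *
      -(R * riesz k ξ * partialFourier multLin (fun x => p x * u (Fin.last d) x) ξ) =
      (2 * mu * (b - 1) * R * partialFourier multLin (fun x => p x * u (Fin.last d) x) ξ) *
        (R * (riesz k ξ * riesz k ξ)) := fun k => by ring
  simp only [e1, e2, Finset.sum_add_distrib, ← Finset.mul_sum, hR]
  -- What remains is a multiple of `(λ + 2μ) b - μ`; the vanishing of this quantity is the condition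
  -- that fixes `b`.
  linear_combination (2 * R ^ 2 * (∑ k, riesz k ξ *
    partialFourier multExp (fun x => p x * u (Fin.castSucc k) x) ξ) -
    2 * R ^ 2 * partialFourier multExp (fun x => p x * u (Fin.last d) x) ξ) * hb'

end Stress

/-! ### Lower-order terms as bounded elements of `L²` -/

section Bounded

variable {d : ℕ}

/-- Bounded Hermitian elements of `L²`. -/
structure IsBddL2 (G : Eucl d → ℂ) : Prop where
  memLp : MemLp G 2
  bound : ∃ C, ∀ ξ, ‖G ξ‖ ≤ C
  neg : ∀ ξ, G (-ξ) = starRingEnd ℂ (G ξ)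

namespace IsBddL2

variable {G K α : Eucl d → ℂ}

lemma zero : IsBddL2 fun _ : Eucl d => 0 := ⟨MemLp.zero', ⟨0, by simp⟩, by simp⟩

lemma add (hG : IsBddL2 G) (hK : IsBddL2 K) : IsBddL2 fun ξ => G ξ + K ξ := by
  obtain ⟨C, hC⟩ := hG.bound
  obtain ⟨C', hC'⟩ := hK.bound
  exact ⟨hG.memLp.add hK.memLp, ⟨C + C', fun ξ => (norm_add_le _ _).trans
    (add_le_add (hC ξ) (hC' ξ))⟩, fun ξ => by simp [hG.neg, hK.neg]⟩

lemma symbol_mul (hα : IsBddSymbol α) (hG : IsBddL2 G) : IsBddL2 fun ξ => α ξ * G ξ := by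
  obtain ⟨C, hC⟩ := hG.bound
  obtain ⟨C', hC'⟩ := hα.bound
  refine ⟨hG.memLp.of_le_mul (c := C') (hα.measurable.aestronglyMeasurable.mul hG.memLp.1)
    (Filter.Eventually.of_forall fun ξ => ?_), ⟨C' * C, fun ξ => ?_⟩, fun ξ => by
      simp [hG.neg, hα.neg]⟩
  · rw [norm_mul]
    gcongr
    exact hC' ξ
  · rw [norm_mul]
    exact mul_le_mul (hC' ξ) (hC ξ) (norm_nonneg _) ((norm_nonneg _).trans (hC' ξ))

lemma const_mul (c : ℝ) (hG : IsBddL2 G) : IsBddL2 fun ξ => (c : ℂ) * G ξ :=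
  symbol_mul (isBddSymbol_const c) hG

lemma sub (hG : IsBddL2 G) (hK : IsBddL2 K) : IsBddL2 fun ξ => G ξ - K ξ := by
  simpa [sub_eq_add_neg] using hG.add (hK.const_mul (-1))

lemma sum {ι : Type*} (s : Finset ι) {G : ι → Eucl d → ℂ} (h : ∀ i ∈ s, IsBddL2 (G i)) :
    IsBddL2 fun ξ => ∑ i ∈ s, G i ξ := by
  classical
  induction s using Finset.induction_on with
  | empty => simpa using zero
  | insert a s ha ih =>
    simp only [Finset.sum_insert ha]
    exact (h a (Finset.mem_insert_self a s)).add
      (ih fun i hi => h i (Finset.mem_insert_of_mem hi))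

end IsBddL2

variable {f p : Eucl (d + 1) → ℝ} {Df : Eucl (d + 1) → Fin (d + 1) → ℝ} {α β : Eucl d → ℂ}

lemma isBddL2_partialFourier {m : Eucl d → ℝ → ℝ} (hm : IsUnitMultiplier m)
    (hf : MemLp f 2 (volume.restrict (halfBall d))) : IsBddL2 (partialFourier m f) :=
  ⟨(memLp_partialFourier hm hf).1,
    ⟨_, norm_partialFourier_le hm (integrable_of_memLp_halfBall hf)⟩, partialFourier_neg_freq hm⟩

lemma isBddL2_pairSym (hα : IsBddSymbol α) (hβ : IsBddSymbol β)
    (hf : MemLp f 2 (volume.restrict (halfBall d))) : IsBddL2 (pairSym α β f) :=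
  (IsBddL2.symbol_mul hα (isBddL2_partialFourier isUnitMultiplier_exp hf)).add
    (IsBddL2.symbol_mul hβ (isBddL2_partialFourier isUnitMultiplier_lin hf))

/-- `ρ` is minus the sum of the Riesz symbols times the symbols of the tangential derivatives, and
these derivatives can be moved onto `p f`. A full power of `ρ` is thus traded for an `L²` gradient.
-/
lemma HasH1Gradient.rho_mul_partialFourier (hf : HasH1Gradient f Df) (hp : ContDiff ℝ ∞ p)
    (hp0 : ∀ x, 1 ≤ ‖x‖ → p x = 0) {m : Eucl d → ℝ → ℝ} (hm : ∀ ξ, ContDiff ℝ ∞ (m ξ))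
    (ξ : Eucl d) : rho ξ * partialFourier m (fun x => p x * f x) ξ =
      ∑ k, riesz k ξ * partialFourier m (fun x => prodGrad p f Df x (Fin.castSucc k)) ξ := by
  simp only [hf.partialFourier_tangential hp hp0 hm, symb_eq]
  have e : ∀ k, riesz k ξ * -(rho ξ * riesz k ξ * partialFourier m (fun x => p x * f x) ξ) =
      -(partialFourier m (fun x => p x * f x) ξ) * (rho ξ * (riesz k ξ * riesz k ξ)) :=
    fun k => by ring
  simp only [e, ← Finset.mul_sum, rho_mul_sum_riesz_sq]
  ring

lemma HasH1Gradient.isBddL2_rho_mul (hf : HasH1Gradient f Df) (hp : ContDiff ℝ ∞ p)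
    (hp0 : ∀ x, 1 ≤ ‖x‖ → p x = 0) {m : Eucl d → ℝ → ℝ} (hm : ∀ ξ, ContDiff ℝ ∞ (m ξ))
    (hm' : IsUnitMultiplier m) :
    IsBddL2 fun ξ => rho ξ * partialFourier m (fun x => p x * f x) ξ := by
  simp only [hf.rho_mul_partialFourier hp hp0 hm]
  exact IsBddL2.sum _ fun k _ => IsBddL2.symbol_mul (isBddSymbol_riesz k)
    (isBddL2_partialFourier hm' (hf.memLp_prodGrad hp hp0 _))

/-- A derivative of the extension, tested with an `H¹` function cut off at the sphere, needs no
regularity of `g`: the factor `ρ` is moved onto the test function through tangential derivatives,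
for the normal derivative too. This is why the source lies in `L²` and not merely in `H^{-1/2}`. -/
lemma HasH1Gradient.isBddL2_pairSymGrad (hf : HasH1Gradient f Df) (hp : ContDiff ℝ ∞ p)
    (hp0 : ∀ x, 1 ≤ ‖x‖ → p x = 0) (hα : IsBddSymbol α) (hβ : IsBddSymbol β) (j : Fin (d + 1)) :
    IsBddL2 (pairSymGrad α β j fun x => p x * f x) := by
  refine Fin.lastCases ?_ (fun k => ?_) j
  · have h := (IsBddL2.symbol_mul (hβ.sub hα)
      (hf.isBddL2_rho_mul hp hp0 contDiff_multExp isUnitMultiplier_exp)).sub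
      (IsBddL2.symbol_mul hβ (hf.isBddL2_rho_mul hp hp0 contDiff_multLin isUnitMultiplier_lin))
    convert h using 2 with ξ
    simp only [pairSymGrad, Fin.lastCases_last]
    ring
  · have h := (isBddL2_pairSym hα hβ (hf.memLp_prodGrad hp hp0 (Fin.castSucc k))).const_mul (-1)
    convert h using 2 with ξ
    rw [hf.pairSymGrad_castSucc hp hp0]
    simp

end Bounded

/-! ### The variational inequality on the boundary -/

section Variational

variable {d : ℕ}

lemma HasH1Gradient.add {f g : Eucl (d + 1) → ℝ} {Df Dg : Eucl (d + 1) → Fin (d + 1) → ℝ}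
    (hf : HasH1Gradient f Df) (hg : HasH1Gradient g Dg) :
    HasH1Gradient (fun x => f x + g x) (fun x i => Df x i + Dg x i) := by
  refine ⟨hf.memLp.add hg.memLp, fun i => (hf.memLp_grad i).add (hg.memLp_grad i),
    fun θ hθ i => ?_⟩
  have mθ : MemLp θ 2 (volume.restrict (halfBall d)) :=
    (hθ.1.continuous.memLp_of_hasCompactSupport hθ.2.1).restrict _
  have mD : MemLp (partialDeriv i θ) 2 (volume.restrict (halfBall d)) :=
    ((continuous_partialDeriv hθ.1 i).memLp_of_hasCompactSupport
      (hasCompactSupport_partialDeriv hθ.2.1 i)).restrict _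
  have i1 : Integrable (fun x => f x * partialDeriv i θ x) (volume.restrict (halfBall d)) :=
    hf.memLp.integrable_mul mD
  have i2 : Integrable (fun x => g x * partialDeriv i θ x) (volume.restrict (halfBall d)) :=
    hg.memLp.integrable_mul mD
  have i3 : Integrable (fun x => Df x i * θ x) (volume.restrict (halfBall d)) :=
    (hf.memLp_grad i).integrable_mul mθ
  have i4 : Integrable (fun x => Dg x i * θ x) (volume.restrict (halfBall d)) :=
    (hg.memLp_grad i).integrable_mul mθ
  simp only [add_mul]
  rw [integral_add i1 i2, integral_add i3 i4, hf.weak_deriv θ hθ i, hg.weak_deriv θ hθ i]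
  ring

lemma LocallyIntegrableOn.integrable_mul_test {t : Eucl d → ℝ}
    (ht : LocallyIntegrableOn t (flatBall d)) {θ : Eucl (d + 1) → ℝ}
    (hθ : IsTest (Metric.ball 0 1) θ) :
    Integrable (fun y => t y * θ (flat y)) (volume.restrict (flatBall d)) := by
  have hc : Continuous fun y : Eucl d => flat y := contDiff_flat.continuous
  set K : Set (Eucl d) := (fun y => flat y) ⁻¹' tsupport θ with hK
  have hKs : K ⊆ flatBall d := fun y hy => by
    have := hθ.2.2 hy
    simpa [flatBall, norm_flat] using this
  have hKc : IsCompact K := (isCompact_closedBall (0 : Eucl d) 1).of_isClosed_subset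
    ((isClosed_tsupport θ).preimage hc) (hKs.trans Metric.ball_subset_closedBall)
  have h0 : ∀ y, y ∉ K → θ (flat y) = 0 := fun y hy => image_eq_zero_of_notMem_tsupport hy
  have h1 := (ht.integrableOn_compact_subset hKs hKc).mul_continuousOn
    (hθ.1.continuous.comp hc).continuousOn hKc
  have h2 : Integrable fun y => t y * θ (flat y) :=
    (integrableOn_iff_integrable_of_support_subset fun y hy => by
      by_contra h
      exact hy (by simp [h0 y h])).1 h1
  exact h2.restrict

lemma HasFlatTrace.add {f g : Eucl (d + 1) → ℝ} {Df Dg : Eucl (d + 1) → Fin (d + 1) → ℝ}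
    {s t : Eucl d → ℝ} (hf' : HasH1Gradient f Df) (hg' : HasH1Gradient g Dg)
    (hf : HasFlatTrace f Df s) (hg : HasFlatTrace g Dg t) :
    HasFlatTrace (fun x => f x + g x) (fun x i => Df x i + Dg x i) (fun y => s y + t y) := by
  refine ⟨hf.1.add hg.1, fun θ hθ => ?_⟩
  have mθ : MemLp θ 2 (volume.restrict (halfBall d)) :=
    (hθ.1.continuous.memLp_of_hasCompactSupport hθ.2.1).restrict _
  have mD : MemLp (partialDeriv (Fin.last d) θ) 2 (volume.restrict (halfBall d)) :=
    ((continuous_partialDeriv hθ.1 _).memLp_of_hasCompactSupport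
      (hasCompactSupport_partialDeriv hθ.2.1 _)).restrict _
  have i1 : Integrable (fun x => f x * partialDeriv (Fin.last d) θ x + Df x (Fin.last d) * θ x)
      (volume.restrict (halfBall d)) :=
    (hf'.memLp.integrable_mul mD).add ((hf'.memLp_grad _).integrable_mul mθ)
  have i2 : Integrable (fun x => g x * partialDeriv (Fin.last d) θ x + Dg x (Fin.last d) * θ x)
      (volume.restrict (halfBall d)) :=
    (hg'.memLp.integrable_mul mD).add ((hg'.memLp_grad _).integrable_mul mθ)
  have e : ∀ x, (f x + g x) * partialDeriv (Fin.last d) θ x +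
      (Df x (Fin.last d) + Dg x (Fin.last d)) * θ x =
      (f x * partialDeriv (Fin.last d) θ x + Df x (Fin.last d) * θ x) +
        (g x * partialDeriv (Fin.last d) θ x + Dg x (Fin.last d) * θ x) := fun x => by ring
  have e' : ∀ y, (s y + t y) * θ (flat y) = s y * θ (flat y) + t y * θ (flat y) := fun y =>
    add_mul _ _ _
  simp only [e, e']
  rw [integral_add i1 i2, hf.2 θ hθ, hg.2 θ hθ,
    integral_add (LocallyIntegrableOn.integrable_mul_test hf.1 hθ)
      (LocallyIntegrableOn.integrable_mul_test hg.1 hθ)]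
  ring

/-- The stress tensor `2μ e + λ (tr e) I` of the gradient `N`. -/
noncomputable def stress (mu lam : ℝ) (N : Fin (d + 1) → Fin (d + 1) → ℝ) (i j : Fin (d + 1)) :
    ℝ :=
  mu * (N i j + N j i) + if i = j then lam * ∑ k, N k k else 0

/-- The stress is symmetric, so only the symmetric part of `M` contributes. -/
lemma sum_mul_stress (mu lam : ℝ) (M N : Fin (d + 1) → Fin (d + 1) → ℝ) :
    ∑ i, ∑ j, M i j * stress mu lam N i j =
      2 * mu * ∑ i, ∑ j, (M j i + M i j) / 2 * ((N j i + N i j) / 2) +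
        lam * ((∑ k, M k k) * ∑ k, N k k) := by
  have h1 : ∑ i, ∑ j, M i j * stress mu lam N i j =
      mu * (∑ i, ∑ j, M i j * (N i j + N j i)) + lam * ((∑ k, M k k) * ∑ k, N k k) := by
    simp only [stress, mul_add, mul_ite, mul_zero, Finset.sum_add_distrib, Finset.sum_ite_eq,
      Finset.mem_univ, if_true, Finset.mul_sum, Finset.sum_mul]
    congr 1
    · congr 1 <;>
      exact Finset.sum_congr rfl fun i _ => Finset.sum_congr rfl fun j _ => by ring
    · rw [Finset.sum_comm]
      exact Finset.sum_congr rfl fun i _ => Finset.sum_congr rfl fun j _ => by ring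
  have h2 : ∑ i, ∑ j, M i j * (N i j + N j i) = ∑ i, ∑ j, M j i * (N i j + N j i) := by
    rw [Finset.sum_comm]
    exact Finset.sum_congr rfl fun i _ => Finset.sum_congr rfl fun j _ => by ring
  have h3 : ∑ i, ∑ j, (M j i + M i j) / 2 * ((N j i + N i j) / 2) =
      (1 / 4) * (∑ i, ∑ j, M i j * (N i j + N j i) + ∑ i, ∑ j, M j i * (N i j + N j i)) := by
    rw [← Finset.sum_add_distrib, Finset.mul_sum]
    refine Finset.sum_congr rfl fun i _ => ?_
    rw [← Finset.sum_add_distrib, Finset.mul_sum]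
    exact Finset.sum_congr rfl fun j _ => by ring
  rw [h1, h3, ← h2]
  ring

lemma sum_mul_stress_comm (mu lam : ℝ) (M N : Fin (d + 1) → Fin (d + 1) → ℝ) :
    ∑ i, ∑ j, M i j * stress mu lam N i j = ∑ i, ∑ j, stress mu lam M i j * N i j := by
  have := sum_mul_stress mu lam N M
  rw [sum_mul_stress]
  simp only [mul_comm (stress _ _ _ _ _)]
  rw [this]
  congr 2
  · exact Finset.sum_congr rfl fun i _ => Finset.sum_congr rfl fun j _ => by ring
  · ring

lemma stress_add (mu lam : ℝ) (M N : Fin (d + 1) → Fin (d + 1) → ℝ) (i j : Fin (d + 1)) :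
    stress mu lam (fun i j => M i j + N i j) i j = stress mu lam M i j + stress mu lam N i j := by
  simp only [stress, Finset.sum_add_distrib]
  split_ifs <;> ring

lemma lameForm_eq (mu lam : ℝ) (Du Dv : Fin (d + 1) → Eucl (d + 1) → Fin (d + 1) → ℝ) :
    lameForm mu lam Du Dv =
      ∫ x in halfBall d, ∑ i, ∑ j, Du i x j * stress mu lam (fun i j => Dv i x j) i j := by
  simp only [lameForm, sum_mul_stress, symGrad, divg]

/-- The gradient of the product of the fields `E` with `p`, tested with the stress of `Du`. -/
lemma lameForm_prodGrad_eq (mu lam : ℝ) (p : Eucl (d + 1) → ℝ)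
    (Du DE : Fin (d + 1) → Eucl (d + 1) → Fin (d + 1) → ℝ) (E : Fin (d + 1) → Eucl (d + 1) → ℝ) :
    lameForm mu lam Du (fun i => prodGrad p (E i) (DE i)) =
      ∫ x in halfBall d, ((∑ i, ∑ j, p x * Du i x j * stress mu lam (fun i j => DE i x j) i j) +
        ∑ i, (∑ j, stress mu lam (fun i j => Du i x j) i j * partialDeriv j p x) * E i x) := by
  rw [lameForm_eq]
  congr 1
  ext x
  have e : (fun i j => prodGrad p (E i) (DE i) x j) =
      fun i j => p x * DE i x j + E i x * partialDeriv j p x := rfl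
  rw [e]
  simp only [stress_add, mul_add, Finset.sum_add_distrib]
  congr 1
  · refine Finset.sum_congr rfl fun i _ => Finset.sum_congr rfl fun j _ => ?_
    simp only [stress, ← Finset.mul_sum]
    split_ifs <;> ring
  · rw [sum_mul_stress_comm]
    refine Finset.sum_congr rfl fun i _ => ?_
    rw [Finset.sum_mul]
    exact Finset.sum_congr rfl fun j _ => by ring

end Variational

/-! ### The source term and the boundary variational inequality -/

section Source

variable {d : ℕ}

/-- The integral of `Ψ` over the half ball is the real part of the pairing of `g` and `T`. -/
structure Represents (g : Eucl d → ℂ) (Ψ : Eucl (d + 1) → ℝ) (T : Eucl d → ℂ) : Prop where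
  integrable_left : Integrable Ψ (volume.restrict (halfBall d))
  integrable_right : Integrable fun ξ => g ξ * T ξ
  eq : ∫ x in halfBall d, Ψ x = (∫ ξ, g ξ * T ξ).re

namespace Represents

variable {g T T' : Eucl d → ℂ} {Ψ Ψ' : Eucl (d + 1) → ℝ}

lemma zero (g : Eucl d → ℂ) : Represents g (fun _ => 0) (fun _ => 0) :=
  ⟨integrable_zero _ _ _, by simp, by simp⟩

lemma add (h : Represents g Ψ T) (h' : Represents g Ψ' T') :
    Represents g (fun x => Ψ x + Ψ' x) (fun ξ => T ξ + T' ξ) := by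
  refine ⟨h.integrable_left.add h'.integrable_left, ?_, ?_⟩
  · simp only [mul_add]
    exact h.integrable_right.add h'.integrable_right
  · simp only [mul_add]
    rw [integral_add h.integrable_left h'.integrable_left,
      integral_add h.integrable_right h'.integrable_right, Complex.add_re, h.eq, h'.eq]

lemma const_mul (c : ℝ) (h : Represents g Ψ T) :
    Represents g (fun x => c * Ψ x) (fun ξ => (c : ℂ) * T ξ) := by
  have e : ∀ ξ, g ξ * ((c : ℂ) * T ξ) = c * (g ξ * T ξ) := fun ξ => mul_left_comm _ _ _
  refine ⟨h.integrable_left.const_mul c, ?_, ?_⟩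
  · simp only [e]
    exact h.integrable_right.const_mul _
  · simp only [e]
    rw [integral_const_mul, integral_const_mul, Complex.re_ofReal_mul, h.eq]

lemma sum {ι : Type*} (s : Finset ι) {T : ι → Eucl d → ℂ} {Ψ : ι → Eucl (d + 1) → ℝ}
    (h : ∀ i ∈ s, Represents g (Ψ i) (T i)) :
    Represents g (fun x => ∑ i ∈ s, Ψ i x) (fun ξ => ∑ i ∈ s, T i ξ) := by
  classical
  induction s using Finset.induction_on with
  | empty => simpa using zero g
  | insert a s ha ih =>
    simp only [Finset.sum_insert ha]
    exact (h a (Finset.mem_insert_self a s)).add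
      (ih fun i hi => h i (Finset.mem_insert_of_mem hi))

end Represents

variable {b mu lam : ℝ} {g : Eucl d → ℂ} {E : Fin (d + 1) → Eucl (d + 1) → ℝ}
  {DE : Fin (d + 1) → Eucl (d + 1) → Fin (d + 1) → ℝ} {f : Eucl (d + 1) → ℝ}

lemma IsExtension.represents {α β : Eucl d → ℂ} {E : Eucl (d + 1) → ℝ}
    {DE : Eucl (d + 1) → Fin (d + 1) → ℝ} (h : IsExtension α β g E DE)
    (hf : MemLp f 2 (volume.restrict (halfBall d))) :
    Represents g (fun x => f x * E x) (pairSym α β f) :=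
  ⟨hf.integrable_mul h.memLp, h.integrable f hf, h.integral_eq f hf⟩

lemma IsExtension.represents_grad {α β : Eucl d → ℂ} {E : Eucl (d + 1) → ℝ}
    {DE : Eucl (d + 1) → Fin (d + 1) → ℝ} (h : IsExtension α β g E DE)
    (hf : MemLp f 2 (volume.restrict (halfBall d))) (j : Fin (d + 1)) :
    Represents g (fun x => f x * DE x j) (pairSymGrad α β j f) :=
  ⟨hf.integrable_mul (h.memLp_grad j), h.integrable_grad j f hf, h.integral_grad_eq j f hf⟩

lemma represents_stress (mu lam : ℝ)
    (hE : ∀ i, IsExtension (extExp b i) (extLin b i) g (E i) (DE i))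
    (hf : MemLp f 2 (volume.restrict (halfBall d))) (i j : Fin (d + 1)) :
    Represents g (fun x => f x * stress mu lam (fun i j => DE i x j) i j)
      (stressSym mu lam b i j f) := by
  have h0 := (((hE i).represents_grad hf j).add ((hE j).represents_grad hf i)).const_mul mu
  have h1 : Represents g (fun x => if i = j then lam * ∑ k, f x * DE k x k else 0)
      (fun ξ => if i = j then lam * ∑ k, gradSym b k k f ξ else 0) := by
    by_cases hij : i = j
    · simp only [hij, if_true]
      exact (Represents.sum _ fun k _ => (hE k).represents_grad hf k).const_mul lam
    · simpa only [hij, if_false] using Represents.zero g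
  convert h0.add h1 using 2 with x
  · simp only [stress, ← Finset.mul_sum]
    split_ifs <;> ring
  · rfl

lemma pairSym_add {α β : Eucl d → ℂ} {f f' : Eucl (d + 1) → ℝ}
    (hf : Integrable f (volume.restrict (halfBall d)))
    (hf' : Integrable f' (volume.restrict (halfBall d))) (ξ : Eucl d) :
    pairSym α β (fun x => f x + f' x) ξ = pairSym α β f ξ + pairSym α β f' ξ := by
  simp only [pairSym, partialFourier_add isUnitMultiplier_exp hf hf',
    partialFourier_add isUnitMultiplier_lin hf hf']
  ring

lemma pairSymGrad_add {α β : Eucl d → ℂ} {f f' : Eucl (d + 1) → ℝ}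
    (hf : Integrable f (volume.restrict (halfBall d)))
    (hf' : Integrable f' (volume.restrict (halfBall d))) (j : Fin (d + 1)) (ξ : Eucl d) :
    pairSymGrad α β j (fun x => f x + f' x) ξ =
      pairSymGrad α β j f ξ + pairSymGrad α β j f' ξ := by
  refine Fin.lastCases ?_ (fun k => ?_) j
  · simp only [pairSymGrad, Fin.lastCases_last, partialFourier_add isUnitMultiplier_exp hf hf',
      partialFourier_add isUnitMultiplier_lin hf hf']
    ring
  · simp only [pairSymGrad, Fin.lastCases_castSucc, pairSym_add hf hf']
    ring

lemma stressSym_add {f f' : Eucl (d + 1) → ℝ}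
    (hf : Integrable f (volume.restrict (halfBall d)))
    (hf' : Integrable f' (volume.restrict (halfBall d))) (i j : Fin (d + 1)) (ξ : Eucl d) :
    stressSym mu lam b i j (fun x => f x + f' x) ξ =
      stressSym mu lam b i j f ξ + stressSym mu lam b i j f' ξ := by
  simp only [stressSym, gradSym, pairSymGrad_add hf hf', Finset.sum_add_distrib]
  split_ifs <;> ring

lemma HasH1Gradient.isBddL2_stressSym {p : Eucl (d + 1) → ℝ}
    {Df : Eucl (d + 1) → Fin (d + 1) → ℝ} (hf : HasH1Gradient f Df) (hp : ContDiff ℝ ∞ p)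
    (hp0 : ∀ x, 1 ≤ ‖x‖ → p x = 0) (i j : Fin (d + 1)) :
    IsBddL2 (stressSym mu lam b i j fun x => p x * f x) := by
  have h : ∀ i j, IsBddL2 (gradSym b i j fun x => p x * f x) := fun i j =>
    hf.isBddL2_pairSymGrad hp hp0 (isBddSymbol_extExp b i) (isBddSymbol_extLin b i) j
  refine (((h i j).add (h j i)).const_mul mu).add ?_
  by_cases hij : i = j
  · simp only [hij, if_true]
    exact (IsBddL2.sum _ fun k _ => h k k).const_mul lam
  · simpa only [hij, if_false] using IsBddL2.zero

/-- The load `∑ⱼ σᵢⱼ ∂ⱼη + Fⁱ η` produced by cutting off a displacement field. -/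
noncomputable def cutoffLoad (mu lam : ℝ) (η : Eucl (d + 1) → ℝ)
    (F : Fin (d + 1) → Eucl (d + 1) → ℝ)
    (Du : Fin (d + 1) → Eucl (d + 1) → Fin (d + 1) → ℝ) (i : Fin (d + 1)) (x : Eucl (d + 1)) : ℝ :=
  (∑ j, stress mu lam (fun i j => Du i x j) i j * partialDeriv j η x) + η x * F i x

/-- The source term of the boundary problem, up to a constant. -/
noncomputable def boundarySource (mu lam b : ℝ) (η : Eucl (d + 1) → ℝ)
    (F u : Fin (d + 1) → Eucl (d + 1) → ℝ)
    (Du : Fin (d + 1) → Eucl (d + 1) → Fin (d + 1) → ℝ) (ξ : Eucl d) : ℂ :=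
  (∑ i, ∑ j, stressSym mu lam b i j (fun x => partialDeriv j η x * u i x) ξ) -
    ∑ i, pairSym (extExp b i) (extLin b i) (cutoffLoad mu lam η F Du i) ξ

variable {F u : Fin (d + 1) → Eucl (d + 1) → ℝ}
  {Du : Fin (d + 1) → Eucl (d + 1) → Fin (d + 1) → ℝ} {η : Eucl (d + 1) → ℝ} {φ t : Eucl d → ℝ}

lemma memLp_cutoffLoad (hu : ∀ j, HasH1Gradient (u j) (Du j))
    (hF : ∀ j, MemLp (F j) 2 (volume.restrict (halfBall d)))
    (hη : ContDiff ℝ ∞ η) (hη0 : ∀ x, 1 ≤ ‖x‖ → η x = 0) (i : Fin (d + 1)) :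
    MemLp (cutoffLoad mu lam η F Du i) 2 (volume.restrict (halfBall d)) := by
  have hc := hasCompactSupport_of_eq_zero hη0
  refine MemLp.add (memLp_finsetSum _ fun j _ => ?_) ((hF i).mul_contDiff hη hc)
  have h1 : MemLp (fun x => stress mu lam (fun i j => Du i x j) i j) 2
      (volume.restrict (halfBall d)) := by
    refine ((((hu i).memLp_grad j).add ((hu j).memLp_grad i)).const_mul mu).add ?_
    by_cases hij : i = j
    · simp only [hij, if_true]
      exact (memLp_finsetSum _ fun k _ => (hu k).memLp_grad k).const_mul lam
    · simpa only [hij, if_false] using MemLp.zero'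
  simpa only [mul_comm] using
    h1.mul_contDiff (contDiff_partialDeriv hη j) (hasCompactSupport_partialDeriv hc j)

/-- The gradient of the extension is paired only with the `H¹` functions `uⁱ ∂ⱼη`, and the extension
itself with the `L²` load. Both kinds of term are bounded and square integrable in frequency. -/
lemma isBddL2_boundarySource (hu : ∀ j, HasH1Gradient (u j) (Du j))
    (hF : ∀ j, MemLp (F j) 2 (volume.restrict (halfBall d)))
    (hη : ContDiff ℝ ∞ η) (hη0 : ∀ x, 1 ≤ ‖x‖ → η x = 0) :
    IsBddL2 (boundarySource mu lam b η F u Du) :=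
  (IsBddL2.sum _ fun i _ => IsBddL2.sum _ fun j _ => (hu i).isBddL2_stressSym
    (contDiff_partialDeriv hη j) (partialDeriv_eq_zero hη j hη0) i j).sub
    (IsBddL2.sum _ fun i _ => isBddL2_pairSym (isBddSymbol_extExp b i) (isBddSymbol_extLin b i)
      (memLp_cutoffLoad hu hF hη hη0 i))

/-- Write `η ∂ⱼuⁱ = ∂ⱼ(η uⁱ) - uⁱ ∂ⱼη`. Green's formula evaluates the first part exactly, and the
commutator joins the source. -/
lemma cutoff_symbol_eq (hu : ∀ j, HasH1Gradient (u j) (Du j))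
    (ht : HasFlatTrace (u (Fin.last d)) (Du (Fin.last d)) t)
    (hη : ContDiff ℝ ∞ η) (hη0 : ∀ x, 1 ≤ ‖x‖ → η x = 0) (hb : (lam + 2 * mu) * b = mu)
    (ξ : Eucl d) :
    (∑ i, ∑ j, stressSym mu lam b i j (fun x => η x * Du i x j) ξ) +
      ∑ i, pairSym (extExp b i) (extLin b i) (cutoffLoad mu lam η F Du i) ξ =
      2 * b * (mu + lam) * (rho ξ * (𝓕⁻ fun y => ((t y * η (flat y) : ℝ) : ℂ)) ξ) -
        boundarySource mu lam b η F u Du ξ := by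
  have hc := hasCompactSupport_of_eq_zero hη0
  rw [← HasH1Gradient.sum_stressSym_prodGrad hu ht hη hη0 hb, boundarySource]
  have e : ∀ i j, stressSym mu lam b i j (fun x => prodGrad η (u i) (Du i) x j) ξ =
      stressSym mu lam b i j (fun x => η x * Du i x j) ξ +
        stressSym mu lam b i j (fun x => partialDeriv j η x * u i x) ξ := fun i j => by
    rw [← stressSym_add
      (integrable_of_memLp_halfBall (((hu i).memLp_grad j).mul_contDiff hη hc))
      (integrable_of_memLp_halfBall ((hu i).memLp.mul_contDiff (contDiff_partialDeriv hη j)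
        (hasCompactSupport_partialDeriv hc j)))]
    simp only [prodGrad, mul_comm (u i _)]
  simp only [e, Finset.sum_add_distrib]
  ring

/-- The boundary variational inequality for competitors lying above the obstacle. -/
lemma boundarySource_le (hu : ∀ j, HasH1Gradient (u j) (Du j))
    (ht : HasFlatTrace (u (Fin.last d)) (Du (Fin.last d)) t)
    (hF : ∀ j, MemLp (F j) 2 (volume.restrict (halfBall d)))
    (hvi : ∀ (ζ : Fin (d + 1) → Eucl (d + 1) → ℝ)
      (Dζ : Fin (d + 1) → Eucl (d + 1) → Fin (d + 1) → ℝ) (τ : Eucl d → ℝ),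
      (∀ j, HasH1Gradient (ζ j) (Dζ j)) →
      HasFlatTrace (ζ (Fin.last d)) (Dζ (Fin.last d)) τ →
      (∀ᵐ y ∂(volume.restrict (flatBall d)), φ y ≤ τ y) →
      (∀ j, ZeroOnSphere (ζ j - u j) (Dζ j - Du j)) →
      - ∑ j, ∫ x in halfBall d, F j x * (ζ j x - u j x) ≤ lameForm mu lam Du (Dζ - Du))
    (hη : ContDiff ℝ ∞ η) (hη0 : ∀ x, 1 ≤ ‖x‖ → η x = 0) (hb : (lam + 2 * mu) * b = mu)
    {z : Eucl d → ℝ} (hz : HasFourier z g) (hg : IsL1L2 g)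
    (hg' : MemLp (fun ξ => (√(rho ξ) : ℂ) * g ξ) 2)
    (hle : ∀ᵐ y ∂(volume.restrict (flatBall d)), φ y ≤ t y + η (flat y) * z y) :
    0 ≤ (∫ ξ, g ξ * (2 * b * (mu + lam) *
        (rho ξ * (𝓕⁻ fun y => ((t y * η (flat y) : ℝ) : ℂ)) ξ) -
        boundarySource mu lam b η F u Du ξ)).re := by
  have hc := hasCompactSupport_of_eq_zero hη0
  have hex := fun i => exists_isExtension (isBddSymbol_extExp b i) (isBddSymbol_extLin b i) hg hg'
  choose E DE hE using hex
  have hEn : IsExtension (fun _ => 1) (extLin b (Fin.last d)) g (E (Fin.last d))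
      (DE (Fin.last d)) := by
    simpa [extExp] using hE (Fin.last d)
  have hEh := fun i => (hE i).hasH1Gradient
  -- The competitor is `u + η E`. Multiplication by `η` leaves `u` unchanged on the sphere, and the
  -- normal trace becomes `t + η z`, which lies above `φ` by `hle`.
  have key := hvi (fun i x => u i x + η x * E i x)
    (fun i x j => Du i x j + prodGrad η (E i) (DE i) x j) (fun y => t y + η (flat y) * z y)
    (fun j => (hu j).add ((hEh j).mul hη hη0))
    (HasFlatTrace.add (hu _) ((hEh _).mul hη hη0) ht (hEn.hasFlatTrace hz hη hη0)) hle
    (fun j => by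
      have e1 : (fun x => u j x + η x * E j x) - u j = fun x => η x * E j x := by
        ext x
        simp
      have e2 : (fun x i => Du j x i + prodGrad η (E j) (DE j) x i) - Du j =
          prodGrad η (E j) (DE j) := by
        ext x i
        simp
      rw [e1, e2]
      exact (hEh j).zeroOnSphere_mul hη hη0)
  have e3 : (fun i x j => Du i x j + prodGrad η (E i) (DE i) x j) - Du =
      fun i => prodGrad η (E i) (DE i) := by
    ext i x j
    simp
  rw [e3, lameForm_prodGrad_eq] at key
  simp only [add_sub_cancel_left] at key
  have hst : ∀ i, MemLp (fun x => ∑ j, stress mu lam (fun i j => Du i x j) i j *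
      partialDeriv j η x) 2 (volume.restrict (halfBall d)) := fun i => by
    have h := memLp_cutoffLoad (mu := mu) (lam := lam) (F := fun _ _ => 0) hu
      (fun _ => MemLp.zero') hη hη0 i
    unfold cutoffLoad at h
    simpa only [mul_zero, add_zero] using h
  -- `r1` is the principal term `∫ η ∇u : σ(E)`, `r2` the term in which `∇η` falls on `σ(u)`, and
  -- `r3` the force. Their sum is nonnegative by `key`.
  have r1 : Represents g _ _ := Represents.sum Finset.univ fun i _ =>
    Represents.sum Finset.univ fun j _ =>
      represents_stress mu lam hE (((hu i).memLp_grad j).mul_contDiff hη hc) i j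
  have r2 : Represents g _ _ := Represents.sum Finset.univ fun i _ => (hE i).represents (hst i)
  have r3 : Represents g _ _ := Represents.sum Finset.univ fun i _ =>
    (hE i).represents ((hF i).mul_contDiff hη hc)
  have hsum : ∑ j, ∫ x in halfBall d, F j x * (η x * E j x) =
      ∫ x in halfBall d, ∑ i, η x * F i x * E i x := by
    rw [integral_finsetSum _ fun i _ =>
      ((hE i).represents ((hF i).mul_contDiff hη hc)).integrable_left]
    refine Finset.sum_congr rfl fun i _ => ?_
    congr 1
    ext x
    ring
  have hW := (r1.add r2).add r3
  have hW2 := hW.eq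
  rw [integral_add (r1.add r2).integrable_left r3.integrable_left] at hW2
  rw [hsum] at key
  simp only [← cutoff_symbol_eq (F := F) hu ht hη hη0 hb]
  have e4 : ∀ i ξ, pairSym (extExp b i) (extLin b i) (cutoffLoad mu lam η F Du i) ξ =
      pairSym (extExp b i) (extLin b i) (fun x => ∑ j, stress mu lam (fun i j => Du i x j) i j *
        partialDeriv j η x) ξ +
      pairSym (extExp b i) (extLin b i) (fun x => η x * F i x) ξ := fun i ξ =>
    pairSym_add (integrable_of_memLp_halfBall (hst i))
      (integrable_of_memLp_halfBall ((hF i).mul_contDiff hη hc)) ξ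
  simp only [e4, Finset.sum_add_distrib, ← add_assoc]
  rw [← hW2]
  linarith

/-- The inequality for the elastic problem read on the boundary, after division by the positive
constant `c` of the Dirichlet-to-Neumann operator. The direction `z` is the difference of a
competitor for the obstacle `φ η` and `t η`. -/
theorem IsLameThinObstacleSolution.exists_source (hmu : 0 < mu) (hlam : 0 < lam)
    (hu : IsLameThinObstacleSolution mu lam φ F u t)
    (hF : ∀ j, MemLp (F j) 2 (volume.restrict (halfBall d)))
    (hη : ContDiff ℝ ∞ η) (hη_nonneg : ∀ x, 0 ≤ η x) (hη0 : ∀ x, 1 ≤ ‖x‖ → η x = 0) :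
    ∃ H : Eucl d → ℂ, IsBddL2 H ∧ ∀ z g, HasFourier z g → IsL1L2 g →
      MemLp (fun ξ => (√(rho ξ) : ℂ) * g ξ) 2 →
      (∀ᵐ y, φ y * η (flat y) ≤ z y + t y * η (flat y)) →
      Integrable (fun ξ => g ξ * (rho ξ * (𝓕⁻ fun y => ((t y * η (flat y) : ℝ) : ℂ)) ξ)) →
      (∫ ξ, g ξ * H ξ).re ≤
        (∫ ξ, g ξ * (rho ξ * (𝓕⁻ fun y => ((t y * η (flat y) : ℝ) : ℂ)) ξ)).re := by
  obtain ⟨Du, hu, ht, hφt, hvi⟩ := hu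
  set b := mu / (lam + 2 * mu) with hbdef
  have hb : (lam + 2 * mu) * b = mu := by rw [hbdef]; field_simp
  have hb0 : 0 < b := by positivity
  set c := 2 * b * (mu + lam) with hcdef
  have hc0 : 0 < c := by positivity
  have hB := isBddL2_boundarySource (mu := mu) (lam := lam) (b := b) hu hF hη hη0
  refine ⟨_, hB.const_mul c⁻¹, fun z g hz hg hg' hle hint => ?_⟩
  obtain ⟨M, hM⟩ := hη.continuous.bounded_above_of_compact_support
    (hasCompactSupport_of_eq_zero hη0)
  -- An admissible `z` is bounded below by `-η (t - φ)` only, and the elastic competitor has trace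
  -- `t + η s z`. It stays above `φ` as soon as `s η² ≤ 1`. The inequality is homogeneous in `z`, so
  -- shrinking the direction costs nothing.
  set s : ℝ := (M ^ 2 + 1)⁻¹ with hs
  have hs0 : 0 < s := by positivity
  have hsη : ∀ x, s * η x ^ 2 ≤ 1 := fun x => by
    rw [hs, inv_mul_le_one₀ (by positivity)]
    have := hM x
    rw [Real.norm_eq_abs] at this
    nlinarith [sq_abs (η x), abs_nonneg (η x)]
  have hz' : HasFourier (fun y => s * z y) (fun ξ => (s : ℂ) * g ξ) := by
    refine ⟨hz.1.smul (s : ℂ), fun θ => ?_⟩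
    obtain ⟨h1, h2, h3⟩ := hz.2 θ
    simp only [Complex.ofReal_mul, mul_assoc]
    refine ⟨h1.const_mul _, h2.const_mul _, ?_⟩
    rw [integral_const_mul, integral_const_mul, h3]
  have hgs : IsL1L2 fun ξ => (s : ℂ) * g ξ := by
    simpa only [mul_comm] using hg.bdd_mul (α := fun _ => (s : ℂ)) measurable_const
      ⟨_, fun _ => le_rfl⟩
  have hgs' : MemLp (fun ξ => (√(rho ξ) : ℂ) * ((s : ℂ) * g ξ)) 2 := by
    simpa only [mul_left_comm] using hg'.const_mul (s : ℂ)
  have hle' : ∀ᵐ y ∂(volume.restrict (flatBall d)), φ y ≤ t y + η (flat y) * (s * z y) := by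
    filter_upwards [hφt, ae_restrict_of_ae hle] with y h1 h2
    have h3 := hsη (flat y)
    have h4 := mul_le_mul_of_nonneg_left h2 (mul_nonneg hs0.le (hη_nonneg (flat y)))
    -- `t - φ + s η z ≥ (1 - s η²) (t - φ) ≥ 0`.
    nlinarith [mul_nonneg (sub_nonneg.2 h3) (sub_nonneg.2 h1)]
  have key := boundarySource_le hu ht hF hvi hη hη0 hb hz' hgs hgs' hle'
  have i1 := hg.integrable_mul hB.memLp hB.bound
  have e1 : ∀ ξ, (s : ℂ) * g ξ * (2 * b * (mu + lam) *
        (rho ξ * (𝓕⁻ fun y => ((t y * η (flat y) : ℝ) : ℂ)) ξ) -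
        boundarySource mu lam b η F u Du ξ) =
      ((s * c : ℝ) : ℂ) * (g ξ * (rho ξ * (𝓕⁻ fun y => ((t y * η (flat y) : ℝ) : ℂ)) ξ)) -
        (s : ℂ) * (g ξ * boundarySource mu lam b η F u Du ξ) := fun ξ => by
    rw [hcdef]
    push_cast
    ring
  simp only [e1] at key
  rw [integral_sub (hint.const_mul _) (i1.const_mul _), integral_const_mul, integral_const_mul,
    Complex.sub_re, Complex.re_ofReal_mul, Complex.re_ofReal_mul] at key
  simp only [mul_left_comm (g _) ((c⁻¹ : ℝ) : ℂ)]
  rw [integral_const_mul, Complex.re_ofReal_mul, inv_mul_le_iff₀ hc0]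
  have : 0 ≤ s * (c * (∫ ξ, g ξ * (rho ξ * (𝓕⁻ fun y => ((t y * η (flat y) : ℝ) : ℂ)) ξ)).re -
      (∫ ξ, g ξ * boundarySource mu lam b η F u Du ξ).re) := by linarith
  linarith [nonneg_of_mul_nonneg_right this hs0]

end Source

/-! ### Half regularity of cut-off functions -/

section HalfRegularity

variable {d : ℕ}

/-- Equating two expressions for `ρ` times the exponential transform of `p f`, one from tangential
and one from normal derivatives, writes the transform of the trace as a combination of exponential
transforms of the gradient. Each of these gains half a derivative. -/
lemma HasFlatTrace.memLp_sqrt_rho_mul {f p : Eucl (d + 1) → ℝ}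
    {Df : Eucl (d + 1) → Fin (d + 1) → ℝ} {t : Eucl d → ℝ} (hf : HasH1Gradient f Df)
    (ht : HasFlatTrace f Df t) (hp : ContDiff ℝ ∞ p) (hp0 : ∀ x, 1 ≤ ‖x‖ → p x = 0) :
    MemLp (fun ξ => (√(rho ξ) : ℂ) * (𝓕⁻ fun y => ((t y * p (flat y) : ℝ) : ℂ)) ξ) 2 := by
  have h := fun j => (memLp_sqrt_mul_partialFourier isUnitMultiplier_exp continuous_rho rho_nonneg
    rho_mul_lintegral_multExp_le (hf.memLp_prodGrad hp hp0 j)).1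
  have hr : ∀ k : Fin d, MemLp (fun ξ => riesz k ξ * ((√(rho ξ) : ℂ) *
      partialFourier multExp (fun x => prodGrad p f Df x (Fin.castSucc k)) ξ)) 2 := fun k => by
    refine (h (Fin.castSucc k)).of_le_mul (c := 1)
      ((measurable_riesz k).aestronglyMeasurable.mul (h _).1)
      (Filter.Eventually.of_forall fun ξ => ?_)
    rw [norm_mul (riesz k ξ)]
    gcongr
    exact norm_riesz_le k ξ
  have key := (memLp_finsetSum Finset.univ fun k _ => hr k).sub (h (Fin.last d))
  refine (memLp_congr_ae (Filter.Eventually.of_forall fun ξ => ?_)).1 key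
  have h1 := hf.rho_mul_partialFourier hp hp0 contDiff_multExp ξ
  have h2 := hf.rho_mul_partialFourier_exp hp hp0 ξ
  have h3 := (HasFlatTrace.trace_mul hf ht hp hp0).2.2 ξ
  simp only [mul_left_comm (riesz _ _) ((√(rho ξ) : ℝ) : ℂ), ← Finset.mul_sum, Pi.sub_apply]
  rw [← h1, h2, h3]
  ring

/-- Translation by `k` multiplies the transform by a character; then Plancherel. -/
lemma lintegral_translate_sub_sq {f : Eucl d → ℂ} (hf : MemLp f 2) (hf' : Integrable f)
    (k : Eucl d) : ∫⁻ x, ‖f (x + k) - f x‖ₑ ^ 2 =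
      ∫⁻ ξ, ‖(Real.fourierChar (inner ℝ k ξ) : ℂ) - 1‖ₑ ^ 2 * ‖(𝓕 f) ξ‖ₑ ^ 2 := by
  have i1 : Integrable fun x => f (x + k) := hf'.comp_add_right k
  have m1 : MemLp (fun x => f (x + k)) 2 :=
    hf.comp_measurePreserving (measurePreserving_add_right volume k)
  have e : 𝓕 (fun x => f (x + k) - f x) =
      fun ξ => ((Real.fourierChar (inner ℝ k ξ) : ℂ) - 1) * (𝓕 f) ξ := by
    ext ξ
    have h := congrFun (VectorFourier.fourierIntegral_comp_add_right Real.fourierChar volume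
      (innerₗ (Eucl d)) f k) ξ
    have h' : 𝓕 (fun x => f (x + k)) ξ = (Real.fourierChar (inner ℝ k ξ) : ℂ) * (𝓕 f) ξ := h
    have h2 : 𝓕 (fun x => f (x + k) - f x) ξ = 𝓕 (fun x => f (x + k)) ξ - 𝓕 f ξ := by
      simp only [Real.fourier_eq, smul_sub]
      exact integral_sub ((Real.fourierIntegral_convergent_iff ξ).2 i1)
        ((Real.fourierIntegral_convergent_iff ξ).2 hf')
    rw [h2, h']
    ring
  have h := eLpNorm_fourier_eq (m1.sub hf) (i1.sub hf')
  have h2 := congrArg (fun a => a ^ 2) h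
  simp only [eLpNorm_two_sq] at h2
  rw [show (fun x => f (x + k)) - f = fun x => f (x + k) - f x from rfl] at h2
  rw [← h2, e]
  simp only [enorm_mul, mul_pow]

/-- For such phases the cosine is nonpositive, so the real part of the difference is at most `-1`.
-/
lemma one_le_norm_fourierChar_sub_one {s : ℝ} (h1 : 1 / 4 ≤ s) (h2 : s ≤ 3 / 4) :
    1 ≤ ‖(Real.fourierChar s : ℂ) - 1‖ := by
  have hc : Real.cos (2 * Real.pi * s) ≤ 0 := by
    apply Real.cos_nonpos_of_pi_div_two_le_of_le <;> nlinarith [Real.pi_pos]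
  refine le_trans ?_ (Complex.abs_re_le_norm _)
  rw [Real.fourierChar_apply, Complex.sub_re, Complex.exp_ofReal_mul_I_re, Complex.one_re]
  rw [abs_of_nonpos (by linarith)]
  linarith

/-- It suffices to integrate over the ball of radius `r = 1 / (4‖ξ‖)` about `ξ / (2‖ξ‖²)`. There the
phase `k · ξ` lies in `[1/4, 3/4]` and `‖k‖ ≤ 3r < 1/‖ξ‖`, so the integrand is at least `‖ξ‖^{d+1}`.
The volume of this ball supplies `(4‖ξ‖)^{-d}`. -/
lemma le_lintegral_fourierChar_sub_one {ξ : Eucl d} (hξ : 1 ≤ ‖ξ‖) :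
    ENNReal.ofReal (‖ξ‖ / 4 ^ d) * volume (Metric.ball (0 : Eucl d) 1) ≤
      ∫⁻ k in Metric.ball (0 : Eucl d) 1, ‖(Real.fourierChar (inner ℝ k ξ) : ℂ) - 1‖ₑ ^ 2 *
        ENNReal.ofReal (‖k‖ ^ (d + 1))⁻¹ := by
  have hξ0 : 0 < ‖ξ‖ := by linarith
  set r : ℝ := 1 / (4 * ‖ξ‖) with hr
  have hr0 : 0 < r := by positivity
  have hrξ : r * ‖ξ‖ = 1 / 4 := by rw [hr]; field_simp
  set k₀ : Eucl d := (1 / (2 * ‖ξ‖ ^ 2)) • ξ with hk₀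
  have hk₀n : ‖k₀‖ = 2 * r := by
    rw [hk₀, norm_smul, Real.norm_eq_abs, abs_of_pos (by positivity), hr]
    field_simp
    norm_num
  have hk₀i : inner ℝ k₀ ξ = 1 / 2 := by
    rw [hk₀, inner_smul_left, real_inner_self_eq_norm_sq]
    simp only [conj_trivial]
    field_simp
  have hsub : ∀ k ∈ Metric.ball k₀ r, ‖k‖ ≤ 3 * r ∧ 1 / 4 ≤ inner ℝ k ξ ∧ inner ℝ k ξ ≤ 3 / 4 := by
    intro k hk
    rw [mem_ball_iff_norm] at hk
    have h1 : ‖k‖ ≤ ‖k - k₀‖ + ‖k₀‖ := by simpa using norm_add_le (k - k₀) k₀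
    have h2 := abs_real_inner_le_norm (k - k₀) ξ
    rw [inner_sub_left, hk₀i] at h2
    have h3 : ‖k - k₀‖ * ‖ξ‖ ≤ 1 / 4 := by rw [← hrξ]; gcongr
    have h4 := abs_le.1 (h2.trans h3)
    exact ⟨by linarith, by linarith [h4.1], by linarith [h4.2]⟩
  have hrle : r ≤ 1 / 4 := by nlinarith
  have hball : Metric.ball k₀ r ⊆ Metric.ball (0 : Eucl d) 1 := fun k hk => by
    rw [mem_ball_zero_iff]
    linarith [(hsub k hk).1]
  refine le_trans ?_ (lintegral_mono_set hball)
  have hlow : ∀ k ∈ Metric.ball k₀ r, ENNReal.ofReal (‖ξ‖ ^ (d + 1)) ≤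
      ‖(Real.fourierChar (inner ℝ k ξ) : ℂ) - 1‖ₑ ^ 2 * ENNReal.ofReal (‖k‖ ^ (d + 1))⁻¹ := by
    intro k hk
    obtain ⟨h1, h2, h3⟩ := hsub k hk
    have hn := one_le_norm_fourierChar_sub_one h2 h3
    have hk0 : 0 < ‖k‖ := by
      rw [norm_pos_iff]
      rintro rfl
      simp at h2
      linarith
    have hb : ‖ξ‖ ^ (d + 1) ≤ (‖k‖ ^ (d + 1))⁻¹ := by
      rw [← inv_pow]
      gcongr
      rw [le_inv_comm₀ hξ0 hk0, inv_eq_one_div, le_div_iff₀ hξ0]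
      nlinarith
    calc ENNReal.ofReal (‖ξ‖ ^ (d + 1)) = 1 ^ 2 * ENNReal.ofReal (‖ξ‖ ^ (d + 1)) := by simp
      _ ≤ _ := by
        gcongr
        rw [← ofReal_norm]
        exact ENNReal.one_le_ofReal.2 hn
  refine le_trans ?_ (setLIntegral_mono' measurableSet_ball hlow)
  rw [setLIntegral_const, Measure.addHaar_ball_of_pos volume k₀ hr0, ← mul_assoc,
    ← ENNReal.ofReal_mul (by positivity), finrank_euclideanSpace_fin]
  gcongr
  rw [hr, pow_succ, one_div, inv_pow, mul_pow]
  apply le_of_eq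
  field_simp

/-- By Plancherel and Tonelli the Gagliardo integral is the integral of `J |𝓕 f|²`. For `‖ξ‖ ≥ 1`
the weight `ρ` is at most a constant times `J`, and low frequencies are controlled by the `L²` norm,
so differences with `‖k‖ < 1` suffice. -/
lemma memLp_sqrt_rho_mul_fourier {f : Eucl d → ℂ} (hf : MemLp f 2) (hf' : Integrable f)
    (hG : ∫⁻ k in Metric.ball (0 : Eucl d) 1, (∫⁻ x, ‖f (x + k) - f x‖ₑ ^ 2) *
      ENNReal.ofReal (‖k‖ ^ (d + 1))⁻¹ < ⊤) :
    MemLp (fun ξ => (√(rho ξ) : ℂ) * (𝓕 f) ξ) 2 := by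
  have hcont := continuous_fourier_of_integrable hf'
  have hL2 : ∫⁻ ξ, ‖(𝓕 f) ξ‖ₑ ^ 2 < ⊤ := by
    rw [← eLpNorm_two_sq, eLpNorm_fourier_eq hf hf']
    exact ENNReal.pow_lt_top hf.2
  set J : Eucl d → ENNReal := fun ξ => ∫⁻ k in Metric.ball (0 : Eucl d) 1,
    ‖(Real.fourierChar (inner ℝ k ξ) : ℂ) - 1‖ₑ ^ 2 * ENNReal.ofReal (‖k‖ ^ (d + 1))⁻¹ with hJ
  have hJm : Measurable fun q : Eucl d × Eucl d =>
      ‖(Real.fourierChar (inner ℝ q.2 q.1) : ℂ) - 1‖ₑ ^ 2 *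
        ENNReal.ofReal (‖q.2‖ ^ (d + 1))⁻¹ := by
    have h1 : Continuous fun q : Eucl d × Eucl d =>
        (Real.fourierChar (inner ℝ q.2 q.1) : ℂ) - 1 := by fun_prop
    refine (h1.measurable.enorm.pow_const 2).mul (Measurable.ennreal_ofReal ?_)
    exact (measurable_snd.norm.pow_const _).inv
  have hJ' : Measurable J := hJm.lintegral_prod_right'
  have hfin : ∫⁻ ξ, J ξ * ‖(𝓕 f) ξ‖ₑ ^ 2 < ⊤ := by
    refine lt_of_le_of_lt (le_of_eq ?_) hG
    have e1 : ∀ k, (∫⁻ x, ‖f (x + k) - f x‖ₑ ^ 2) * ENNReal.ofReal (‖k‖ ^ (d + 1))⁻¹ =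
        ∫⁻ ξ, ‖(Real.fourierChar (inner ℝ k ξ) : ℂ) - 1‖ₑ ^ 2 *
          ENNReal.ofReal (‖k‖ ^ (d + 1))⁻¹ * ‖(𝓕 f) ξ‖ₑ ^ 2 := fun k => by
      rw [lintegral_translate_sub_sq hf hf', ← lintegral_mul_const' _ _ ENNReal.ofReal_ne_top]
      refine lintegral_congr fun ξ => ?_
      ring
    simp only [e1]
    rw [lintegral_lintegral_swap]
    · refine lintegral_congr fun ξ => ?_
      rw [hJ, lintegral_mul_const']
      exact ENNReal.pow_ne_top enorm_ne_top
    · exact ((hJm.comp measurable_swap).mul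
        (hcont.measurable.enorm.pow_const 2 |>.comp measurable_snd)).aemeasurable
  set V := volume (Metric.ball (0 : Eucl d) 1) with hV
  have hV0 : V ≠ 0 := (Metric.measure_ball_pos _ _ one_pos).ne'
  have hVt : V ≠ ⊤ := measure_ball_lt_top.ne
  -- The constant is chosen so that `D J ≥ 2π‖ξ‖ = ρ` for `‖ξ‖ ≥ 1`, by the lower bound for `J`.
  set D : ENNReal := ENNReal.ofReal (2 * Real.pi * 4 ^ d) * V⁻¹ with hD
  have hDt : D ≠ ⊤ := ENNReal.mul_ne_top ENNReal.ofReal_ne_top (ENNReal.inv_ne_top.2 hV0)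
  refine ⟨(((Complex.continuous_ofReal.comp
    (Real.continuous_sqrt.comp continuous_rho)).mul hcont).aestronglyMeasurable), ?_⟩
  refine (ENNReal.pow_lt_top_iff.1 ?_).resolve_right two_ne_zero
  rw [eLpNorm_two_sq]
  have hbound : ∀ ξ, ‖(√(rho ξ) : ℂ) * (𝓕 f) ξ‖ₑ ^ 2 ≤
      ENNReal.ofReal (2 * Real.pi) * ‖(𝓕 f) ξ‖ₑ ^ 2 + D * (J ξ * ‖(𝓕 f) ξ‖ₑ ^ 2) := by
    intro ξ
    have e : ‖(√(rho ξ) : ℂ) * (𝓕 f) ξ‖ₑ ^ 2 = ENNReal.ofReal (rho ξ) * ‖(𝓕 f) ξ‖ₑ ^ 2 := by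
      rw [enorm_mul, mul_pow, ← ofReal_norm, Complex.norm_real, Real.norm_eq_abs,
        abs_of_nonneg (Real.sqrt_nonneg _), ← ENNReal.ofReal_pow (Real.sqrt_nonneg _),
        Real.sq_sqrt (rho_nonneg ξ)]
    rw [e, ← mul_assoc, ← add_mul]
    gcongr
    rcases le_total ‖ξ‖ 1 with h | h
    · refine le_add_right (ENNReal.ofReal_le_ofReal ?_)
      rw [rho]
      nlinarith [Real.pi_pos]
    · refine le_add_left ?_
      refine le_trans (le_of_eq ?_) (mul_le_mul_right (le_lintegral_fourierChar_sub_one h) D)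
      rw [hD, mul_comm (ENNReal.ofReal (‖ξ‖ / 4 ^ d)), mul_assoc, ← mul_assoc V⁻¹,
        ENNReal.inv_mul_cancel hV0 hVt, one_mul, ← ENNReal.ofReal_mul (by positivity), rho]
      congr 1
      field_simp
  refine (lintegral_mono hbound).trans_lt ?_
  have mF : Measurable fun ξ => ‖(𝓕 f) ξ‖ₑ ^ 2 := hcont.measurable.enorm.pow_const 2
  have mJ : Measurable fun ξ => J ξ * ‖(𝓕 f) ξ‖ₑ ^ 2 := hJ'.mul mF
  rw [lintegral_add_left (mF.const_mul _), lintegral_const_mul _ mF, lintegral_const_mul _ mJ]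
  exact ENNReal.add_lt_top.2 ⟨ENNReal.mul_lt_top ENNReal.ofReal_lt_top hL2,
    ENNReal.mul_lt_top hDt.lt_top hfin⟩

end HalfRegularity

/-! ### Cutting off an `H^{1/2}` function on the ball -/

section Cutoff

variable {d : ℕ}

open scoped Classical in
-- With both points in the ball, the difference is `q x (φ y - φ x) + φ y (q y - q x)`. If one point
-- lies outside, `q` vanishes there, and the Lipschitz bound controls `q` at the other point. So no
-- difference of `φ` across the boundary is needed.
lemma sq_mul_sub_mul_le {φ q : Eucl d → ℝ} {M : ℝ} {L : NNReal} (hM : ∀ x, ‖q x‖ ≤ M)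
    (hL : LipschitzWith L q) (hq0 : ∀ x, x ∉ flatBall d → q x = 0) (x y : Eucl d) :
    (φ y * q y - φ x * q x) ^ 2 ≤
      2 * M ^ 2 * (if x ∈ flatBall d ∧ y ∈ flatBall d then (φ x - φ y) ^ 2 else 0) +
      2 * (L * ‖y - x‖) ^ 2 *
        ((flatBall d).indicator (fun x => φ x ^ 2) x +
          (flatBall d).indicator (fun x => φ x ^ 2) y) := by
  have h1 : (q y - q x) ^ 2 ≤ (L * ‖y - x‖) ^ 2 := by
    have := hL.dist_le_mul y x
    rw [dist_eq_norm, dist_eq_norm, Real.norm_eq_abs] at this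
    exact sq_le_sq' (by linarith [abs_le.1 this |>.1]) (abs_le.1 this).2
  have h2 : q x ^ 2 ≤ M ^ 2 := by
    have := hM x
    rw [Real.norm_eq_abs] at this
    exact sq_le_sq' (by linarith [abs_le.1 this |>.1]) (abs_le.1 this).2
  have h3 : 0 ≤ (L * ‖y - x‖) ^ 2 := sq_nonneg _
  have hx2 := sq_nonneg (φ x)
  have hy2 := sq_nonneg (φ y)
  by_cases hx : x ∈ flatBall d <;> by_cases hy : y ∈ flatBall d
  · simp only [hx, hy, and_self, if_true, indicator_of_mem]
    have e : φ y * q y - φ x * q x = q x * (φ y - φ x) + φ y * (q y - q x) := by ring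
    rw [e]
    nlinarith [sq_nonneg (q x * (φ y - φ x) - φ y * (q y - q x)),
      mul_le_mul_of_nonneg_right h2 (sq_nonneg (φ x - φ y)), mul_le_mul_of_nonneg_left h1 hy2,
      mul_nonneg h3 hx2]
  · simp only [hx, hy, and_false, if_false, indicator_of_mem, not_false_eq_true,
      indicator_of_notMem, hq0 y hy]
    rw [hq0 y hy] at h1
    nlinarith [mul_le_mul_of_nonneg_left h1 hx2, mul_nonneg h3 hx2]
  · simp only [hx, hy, false_and, if_false, indicator_of_mem, not_false_eq_true,
      indicator_of_notMem, hq0 x hx]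
    rw [hq0 x hx] at h1
    nlinarith [mul_le_mul_of_nonneg_left h1 hy2, mul_nonneg h3 hy2]
  · simp [hx, hy, hq0 x hx, hq0 y hy]

/-- The Lipschitz factor `‖k‖²` reduces the kernel `‖k‖^{-(d+1)}` to `‖k‖^{-(d-1)}`, which is
integrable near the origin of `ℝᵈ`. -/
lemma lintegral_ball_sq_mul_inv_lt_top (hd : 1 ≤ d) (c : ℝ) :
    ∫⁻ k in Metric.ball (0 : Eucl d) 1, ENNReal.ofReal ((c * ‖k‖) ^ 2 * (‖k‖ ^ (d + 1))⁻¹) < ⊤ := by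
  obtain ⟨m, rfl⟩ : ∃ m, d = m + 1 := ⟨d - 1, by omega⟩
  have hmeas : Measurable fun k : Eucl (m + 1) => (c * ‖k‖) ^ 2 * (‖k‖ ^ (m + 1 + 1))⁻¹ :=
    ((measurable_norm.const_mul c).pow_const 2).mul (measurable_norm.pow_const _).inv
  have h := integrableOn_ball_of_norm_le_rpow (μ := (volume : Measure (Eucl (m + 1))))
    (f := fun k : Eucl (m + 1) => (c * ‖k‖) ^ 2 * (‖k‖ ^ (m + 1 + 1))⁻¹) (C := c ^ 2)
    (α := m) (r := 1) (by simp) (by simp) (Filter.Eventually.of_forall fun k => ?_)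
    hmeas.aestronglyMeasurable
  · exact h.lintegral_lt_top
  · rw [Real.rpow_neg (norm_nonneg _), Real.rpow_natCast, Real.norm_eq_abs,
      abs_of_nonneg (by positivity)]
    by_cases hk : ‖k‖ = 0
    · rw [hk]
      simp only [mul_zero, ne_eq, OfNat.ofNat_ne_zero, not_false_eq_true, zero_pow, zero_mul]
      positivity
    · apply le_of_eq
      field_simp
      ring

lemma lintegral_lintegral_translate {D : Eucl d → Eucl d → ENNReal} {k : Eucl d → ENNReal}
    (hD : Measurable fun p : Eucl d × Eucl d => D p.1 p.2) (hk : Measurable k) :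
    ∫⁻ z, ∫⁻ x, D x (x + z) * k z = ∫⁻ x, ∫⁻ y, D x y * k (y - x) := by
  have h1 : Measurable fun p : Eucl d × Eucl d => D p.2 (p.2 + p.1) :=
    hD.comp (measurable_snd.prodMk (measurable_snd.add measurable_fst))
  have h2 : Measurable fun p : Eucl d × Eucl d => D p.2 (p.2 + p.1) * k p.1 :=
    h1.mul (hk.comp measurable_fst)
  rw [lintegral_lintegral_swap (f := fun z x => D x (x + z) * k z) h2.aemeasurable]
  refine lintegral_congr fun x => ?_
  rw [← lintegral_add_left_eq_self (fun y => D x y * k (y - x)) x]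
  simp only [add_sub_cancel_left]

open scoped Classical in
lemma MemHHalfBall.lintegral_translate_kernel_lt_top {φ : Eucl d → ℝ} (hφm : Measurable φ)
    (hφ : MemHHalfBall φ) :
    ∫⁻ k, ∫⁻ x, ENNReal.ofReal ((if x ∈ flatBall d ∧ x + k ∈ flatBall d then
      (φ x - φ (x + k)) ^ 2 else 0)) * ENNReal.ofReal (‖k‖ ^ (d + 1))⁻¹ < ⊤ := by
  have hB : MeasurableSet (flatBall d) := measurableSet_ball
  have hwm : Measurable fun k : Eucl d => ENNReal.ofReal (‖k‖ ^ (d + 1))⁻¹ :=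
    (measurable_norm.pow_const _).inv.ennreal_ofReal
  have hDm : Measurable fun p : Eucl d × Eucl d =>
      ENNReal.ofReal (if p.1 ∈ flatBall d ∧ p.2 ∈ flatBall d then (φ p.1 - φ p.2) ^ 2 else 0) :=
    (Measurable.ite ((hB.preimage measurable_fst).inter (hB.preimage measurable_snd))
      (((hφm.comp measurable_fst).sub (hφm.comp measurable_snd)).pow_const 2)
      measurable_const).ennreal_ofReal
  rw [lintegral_lintegral_translate (D := fun x y => ENNReal.ofReal
    (if x ∈ flatBall d ∧ y ∈ flatBall d then (φ x - φ y) ^ 2 else 0)) hDm hwm]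
  refine lt_of_le_of_lt (le_of_eq ?_) hφ.2
  rw [← lintegral_indicator hB]
  refine lintegral_congr fun x => ?_
  by_cases hx : x ∈ flatBall d
  · rw [indicator_of_mem hx, ← lintegral_indicator hB]
    refine lintegral_congr fun y => ?_
    by_cases hy : y ∈ flatBall d
    · simp only [hx, hy, and_self, if_true, indicator_of_mem, norm_sub_rev y x, div_eq_mul_inv]
      rw [ENNReal.ofReal_mul (sq_nonneg _)]
    · simp [hy]
  · simp [hx]

/-- The pointwise bound is integrated against the kernel: the first part is the seminorm of `φ` on
the ball, the second a convergent integral in `k` times the squared `L²` norm of `φ` there. -/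
lemma MemHHalfBall.lintegral_translate_lt_top (hd : 1 ≤ d) {φ q : Eucl d → ℝ} (hφm : Measurable φ)
    (hφ : MemHHalfBall φ) {M : ℝ} {L : NNReal} (hM : ∀ x, ‖q x‖ ≤ M) (hL : LipschitzWith L q)
    (hq0 : ∀ x, x ∉ flatBall d → q x = 0) :
    ∫⁻ k in Metric.ball (0 : Eucl d) 1,
      (∫⁻ x, ENNReal.ofReal ((φ (x + k) * q (x + k) - φ x * q x) ^ 2)) *
        ENNReal.ofReal (‖k‖ ^ (d + 1))⁻¹ < ⊤ := by
  classical
  have hB : MeasurableSet (flatBall d) := measurableSet_ball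
  set D : Eucl d → Eucl d → ℝ := fun x y =>
    if x ∈ flatBall d ∧ y ∈ flatBall d then (φ x - φ y) ^ 2 else 0 with hD
  set Φ : Eucl d → ℝ := (flatBall d).indicator fun x => φ x ^ 2 with hΦ
  have hDm : Measurable fun p : Eucl d × Eucl d => D p.1 p.2 :=
    Measurable.ite ((hB.preimage measurable_fst).inter (hB.preimage measurable_snd))
      (((hφm.comp measurable_fst).sub (hφm.comp measurable_snd)).pow_const 2) measurable_const
  have hD0 : ∀ x y, 0 ≤ D x y := fun x y => by
    simp only [hD]
    split_ifs
    · exact sq_nonneg _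
    · exact le_rfl
  have hΦm : Measurable Φ := (hφm.pow_const 2).indicator hB
  have hΦ0 : ∀ x, 0 ≤ Φ x := fun x => indicator_nonneg (fun x _ => sq_nonneg _) x
  have hΦfin : ∫⁻ x, ENNReal.ofReal (Φ x) < ⊤ := by
    have := hφ.1.integrable_sq
    exact ((integrable_indicator_iff hB).2 this).lintegral_lt_top
  set wt : Eucl d → ℝ := fun k => (‖k‖ ^ (d + 1))⁻¹ with hwt
  have hwm : Measurable wt := (measurable_norm.pow_const _).inv
  have hw0 : ∀ k, 0 ≤ wt k := fun k => by positivity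
  have hDfin : ∫⁻ k, ∫⁻ x, ENNReal.ofReal (D x (x + k) * wt k) < ⊤ := by
    simp only [ENNReal.ofReal_mul (hD0 _ _)]
    exact hφ.lintegral_translate_kernel_lt_top hφm
  have hpt : ∀ k, (∫⁻ x, ENNReal.ofReal ((φ (x + k) * q (x + k) - φ x * q x) ^ 2)) *
      ENNReal.ofReal (‖k‖ ^ (d + 1))⁻¹ ≤
      ENNReal.ofReal (2 * M ^ 2) * (∫⁻ x, ENNReal.ofReal (D x (x + k) * wt k)) +
        ENNReal.ofReal ((L * ‖k‖) ^ 2 * (‖k‖ ^ (d + 1))⁻¹) *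
          (4 * ∫⁻ x, ENNReal.ofReal (Φ x)) := by
    intro k
    have m1 : Measurable fun x => ENNReal.ofReal (D x (x + k) * wt k) :=
      ((hDm.comp (measurable_id.prodMk (measurable_id.add_const k))).mul_const _).ennreal_ofReal
    -- The factor four is the two from squaring a sum, times the two translates of `Φ`, which have
    -- equal integrals.
    have e2 : 4 * ∫⁻ x, ENNReal.ofReal (Φ x) =
        ∫⁻ x, 2 * (ENNReal.ofReal (Φ x) + ENNReal.ofReal (Φ (x + k))) := by
      rw [lintegral_const_mul' _ _ (by norm_num), lintegral_add_left hΦm.ennreal_ofReal,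
        lintegral_add_right_eq_self (fun x => ENNReal.ofReal (Φ x)) k]
      ring
    rw [← lintegral_mul_const' _ _ ENNReal.ofReal_ne_top, e2,
      ← lintegral_const_mul' _ _ ENNReal.ofReal_ne_top,
      ← lintegral_const_mul' _ _ ENNReal.ofReal_ne_top,
      ← lintegral_add_left (m1.const_mul _)]
    refine lintegral_mono fun x => ?_
    have h := mul_le_mul_of_nonneg_right (sq_mul_sub_mul_le (φ := φ) hM hL hq0 x (x + k)) (hw0 k)
    rw [← ENNReal.ofReal_mul (sq_nonneg _)]
    refine (ENNReal.ofReal_le_ofReal h).trans (le_of_eq ?_)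
    have e3 : (2 * M ^ 2 * D x (x + k) +
        2 * (L * ‖x + k - x‖) ^ 2 * (Φ x + Φ (x + k))) * wt k =
        2 * M ^ 2 * (D x (x + k) * wt k) +
          (L * ‖k‖) ^ 2 * (‖k‖ ^ (d + 1))⁻¹ * (2 * (Φ x + Φ (x + k))) := by
      rw [add_sub_cancel_left]
      ring
    have hp1 : 0 ≤ D x (x + k) * wt k := mul_nonneg (hD0 _ _) (hw0 k)
    have hp2 : 0 ≤ Φ x + Φ (x + k) := add_nonneg (hΦ0 _) (hΦ0 _)
    refine (congrArg ENNReal.ofReal e3).trans ?_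
    rw [ENNReal.ofReal_add (by positivity) (by positivity), ENNReal.ofReal_mul (by positivity),
      ENNReal.ofReal_mul (p := (L * ‖k‖) ^ 2 * (‖k‖ ^ (d + 1))⁻¹) (by positivity),
      ENNReal.ofReal_mul (p := 2) (q := Φ x + Φ (x + k)) (by norm_num), ENNReal.ofReal_add (hΦ0 _) (hΦ0 _)]
    simp
  refine (lintegral_mono hpt).trans_lt ?_
  have m2 : Measurable fun k : Eucl d => ENNReal.ofReal ((L * ‖k‖) ^ 2 * (‖k‖ ^ (d + 1))⁻¹) :=
    (((measurable_norm.const_mul _).pow_const 2).mul hwm).ennreal_ofReal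
  rw [lintegral_add_right _ (m2.mul_const _), lintegral_const_mul' _ _ ENNReal.ofReal_ne_top,
    lintegral_mul_const _ m2]
  refine ENNReal.add_lt_top.2 ⟨ENNReal.mul_lt_top ENNReal.ofReal_lt_top
    ((setLIntegral_le_lintegral _ _).trans_lt hDfin), ENNReal.mul_lt_top
    (lintegral_ball_sq_mul_inv_lt_top hd L) (ENNReal.mul_lt_top (by norm_num) hΦfin)⟩

/-- The product of an `H^{1/2}` function on the ball with a cutoff function is in `H^{1/2}`. -/
lemma MemHHalfBall.mul_cutoff (hd : 1 ≤ d) {φ q : Eucl d → ℝ} (hφ : MemHHalfBall φ)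
    (hq : ContDiff ℝ ∞ q) (hq0 : ∀ x, 1 ≤ ‖x‖ → q x = 0) :
    MemLp (fun x => φ x * q x) 2 ∧ Integrable (fun x => φ x * q x) ∧
      MemLp (fun ξ => (√(rho ξ) : ℂ) * (𝓕 fun x => ((φ x * q x : ℝ) : ℂ)) ξ) 2 := by
  have hB : MeasurableSet (flatBall d) := measurableSet_ball
  have hc := hasCompactSupport_of_eq_zero hq0
  have hq0' : ∀ x, x ∉ flatBall d → q x = 0 := fun x hx => hq0 x (by simpa [flatBall] using hx)
  obtain ⟨M, hM⟩ := hq.continuous.bounded_above_of_compact_support hc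
  obtain ⟨L, hL⟩ := hq.lipschitzWith_of_hasCompactSupport hc (by simp)
  -- A measurable representative is needed for the changes of variables; neither the seminorm nor
  -- the product with `q` sees the null set.
  set φ₀ := hφ.1.1.mk φ with hφ₀
  have hφ₀m : Measurable φ₀ := hφ.1.1.stronglyMeasurable_mk.measurable
  have hae : φ =ᵐ[volume.restrict (flatBall d)] φ₀ := hφ.1.1.ae_eq_mk
  have hφ₀' : MemHHalfBall φ₀ := by
    refine ⟨hφ.1.ae_eq hae, lt_of_le_of_lt (le_of_eq ?_) hφ.2⟩
    refine lintegral_congr_ae ?_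
    filter_upwards [hae] with x hx
    refine lintegral_congr_ae ?_
    filter_upwards [hae] with y hy
    rw [hx, hy]
  have hfg : (fun x => φ x * q x) =ᵐ[volume] fun x => φ₀ x * q x := by
    filter_upwards [(ae_restrict_iff' hB).1 hae] with x hx
    by_cases h : x ∈ flatBall d
    · rw [hx h]
    · simp [hq0' x h]
  have m0 : MemLp (fun x => φ₀ x * q x) 2 := by
    have h1 : MemLp ((flatBall d).indicator φ₀) 2 := (memLp_indicator_iff_restrict hB).2 hφ₀'.1
    refine h1.of_le_mul (c := M) ((hφ₀m.mul hq.continuous.measurable).aestronglyMeasurable)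
      (Filter.Eventually.of_forall fun x => ?_)
    by_cases h : x ∈ flatBall d
    · rw [indicator_of_mem h, norm_mul, mul_comm]
      gcongr
      exact hM x
    · simp [hq0' x h, h]
  have i0 : Integrable (fun x => φ₀ x * q x) := by
    have h2 : Integrable (fun x => φ₀ x * q x) (volume.restrict (flatBall d)) :=
      haveI : IsFiniteMeasure (volume.restrict (flatBall d)) := inferInstance
      (m0.restrict _).integrable (by norm_num)
    exact (integrableOn_iff_integrable_of_support_subset fun x hx => by
      by_contra h
      exact hx (by simp [hq0' x h])).1 h2
  refine ⟨m0.ae_eq hfg.symm, i0.congr hfg.symm, ?_⟩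
  have eF : 𝓕 (fun x => ((φ x * q x : ℝ) : ℂ)) = 𝓕 (fun x => ((φ₀ x * q x : ℝ) : ℂ)) := by
    ext ξ
    simp only [Real.fourier_eq]
    refine integral_congr_ae ?_
    filter_upwards [hfg] with x hx
    rw [hx]
  rw [eF]
  refine memLp_sqrt_rho_mul_fourier m0.ofReal i0.ofReal ?_
  convert hφ₀'.lintegral_translate_lt_top hd hφ₀m hM hL hq0' using 6 with k x
  rw [← Complex.ofReal_sub, ← ofReal_norm, Complex.norm_real, ← ENNReal.ofReal_pow (norm_nonneg _),
    Real.norm_eq_abs, sq_abs]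

end Cutoff

/-! ### Fractional Laplacians of order one half and one -/

section Order

variable {d : ℕ}

lemma rpow_two_mul_quarter (ξ : Eucl d) :
    (2 * Real.pi * ‖ξ‖) ^ (2 * (1 / 4) : ℝ) = √(rho ξ) := by
  rw [Real.sqrt_eq_rpow, rho]
  norm_num

lemma hasFracLaplacian_quarter_iff {f g : Eucl d → ℝ} : HasFracLaplacian (1 / 4) f g ↔
    MemLp g 2 ∧ ∃ G, HasFourier f G ∧ HasFourier g fun ξ => (√(rho ξ) : ℂ) * G ξ := by
  simp only [HasFracLaplacian, rpow_two_mul_quarter]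

lemma HasFracLaplacian.memHdot {f g : Eucl d → ℝ} (h : HasFracLaplacian (1 / 4) f g) :
    MemHdot (1 / 2) f := ⟨g, by convert h using 1; norm_num⟩

lemma HasFracLaplacian.sub {s : ℝ} {f₁ f₂ g₁ g₂ : Eucl d → ℝ} (h₁ : HasFracLaplacian s f₁ g₁)
    (h₂ : HasFracLaplacian s f₂ g₂) :
    HasFracLaplacian s (fun x => f₁ x - f₂ x) (fun x => g₁ x - g₂ x) := by
  obtain ⟨m₁, G₁, a₁, b₁⟩ := h₁
  obtain ⟨m₂, G₂, a₂, b₂⟩ := h₂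
  refine ⟨m₁.sub m₂, _, a₁.sub a₂, ?_⟩
  convert b₁.sub b₂ using 2
  ring

lemma conj_fourier_ofReal (f : Eucl d → ℝ) (ξ : Eucl d) :
    starRingEnd ℂ ((𝓕 fun x => (f x : ℂ)) ξ) = (𝓕⁻ fun x => (f x : ℂ)) ξ := by
  rw [Real.fourier_eq, Real.fourierInv_eq, ← integral_conj]
  refine integral_congr_ae (Filter.Eventually.of_forall fun x => ?_)
  simp [Circle.smul_def, AddChar.map_neg_eq_inv]

lemma fourier_ofReal_neg (f : Eucl d → ℝ) (ξ : Eucl d) :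
    (𝓕 fun x => (f x : ℂ)) (-ξ) = starRingEnd ℂ ((𝓕 fun x => (f x : ℂ)) ξ) := by
  rw [conj_fourier_ofReal, Real.fourierInv_eq_fourier_neg]

lemma hasFourier_fourier {f : Eucl d → ℝ} (hf : MemLp f 2) (hf' : Integrable f) :
    HasFourier f (𝓕 fun x => (f x : ℂ)) := by
  obtain ⟨G, -, hG⟩ := hf.exists_hasFourier
  exact hG.congr (hG.ae_eq_fourier hf')

lemma exists_hasFourier_sqrt_rho_mul {G : Eucl d → ℂ}
    (hG : MemLp (fun ξ => (√(rho ξ) : ℂ) * G ξ) 2)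
    (hherm : ∀ ξ, G (-ξ) = starRingEnd ℂ (G ξ)) :
    ∃ V, MemLp V 2 ∧ HasFourier V fun ξ => (√(rho ξ) : ℂ) * G ξ :=
  exists_hasFourier_of_memLp hG fun ξ => by simp [hherm, rho_neg]

lemma one_le_rho {ξ : Eucl d} (h : ξ ∉ Metric.ball (0 : Eucl d) 1) : 1 ≤ rho ξ := by
  have h' : 1 ≤ ‖ξ‖ := by simpa using h
  have := Real.pi_gt_three
  rw [rho]
  nlinarith

/-- Outside the unit ball `ρ ≥ 1`, so there `√ρ G` dominates `G`. Elements of `Ḣ^{1/2}` thus have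
transforms of the kind the extension accepts. -/
lemma isL1L2_of_locallyIntegrable {G : Eucl d → ℂ} (hG : LocallyIntegrable G)
    (hG' : MemLp (fun ξ => (√(rho ξ) : ℂ) * G ξ) 2) : IsL1L2 G := by
  refine ⟨?_, ?_⟩
  · rw [integrable_indicator_iff measurableSet_ball]
    exact (hG.integrableOn_isCompact (isCompact_closedBall 0 1)).mono_set
      Metric.ball_subset_closedBall
  · refine hG'.mono (hG.aestronglyMeasurable.indicator measurableSet_ball.compl)
      (Filter.Eventually.of_forall fun ξ => ?_)
    by_cases h : ξ ∈ Metric.ball (0 : Eucl d) 1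
    · rw [indicator_of_notMem (notMem_compl_iff.2 h), norm_zero]
      exact norm_nonneg _
    · rw [indicator_of_mem h, norm_mul, Complex.norm_real, Real.norm_eq_abs,
        abs_of_nonneg (Real.sqrt_nonneg _)]
      exact le_mul_of_one_le_left (norm_nonneg _) (Real.one_le_sqrt.2 (one_le_rho h))

/-- Low frequencies give a bounded function, high frequencies an `L²` function. The unit ball is
symmetric, so both pieces remain Hermitian and both functions are real. -/
lemma IsL1L2.exists_hasFourier {G : Eucl d → ℂ} (hG : IsL1L2 G)
    (hherm : ∀ ξ, G (-ξ) = starRingEnd ℂ (G ξ)) : ∃ f, HasFourier f G := by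
  have hs : ∀ s : Set (Eucl d), (∀ ξ, -ξ ∈ s ↔ ξ ∈ s) → ∀ ξ,
      s.indicator G (-ξ) = starRingEnd ℂ (s.indicator G ξ) := fun s hs ξ => by
    by_cases h : ξ ∈ s
    · rw [indicator_of_mem h, indicator_of_mem ((hs ξ).2 h), hherm]
    · rw [indicator_of_notMem h, indicator_of_notMem (fun h' => h ((hs ξ).1 h')), map_zero]
  obtain ⟨f₁, h₁⟩ := exists_hasFourier_of_integrable hG.1 (hs _ fun ξ => by simp)
  obtain ⟨f₂, -, h₂⟩ := exists_hasFourier_of_memLp hG.2 (hs _ fun ξ => by simp)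
  refine ⟨_, (h₁.add h₂).congr (Filter.Eventually.of_forall fun ξ => ?_)⟩
  by_cases h : ξ ∈ Metric.ball (0 : Eucl d) 1 <;> simp [h]

/-- The multiplier `|2πξ|⁻¹` maps bounded elements of `L²` to Fourier transforms of elements of
`Ḣ^{1/2}`, in dimension at least two. -/
lemma IsBddL2.inv_rho_mul (hd : 2 ≤ d) {K : Eucl d → ℂ} (hK : IsBddL2 K) :
    IsL1L2 (fun ξ => (rho ξ : ℂ)⁻¹ * K ξ) ∧
      MemLp (fun ξ => (√(rho ξ) : ℂ) * ((rho ξ : ℂ)⁻¹ * K ξ)) 2 := by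
  obtain ⟨C, hC⟩ := hK.bound
  have hC0 : 0 ≤ C := (norm_nonneg _).trans (hC 0)
  have hd1 : (1 : ℝ) < Module.finrank ℝ (Eucl d) := by
    rw [finrank_euclideanSpace_fin]
    exact_mod_cast hd
  have hd1' : 1 ≤ Module.finrank ℝ (Eucl d) := by
    rw [finrank_euclideanSpace_fin]
    omega
  have mr : Measurable fun ξ : Eucl d => (rho ξ : ℂ)⁻¹ :=
    (Complex.continuous_ofReal.comp continuous_rho).measurable.inv
  have ms : Measurable fun ξ : Eucl d => (√(rho ξ) : ℂ) :=
    (Complex.continuous_ofReal.comp (Real.continuous_sqrt.comp continuous_rho)).measurable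
  have m1 : AEStronglyMeasurable (fun ξ => (rho ξ : ℂ)⁻¹ * K ξ) :=
    mr.aestronglyMeasurable.mul hK.memLp.1
  have m2 : AEStronglyMeasurable (fun ξ => (√(rho ξ) : ℂ) * ((rho ξ : ℂ)⁻¹ * K ξ)) :=
    ms.aestronglyMeasurable.mul m1
  have n1 : ∀ ξ, ‖(rho ξ : ℂ)⁻¹ * K ξ‖ = (rho ξ)⁻¹ * ‖K ξ‖ := fun ξ => by
    rw [norm_mul, norm_inv, Complex.norm_real, Real.norm_eq_abs, abs_of_nonneg (rho_nonneg ξ)]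
  have n2 : ∀ ξ, ‖(√(rho ξ) : ℂ) * ((rho ξ : ℂ)⁻¹ * K ξ)‖ = √(rho ξ) * ((rho ξ)⁻¹ * ‖K ξ‖) :=
    fun ξ => by
      rw [norm_mul, n1, Complex.norm_real, Real.norm_eq_abs, abs_of_nonneg (Real.sqrt_nonneg _)]
  have hrinv : ∀ ξ : Eucl d, (rho ξ)⁻¹ = (2 * Real.pi)⁻¹ * ‖ξ‖ ^ (-1 : ℝ) := fun ξ => by
    rw [Real.rpow_neg_one, rho, mul_inv]
  -- Since `K` is bounded, this function and, below, the square `ρ⁻¹ |K|²` are at most a constant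
  -- times `‖ξ‖⁻¹` near the origin, which is integrable for `d ≥ 2`.
  have b1 : IntegrableOn (fun ξ => (rho ξ : ℂ)⁻¹ * K ξ) (Metric.ball 0 1) := by
    refine integrableOn_ball_of_norm_le_rpow (C := (2 * Real.pi)⁻¹ * C) (α := 1) hd1' hd1
      (Filter.Eventually.of_forall fun ξ => ?_) m1
    rw [n1, hrinv, mul_right_comm]
    gcongr
    exact hC ξ
  have b2 : IntegrableOn (fun ξ => ‖(√(rho ξ) : ℂ) * ((rho ξ : ℂ)⁻¹ * K ξ)‖ ^ 2)
      (Metric.ball 0 1) := by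
    refine integrableOn_ball_of_norm_le_rpow (C := (2 * Real.pi)⁻¹ * C ^ 2) (α := 1) hd1' hd1
      (Filter.Eventually.of_forall fun ξ => ?_) (m2.norm.pow 2)
    rw [Real.norm_eq_abs, abs_of_nonneg (sq_nonneg _), n2, mul_right_comm, ← hrinv, mul_pow, mul_pow,
      Real.sq_sqrt (rho_nonneg ξ)]
    by_cases h : rho ξ = 0
    · simp [h]
    · have e : rho ξ * ((rho ξ)⁻¹ ^ 2 * ‖K ξ‖ ^ 2) = (rho ξ)⁻¹ * ‖K ξ‖ ^ 2 := by
        field_simp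
      rw [e]
      have := rho_nonneg ξ
      gcongr
      exact hC ξ
  refine ⟨⟨(integrable_indicator_iff measurableSet_ball).2 b1, ?_⟩, ?_⟩
  · refine hK.memLp.mono (m1.indicator measurableSet_ball.compl)
      (Filter.Eventually.of_forall fun ξ => ?_)
    by_cases h : ξ ∈ Metric.ball (0 : Eucl d) 1
    · simp [h]
    · rw [indicator_of_mem h, n1]
      exact mul_le_of_le_one_left (norm_nonneg _) (inv_le_one_of_one_le₀ (one_le_rho h))
  · rw [memLp_two_iff_integrable_sq_norm m2, ← integrableOn_univ,
      ← union_compl_self (Metric.ball (0 : Eucl d) 1)]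
    refine b2.union ?_
    refine (hK.memLp.integrable_norm_pow two_ne_zero).integrableOn.mono' (m2.norm.pow 2).restrict ?_
    filter_upwards [ae_restrict_mem measurableSet_ball.compl] with ξ h
    have hr := one_le_rho h
    rw [Real.norm_eq_abs, abs_of_nonneg (sq_nonneg _), n2]
    gcongr
    have hs : √(rho ξ) * (rho ξ)⁻¹ ≤ 1 := by
      rw [← div_eq_mul_inv, div_le_one (by linarith), Real.sqrt_le_left (by linarith)]
      nlinarith
    rw [← mul_assoc]
    exact mul_le_of_le_one_left (norm_nonneg _) hs

end Order

/-! ### The potential and the reduction to the obstacle problem -/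

section Main

variable {d : ℕ}

lemma MeasureTheory.MemLp.sqrt_rho_conj {G : Eucl d → ℂ}
    (h : MemLp (fun ξ => (√(rho ξ) : ℂ) * starRingEnd ℂ (G ξ)) 2) :
    MemLp (fun ξ => (√(rho ξ) : ℂ) * G ξ) 2 := by
  have h2 := h.star
  convert h2 using 2 with ξ
  simp [mul_comm]

/-- The Dirichlet pairing of order one half on the Fourier side. -/
lemma integral_mul_sub_eq {V Z : Eucl d → ℝ} {G K : Eucl d → ℂ} (mV : MemLp V 2) (mZ : MemLp Z 2)
    (hV : HasFourier V fun ξ => (√(rho ξ) : ℂ) * G ξ)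
    (hZ : HasFourier Z fun ξ => (√(rho ξ) : ℂ) * K ξ) :
    ∫ y, V y * (Z y - V y) = (∫ ξ, (K ξ - G ξ) * (rho ξ * starRingEnd ℂ (G ξ))).re := by
  have mZV : MemLp (fun y => Z y - V y) 2 := mZ.sub mV
  rw [hV.integral_mul mV mZV (hZ.sub hV)]
  congr 2
  ext ξ
  have : (rho ξ : ℂ) = (√(rho ξ) : ℂ) * (√(rho ξ) : ℂ) := by
    rw [← Complex.ofReal_mul, Real.mul_self_sqrt (rho_nonneg ξ)]
  rw [this, map_mul, Complex.conj_ofReal]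
  ring

lemma integrable_mul_rho_mul {G K : Eucl d → ℂ} (hG : MemLp (fun ξ => (√(rho ξ) : ℂ) * G ξ) 2)
    (hK : MemLp (fun ξ => (√(rho ξ) : ℂ) * K ξ) 2) :
    Integrable fun ξ => G ξ * (rho ξ * K ξ) := by
  have h : Integrable fun ξ => (√(rho ξ) : ℂ) * G ξ * ((√(rho ξ) : ℂ) * K ξ) :=
    hG.integrable_mul hK
  refine h.congr (Filter.Eventually.of_forall fun ξ => ?_)
  have : (rho ξ : ℂ) = (√(rho ξ) : ℂ) * (√(rho ξ) : ℂ) := by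
    rw [← Complex.ofReal_mul, Real.mul_self_sqrt (rho_nonneg ξ)]
  simp only [this]
  ring

/-- The potential `(-Δ)^{-1/2} h`, in dimension at least two. -/
lemma exists_potential (hd : 2 ≤ d) {H : Eucl d → ℂ} (hH : IsBddL2 H) {h : Eucl d → ℝ}
    (mh : MemLp h 2) (hh : HasFourier h fun ξ => starRingEnd ℂ (H ξ)) :
    ∃ (w W : Eucl d → ℝ) (K : Eucl d → ℂ), MemLp W 2 ∧ HasFourier w K ∧
      HasFourier W (fun ξ => (√(rho ξ) : ℂ) * K ξ) ∧ HasFracLaplacian (1 / 2) w h ∧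
      ∀ᵐ ξ, rho ξ * starRingEnd ℂ (K ξ) = H ξ := by
  have hc : IsBddL2 fun ξ => starRingEnd ℂ (H ξ) :=
    ⟨hH.memLp.star, by simpa using hH.bound, fun ξ => by rw [hH.neg]⟩
  obtain ⟨h1, h2⟩ := hc.inv_rho_mul hd
  have hherm : ∀ ξ, (rho (-ξ) : ℂ)⁻¹ * starRingEnd ℂ (H (-ξ)) =
      starRingEnd ℂ ((rho ξ : ℂ)⁻¹ * starRingEnd ℂ (H ξ)) := fun ξ => by
    simp [rho_neg, hH.neg]
  obtain ⟨w, hw⟩ := h1.exists_hasFourier hherm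
  obtain ⟨W, mW, hW⟩ := exists_hasFourier_sqrt_rho_mul h2 hherm
  have hne : ∀ᵐ ξ : Eucl d, (rho ξ : ℂ) ≠ 0 := by
    obtain ⟨m, rfl⟩ : ∃ m, d = m + 1 := ⟨d - 1, by omega⟩
    filter_upwards [Measure.ae_ne volume (0 : Eucl (m + 1))] with ξ hξ
    exact_mod_cast fun h' => hξ (rho_eq_zero_iff.1 h')
  refine ⟨w, W, _, mW, hw, hW, ⟨mh, _, hw, hh.congr ?_⟩, ?_⟩
  · filter_upwards [hne] with ξ hξ
    have e : (2 * Real.pi * ‖ξ‖) ^ (2 * (1 / 2) : ℝ) = rho ξ := by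
      rw [rho]
      norm_num
    rw [e, mul_inv_cancel_left₀ hξ]
  · filter_upwards [hne] with ξ hξ
    rw [map_mul, map_inv₀, Complex.conj_ofReal, Complex.conj_conj, mul_inv_cancel_left₀ hξ]

end Main

/-- The obstacle problem solved by `u^n η`, with its right-hand side `h`, and, after subtraction of
the potential `w`, without right-hand side. For `d ≥ 2` the potential is `(-Δ)^{-1/2} h`. For
`d = 1` cutoff functions of arbitrarily small `Ḣ^{1/2}` norm force every solution of the obstacle
problem without right-hand side to vanish, so that `w = u^n η` there. -/
theorem proposition3p2 {d : ℕ} (hd : 1 ≤ d) (mu lam : ℝ) (hmu : 0 < mu) (hlam : 0 < lam)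
    (φ : Eucl d → ℝ) (hφ : MemHHalfBall φ)
    (F : Fin (d + 1) → Eucl (d + 1) → ℝ)
    (hF : ∀ j, MemLp (F j) 2 (volume.restrict (halfBall d)))
    (u : Fin (d + 1) → Eucl (d + 1) → ℝ) (t : Eucl d → ℝ)
    (hu : IsLameThinObstacleSolution mu lam φ F u t)
    (η : Eucl (d + 1) → ℝ) (hη_smooth : ContDiff ℝ ∞ η) (hη_nonneg : ∀ x, 0 ≤ η x)
    (hη_radial : ∀ x y, ‖x‖ = ‖y‖ → η x = η y)
    (x₀ : Eucl d) (hx₀ : x₀ ∈ flatBall d) (r : ℝ) (hr : 0 < r ∧ r < 1)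
    (hball : Metric.ball (flat x₀) r ⊆ Metric.ball 0 1)
    (hη_one : ∀ x ∈ Metric.ball (flat x₀) r, η x = 1)
    (hη_zero : ∀ x, 1 ≤ ‖x‖ → η x = 0) :
    ∃ h w v ψ : Eucl d → ℝ,
      MemLp h 2 ∧
      IsHalfLaplacianObstacleSolutionWith h (fun y => φ y * η (flat y))
        (fun y => t y * η (flat y)) ∧
      MemHdot (1 / 2) w ∧
      (2 ≤ d → HasFracLaplacian (1 / 2) w h) ∧
      (v = fun y => t y * η (flat y) - w y) ∧
      (ψ = fun y => φ y * η (flat y) - w y) ∧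
      MemHdot (1 / 2) v ∧
      MemHdot (1 / 2) ψ ∧
      IsHalfLaplacianObstacleSolution ψ v ∧
      {y | v y = ψ y} ∩ {y | η (flat y) ≠ 0} =
        {y | y ∈ flatBall d ∧ t y = φ y} ∩ {y | η (flat y) ≠ 0} := by
  have hq0 : ∀ y : Eucl d, 1 ≤ ‖y‖ → η (flat y) = 0 := fun y hy => hη_zero _ (by rwa [norm_flat])
  have hqs : ContDiff ℝ ∞ fun y : Eucl d => η (flat y) := hη_smooth.comp contDiff_flat
  obtain ⟨H, hH, hmain⟩ := hu.exists_source hmu hlam hF hη_smooth hη_nonneg hη_zero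
  obtain ⟨Du, huD, ht, hφt, -⟩ := hu
  obtain ⟨mv, iv, -⟩ := HasFlatTrace.trace_mul (huD _) ht hη_smooth hη_zero
  have hT := HasFlatTrace.memLp_sqrt_rho_mul (huD _) ht hη_smooth hη_zero
  obtain ⟨mf, iff, hfs⟩ := hφ.mul_cutoff hd hqs hq0
  set vb : Eucl d → ℝ := fun y => t y * η (flat y) with hvb
  set fb : Eucl d → ℝ := fun y => φ y * η (flat y) with hfb
  set Gv : Eucl d → ℂ := 𝓕 fun y => (vb y : ℂ) with hGv
  -- The half ball pairings use `e^{2πi x'·ξ}`, while `HasFourier` uses `e^{-2πi x·ξ}`; for real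
  -- functions the two transforms are conjugate.
  have hTc : (𝓕⁻ fun y => (vb y : ℂ)) = fun ξ => starRingEnd ℂ (Gv ξ) :=
    funext fun ξ => (conj_fourier_ofReal vb ξ).symm
  have hle : ∀ᵐ y, fb y ≤ vb y := by
    filter_upwards [(ae_restrict_iff' measurableSet_ball).1 hφt] with y hy
    by_cases h : y ∈ flatBall d
    · exact mul_le_mul_of_nonneg_right (hy h) (hη_nonneg _)
    · simp [hfb, hvb, hq0 y (by simpa [flatBall] using h)]
  change MemLp (fun ξ => (√(rho ξ) : ℂ) * (𝓕⁻ fun y => (vb y : ℂ)) ξ) 2 at hT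
  change ∀ z g, HasFourier z g → IsL1L2 g → MemLp (fun ξ => (√(rho ξ) : ℂ) * g ξ) 2 →
    (∀ᵐ y, fb y ≤ z y + vb y) →
    Integrable (fun ξ => g ξ * (rho ξ * (𝓕⁻ fun y => (vb y : ℂ)) ξ)) →
    (∫ ξ, g ξ * H ξ).re ≤ (∫ ξ, g ξ * (rho ξ * (𝓕⁻ fun y => (vb y : ℂ)) ξ)).re at hmain
  simp only [hTc] at hT hmain
  have hGvs : MemLp (fun ξ => (√(rho ξ) : ℂ) * Gv ξ) 2 := hT.sqrt_rho_conj
  have hv : HasFourier vb Gv := hasFourier_fourier mv iv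
  have hf := hasFourier_fourier mf iff
  obtain ⟨V, mV, hV⟩ := exists_hasFourier_sqrt_rho_mul hGvs (fourier_ofReal_neg vb)
  obtain ⟨U, mU, hU⟩ := exists_hasFourier_sqrt_rho_mul hfs (fourier_ofReal_neg fb)
  have hvV : HasFracLaplacian (1 / 4) vb V := hasFracLaplacian_quarter_iff.2 ⟨mV, _, hv, hV⟩
  have hfU : HasFracLaplacian (1 / 4) fb U := hasFracLaplacian_quarter_iff.2 ⟨mU, _, hf, hU⟩
  -- Parseval conjugates one factor, so `∫ h z = Re ∫ g H` requires `h` to have transform `conj H`.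
  -- The Hermitian symmetry of `H` makes `h` real.
  obtain ⟨h, mh, hh⟩ := exists_hasFourier_of_memLp (G := fun ξ => starRingEnd ℂ (H ξ))
    hH.memLp.star (fun ξ => by rw [hH.neg])
  have hwith : IsHalfLaplacianObstacleSolutionWith h fb vb := by
    refine ⟨mv, hle, V, hvV, fun ζ Z mζ hζ hζle => ?_⟩
    obtain ⟨mZ, K, hK, hZ⟩ := hasFracLaplacian_quarter_iff.1 hζ
    have hs : MemLp (fun ξ => (√(rho ξ) : ℂ) * (K ξ - Gv ξ)) 2 := by
      simp only [mul_sub]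
      exact (hZ.memLp mZ).sub hGvs
    have hz := hK.sub hv
    -- The direction is `z = ζ - vb`, with transform `K - Gv`; admissibility of `z` is exactly `ζ ≥
    -- fb`.
    have key := hmain _ _ hz (isL1L2_of_locallyIntegrable hz.1 hs) hs
      (by simpa using hζle) (integrable_mul_rho_mul hs hT)
    have mz : MemLp (fun y => ζ y - vb y) 2 := mζ.sub mv
    rw [integral_mul_sub_eq mV mZ hV hZ, hh.integral_mul mh mz hz]
    simpa only [Complex.conj_conj, mul_comm (H _)] using key
  -- Subtracting the same `w` does not affect equality, and the factor `η` cancels where it is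
  -- nonzero, which forces the point into the flat ball.
  have hcontact : ∀ w : Eucl d → ℝ, {y | vb y - w y = fb y - w y} ∩ {y | η (flat y) ≠ 0} =
      {y | y ∈ flatBall d ∧ t y = φ y} ∩ {y | η (flat y) ≠ 0} := by
    intro w
    ext y
    simp only [mem_inter_iff, mem_ofPred_eq, sub_left_inj, hvb, hfb]
    refine and_congr_left fun hy => ?_
    have hyb : y ∈ flatBall d := by
      by_contra h'
      exact hy (hq0 y (by simpa [flatBall] using h'))
    simp [hyb, mul_left_inj' hy]
  by_cases hd2 : 2 ≤ d
  · obtain ⟨w, W, K, mW, hw, hW, hwh, hKH⟩ := exists_potential hd2 hH mh hh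
    have hwW : HasFracLaplacian (1 / 4) w W := hasFracLaplacian_quarter_iff.2 ⟨mW, _, hw, hW⟩
    refine ⟨h, w, _, _, mh, hwith, hwW.memHdot, fun _ => hwh, rfl, rfl, (hvV.sub hwW).memHdot,
      (hfU.sub hwW).memHdot, ⟨?_, _, hvV.sub hwW, fun ζ Z hζ hζle => ?_⟩, hcontact w⟩
    · filter_upwards [hle] with y hy
      exact sub_le_sub_right hy _
    · obtain ⟨mZ, L, hL, hZ⟩ := hasFracLaplacian_quarter_iff.1 hζ
      have hVW : HasFourier (fun y => V y - W y) fun ξ => (√(rho ξ) : ℂ) * (Gv ξ - K ξ) := by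
        simpa only [mul_sub] using hV.sub hW
      have hs : MemLp (fun ξ => (√(rho ξ) : ℂ) * (L ξ - (Gv ξ - K ξ))) 2 := by
        simp only [mul_sub]
        exact (hZ.memLp mZ).sub (hGvs.sub (hW.memLp mW))
      have hz := hL.sub (hv.sub hw)
      have hg := isL1L2_of_locallyIntegrable hz.1 hs
      have i1 := integrable_mul_rho_mul hs hT
      -- For `ζ ≥ fb - w` the direction is `ζ - (vb - w)`, that is, `ζ + w` is a competitor for
      -- `vb`. It need not be in `L²`, which is why the source inequality covers `Ḣ^{1/2}`
      -- directions.
      have key := hmain _ _ hz hg hs (by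
        filter_upwards [hζle] with y hy
        linarith) i1
      have i2 := hg.integrable_mul hH.memLp hH.bound
      have mVW : MemLp (fun y => V y - W y) 2 := mV.sub mW
      rw [integral_mul_sub_eq mVW mZ hVW hZ]
      -- Since `ρ conj K = H`, replacing `vb` by `vb - w` subtracts exactly the source from the
      -- pairing.
      have e : ∫ ξ, (L ξ - (Gv ξ - K ξ)) * (rho ξ * starRingEnd ℂ (Gv ξ - K ξ)) =
          ∫ ξ, ((L ξ - (Gv ξ - K ξ)) * (rho ξ * starRingEnd ℂ (Gv ξ)) -
            (L ξ - (Gv ξ - K ξ)) * H ξ) := by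
        refine integral_congr_ae ?_
        filter_upwards [hKH] with ξ hξ
        rw [← hξ, map_sub]
        ring
      rw [e, integral_sub i1 i2, Complex.sub_re]
      linarith
  -- Here `w = vb`, so `v` and its quarter Laplacian vanish identically: the obstacle `fb - vb` is
  -- nonpositive and the pairing is zero.
  · refine ⟨h, vb, _, _, mh, hwith, hvV.memHdot, fun h' => absurd h' hd2, rfl, rfl,
      (hvV.sub hvV).memHdot, (hfU.sub hvV).memHdot, ⟨?_, _, hvV.sub hvV, fun ζ Z _ _ => ?_⟩,
      hcontact vb⟩
    · filter_upwards [hle] with y hy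
      exact sub_le_sub_right hy _
    · simp
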